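/- **Setting.** Let $P=(p_1,\dots,p_n)$, $n\ge 1$, be points in $\mathbb{R}^d$ and let $k\ge 1$, $1\le j\le d$ be integers. $(k,j)$-projective clustering asks for $k$ $j$-dimensional flats $\mathcal F_1,\dots,\mathcal F_k$ in $\mathbb{R}^d$ that minimize $\frac1n\sum_{i}\min_{l}\|p_i,\mathcal F_l\|^2$, where $\|p,\mathcal F\|$ is the Euclidean distance from $p$ to $\mathcal F$. Optimal clusters $C_1,\dots,C_k$ are obtained from an optimal solution by assigning each point to a nearest flat (ties are broken arbitrarily). The coefficient of variation of a finite family of numbers $x$ with mean $\mu$ is $\sqrt{E[(x-\mu)^2]}/E[|x-\mu|]$ (read as $0$ if the family is constant). The instance is *regular with factor $\omega\ge1$* if, for every $i$ and every direction $v$, the coefficient of variation of $\{\langle p-o_i,v\rangle: p\in C_i\}$ is at most $\omega$, where $o_i$ is the mean point of $C_i$. **Algorithm Projective-Clustering** (parameters: numbers $t,s$ of rounds and of points per round, sample size $r$, radius factor $\rho$, grid number $M$). 1. Dimension reduction by adaptive sampling: starting from $V=0$, repeat $t$ times: draw $s$ points of $P$ independently, each with probability proportional to its squared distance to $V$, and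 add them to $V$ (as a span). Let $P'$ be the orthogonal projection of $P$ to $V$. 2. Run Recursive-Projection $k$ times on $P'$: draw $r$ uniform random points of $P'$, and let $o$ run over the means of all nonempty subsets of this sample. For each $o$ grow a tree of height $j$. The flat of the root is $V$. At a node with flat $f$, project $P'$ to $f$, draw a fresh uniform sample $Q$ of size $r$ (with replacement), and create one child for the mean of each nonempty subset of $Q\cup(2o-Q)$ (Symmetric-Sampling). The flat of a child with point $t$ is the part of $f$ through $o$ that is orthogonal to the component of $t-o$ within $f$. The directions collected on a root-to-leaf path span a flat through $o$; if its dimension is less than $j$, it is extended to a $j$-flat by coordinate directions. 3. Let $L$ be the smallest objective value on $P$ among all combinations of $k$ flats, one from each of the $k$ runs. 4. Repeat step 2 with fresh randomness, replacing every point returned by Symmetric-Sampling by all the points of a grid in $V$ around it, of radius $\rho\sqrt L$ and grid length $\rho\sqrt L/M$ (with respect to an orthonormal basis of $V$). 5. Output a combination of $k$ flats, one from each run, with the smallest objective value on $P$. Running time is the number of steps on a machine on which an arithmetic operation or comparison of real numbers, a square root, a loop iteration and the draw of a uniform random index cost one step each, and drawing one of $n$ indices with given weights costs $2n+1$ steps.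 **Theorem 7.** There are a constant $c>0$, a constant $C$, a polynomial $\mathrm{poly}$, and a choice of the parameters $t,s,r,\rho,M$ as functions of $k,j,\epsilon,\alpha,\omega$ only, such that the following holds for all integers $k\ge1$, $1\le j\le d$, $n\ge 1$, all reals $0<\epsilon\le1$, $0<\alpha\le\frac1k$, $\omega\ge1$, and all $P$ consisting of $n$ points in $\mathbb{R}^d$. Algorithm Projective-Clustering always stops after at most $C\cdot 2^{\mathrm{poly}(kj\omega/(\epsilon\alpha))}\,n\,d$ steps. If moreover the $(k,j)$-projective clustering problem on $P$ is regular with factor $\omega$ and each of its optimal clusters has at least $\alpha n$ points (for some choice of the optimal solution and of the clusters), then with probability at least $c$ the output consists of $k$ $j$-flats $\mathcal F_1,\dots,\mathcal F_k$ with $$\frac1n\sum_{i=1}^n\min_{1\le l\le k}\|p_i,\mathcal F_l\|^2\le(1+\epsilon)\,Opt,$$ where $Opt$ is the optimal objective value on all points of $P$. -/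

import Mathlib

open scoped BigOperators

noncomputable section

namespace ProjClust

/-- Points of `ℝ^d` with the Euclidean norm. -/
abbrev Vec (d : ℕ) : Type := EuclideanSpace ℝ (Fin d)

/-! ### The problem -/

/-- A `j`-flat of `ℝ^d`: a nonempty affine subspace of dimension `j`. -/
def IsFlat {d : ℕ} (j : ℕ) (F : AffineSubspace ℝ (Vec d)) : Prop :=
  (F : Set (Vec d)).Nonempty ∧ Module.finrank ℝ F.direction = j

/-- The average squared distance of the points to the nearest one of `k` flats. -/
def objective {d n k : ℕ} (P : Fin n → Vec d) (F : Fin k → AffineSubspace ℝ (Vec d)) : ℝ :=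
  (∑ i, ⨅ l, Metric.infDist (P i) (F l : Set (Vec d)) ^ 2) / n

/-- `F` consists of `j`-flats and is an optimal solution of `(k,j)`-projective clustering on `P`. -/
def IsOptimal {d n k : ℕ} (j : ℕ) (P : Fin n → Vec d)
    (F : Fin k → AffineSubspace ℝ (Vec d)) : Prop :=
  (∀ l, IsFlat j (F l)) ∧
    ∀ G : Fin k → AffineSubspace ℝ (Vec d), (∀ l, IsFlat j (G l)) → objective P F ≤ objective P G

/-- `cl` assigns every point to a nearest flat of `F`. -/
def IsNearest {d n k : ℕ} (P : Fin n → Vec d) (F : Fin k → AffineSubspace ℝ (Vec d))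
    (cl : Fin n → Fin k) : Prop :=
  ∀ i l, Metric.infDist (P i) (F (cl i) : Set (Vec d)) ≤ Metric.infDist (P i) (F l : Set (Vec d))

/-- The points of the `l`-th cluster. -/
def cluster {n k : ℕ} (cl : Fin n → Fin k) (l : Fin k) : Finset (Fin n) :=
  Finset.univ.filter fun i => cl i = l

/-- The mean of a family of numbers over a finite set of indices. -/
def avg {n : ℕ} (s : Finset (Fin n)) (x : Fin n → ℝ) : ℝ := (∑ i ∈ s, x i) / s.card

/-- The mean point of a family of points over a finite set of indices. -/
def centroid {d n : ℕ} (s : Finset (Fin n)) (P : Fin n → Vec d) : Vec d :=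
  (s.card : ℝ)⁻¹ • ∑ i ∈ s, P i

/-- The coefficient of variation `√E[(x-μ)²] / E|x-μ|` of a finite family of numbers. If all the
numbers are equal, the quotient `0/0` is read as `0`, so that a constant family is not excluded
by an upper bound. -/
def coefVar {n : ℕ} (s : Finset (Fin n)) (x : Fin n → ℝ) : ℝ :=
  √(avg s fun i => (x i - avg s x) ^ 2) / avg s fun i => |x i - avg s x|

/-- The coefficient of variation of the points is at most `ω` along every direction. -/
def IsRegular {d n : ℕ} (ω : ℝ) (s : Finset (Fin n)) (P : Fin n → Vec d) : Prop :=
  ∀ v : Vec d, ‖v‖ = 1 → coefVar s (fun i => inner ℝ (P i - centroid s P) v) ≤ ω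

/-! ### Computations with a step count

The cost measure is that of a real random access machine: every arithmetic operation or
comparison of two numbers, every iteration of a loop and every uniform random index costs
one step. -/

/-- The result of a deterministic computation together with its number of steps. -/
structure Timed (α : Type) where
  val : α
  steps : ℕ

instance : Monad Timed where
  pure a := ⟨a, 0⟩
  bind m f := ⟨(f m.val).val, m.steps + (f m.val).steps⟩

/-- A randomized computation: a distribution on results with step counts. -/
def Rand (α : Type) : Type := PMF (Timed α)

/-- The joint distribution of the result and the number of steps. -/
def Rand.law {α : Type} (m : Rand α) : PMF (Timed α) := m

instance : Monad Rand where
  pure a := PMF.pure ⟨a, 0⟩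
  bind m f := PMF.bind m fun t => PMF.map (fun s => ⟨s.val, t.steps + s.steps⟩) (f t.val)

/-- A deterministic computation as a randomized one. -/
def det {α : Type} (t : Timed α) : Rand α := PMF.pure t

/-- Spend `c` steps. -/
def tick (c : ℕ) : Timed Unit := ⟨(), c⟩

def radd (x y : ℝ) : Timed ℝ := ⟨x + y, 1⟩
def rsub (x y : ℝ) : Timed ℝ := ⟨x - y, 1⟩
def rmul (x y : ℝ) : Timed ℝ := ⟨x * y, 1⟩
def rdiv (x y : ℝ) : Timed ℝ := ⟨x / y, 1⟩
def rsqrt (x : ℝ) : Timed ℝ := ⟨√x, 1⟩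
def rle (x y : ℝ) : Timed Bool := ⟨decide (x ≤ y), 1⟩
def rIsZero (x : ℝ) : Timed Bool := ⟨decide (x = 0), 1⟩

/-- A uniformly random index. -/
def uniformIndex (n : ℕ) [NeZero n] : Rand (Fin n) :=
  PMF.map (fun i => ⟨i, 1⟩) (PMF.uniformOfFintype (Fin n))

/-- A random index with probabilities proportional to the weights (negative weights count as `0`),
or `none` if all weights vanish; one pass for the total weight and one pass for the search. -/
def weightedIndex {n : ℕ} (w : Fin n → ℝ) : Rand (Option (Fin n)) :=
  if h : ∑ i, ENNReal.ofReal (w i) = 0 then PMF.pure ⟨none, 2 * n + 1⟩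
  else PMF.map (fun i => ⟨some i, 2 * n + 1⟩)
    (PMF.normalize (fun i => ENNReal.ofReal (w i)) (by rwa [tsum_fintype])
      (by rw [tsum_fintype]; exact ENNReal.sum_ne_top.2 fun _ _ => ENNReal.ofReal_ne_top))

/-- Loop filling an array. -/
def table {n : ℕ} {α : Type} (f : Fin n → Timed α) : Timed (Fin n → α) :=
  ⟨fun i => (f i).val, ∑ i, ((f i).steps + 1)⟩

/-- Loop adding up numbers; the extra two steps per iteration are the addition and the loop. -/
def sumLoop {n : ℕ} (f : Fin n → Timed ℝ) : Timed ℝ :=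
  ⟨∑ i, (f i).val, ∑ i, ((f i).steps + 2)⟩

/-- Loop over a list with an accumulator. -/
def foldSteps {α β : Type} (f : β → α → Timed β) : β → List α → Timed β
  | b, [] => pure b
  | b, a :: l => do
      tick 1
      let b' ← f b a
      foldSteps f b' l

/-- Loop applying a deterministic computation to all the elements of a list. -/
def mapSteps {α β : Type} (f : α → Timed β) : List α → Timed (List β)
  | [] => pure []
  | a :: l => do
      tick 1
      let b ← f a
      let bs ← mapSteps f l
      pure (b :: bs)

/-- Loop applying a randomized computation, with fresh randomness, to all the elements of a list. -/
def forEach {α β : Type} (f : α → Rand β) : List α → Rand (List β)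
  | [] => pure []
  | a :: l => do
      det (tick 1)
      let b ← f a
      let bs ← forEach f l
      pure (b :: bs)

/-- Run a randomized computation `m` times with fresh randomness. -/
def repeatRand {α : Type} (m : ℕ) (f : Rand α) : Rand (List α) :=
  forEach (fun _ => f) (List.range m)

/-- Concatenate lists; one step for every element and every list. -/
def concat {α : Type} (L : List (List α)) : Timed (List α) :=
  ⟨L.flatten, L.flatten.length + L.length⟩

/-! ### Vector operations -/

section Vectors

variable {d n : ℕ}

/-- Loop computing the coordinates of a vector. -/
def vecLoop (f : Fin d → Timed ℝ) : Timed (Vec d) :=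
  ⟨WithLp.toLp 2 fun i => (f i).val, ∑ i, ((f i).steps + 1)⟩

def vadd (x y : Vec d) : Timed (Vec d) := vecLoop fun i => radd (x i) (y i)
def vsub (x y : Vec d) : Timed (Vec d) := vecLoop fun i => rsub (x i) (y i)
def vsmul (c : ℝ) (x : Vec d) : Timed (Vec d) := vecLoop fun i => rmul c (x i)
def vdot (x y : Vec d) : Timed ℝ := sumLoop fun i => rmul (x i) (y i)
def vzero : Timed (Vec d) := vecLoop fun _ => pure 0
def vunit (i : Fin d) : Timed (Vec d) := vecLoop fun l => pure (if l = i then 1 else 0)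

/-- The component of `x` orthogonal to the pairwise orthogonal nonzero vectors `W`. -/
def orthPart (W : List (Vec d)) (x : Vec d) : Timed (Vec d) :=
  foldSteps (fun y w => do
    let a ← vdot y w
    let b ← vdot w w
    let c ← rdiv a b
    let z ← vsmul c w
    vsub y z) x W

/-- Gram-Schmidt step: adjoin to `W` the component of `x` orthogonal to `W`, unless it is zero. -/
def extend (W : List (Vec d)) (x : Vec d) : Timed (List (Vec d)) := do
  let y ← orthPart W x
  let s ← vdot y y
  let z ← rIsZero s
  pure (if z then W else y :: W)

/-- The squared distance of `x` to the span of `W`. -/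
def sqDist (W : List (Vec d)) (x : Vec d) : Timed ℝ := do
  let y ← orthPart W x
  vdot y y

/-- The orthogonal projection of `x` to the span of `W`. -/
def project (W : List (Vec d)) (x : Vec d) : Timed (Vec d) := do
  let y ← orthPart W x
  vsub x y

/-- The mean point of a nonempty list of points. -/
def meanPoint (S : List (Vec d)) : Timed (Vec d) := do
  let z ← vzero
  let s ← foldSteps vadd z S
  let c ← rdiv 1 S.length
  vsmul c s

/-- The mean points of all the nonempty subsets of a list of points. -/
def subsetMeans (S : List (Vec d)) : Timed (List (Vec d)) :=
  mapSteps meanPoint (S.sublists.filter fun T => !T.isEmpty)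

/-- `W` scaled to unit vectors. -/
def normalizeAll (W : List (Vec d)) : Timed (List (Vec d)) :=
  mapSteps (fun w => do
    let a ← vdot w w
    let b ← rsqrt a
    let c ← rdiv 1 b
    vsmul c w) W

/-- A flat is stored as one of its points and a list of pairwise orthogonal nonzero directions. -/
abbrev FlatRep (d : ℕ) : Type := Vec d × List (Vec d)

/-- The flat that is stored. -/
def FlatRep.toFlat (F : FlatRep d) : AffineSubspace ℝ (Vec d) :=
  AffineSubspace.mk' F.1 (Submodule.span ℝ {w | w ∈ F.2})

/-- Adjoin directions to `W`, taken from the first `j` unit vectors, until there are `j` of them. -/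
def complete (j : ℕ) (W : List (Vec d)) : Timed (List (Vec d)) :=
  foldSteps (fun W i => do
    tick 1
    if W.length < j then do
      let e ← vunit i
      extend W e
    else pure W) W ((List.finRange d).take j)

/-- The squared distance of a point to a stored flat. -/
def flatSqDist (p : Vec d) (F : FlatRep d) : Timed ℝ := do
  let x ← vsub p F.1
  sqDist F.2 x

/-- The squared distance of a point to the nearest flat of a nonempty list. -/
def minSqDist (p : Vec d) : List (FlatRep d) → Timed ℝ
  | [] => pure 0
  | F :: Fs => do
      let a ← flatSqDist p F
      foldSteps (fun a G => do
        let b ← flatSqDist p G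
        let c ← rle a b
        pure (if c then a else b)) a Fs

/-- The objective value of a list of flats. -/
def evalObjective (P : Fin n → Vec d) (Fs : List (FlatRep d)) : Timed ℝ := do
  let s ← sumLoop fun i => minSqDist (P i) Fs
  rdiv s n

/-- Among all the ways to select one flat from each of the given lists, one with the smallest
objective value, together with that value. -/
def bestCombination (P : Fin n → Vec d) (T : List (List (FlatRep d))) :
    Timed (Option (ℝ × List (FlatRep d))) :=
  foldSteps (fun best Fs => do
    tick T.length
    let v ← evalObjective P Fs
    match best with
    | none => pure (some (v, Fs))
    | some b => do
        let c ← rle b.1 v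
        pure (if c then some b else some (v, Fs))) none T.sections

/-! ### The algorithm -/

/-- `m` independent uniformly random elements of an array of points. -/
def drawSample [NeZero n] (m : ℕ) (P : Fin n → Vec d) : Rand (List (Vec d)) :=
  repeatRand m (do
    let i ← uniformIndex n
    pure (P i))

/-- One round of adaptive sampling: `s` independent points of `P`, each with probability
proportional to its squared distance to the span of `W`, are adjoined to `W`. -/
def adaptiveRound (P : Fin n → Vec d) (s : ℕ) (W : List (Vec d)) : Rand (List (Vec d)) := do
  let w ← det (table fun i => sqDist W (P i))
  let I ← repeatRand s (weightedIndex w)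
  det (foldSteps (fun W o =>
    match o with
    | none => pure W
    | some i => extend W (P i)) W I)

/-- Rounds of adaptive sampling, one after the other. -/
def adaptiveRounds (P : Fin n → Vec d) (s : ℕ) : ℕ → List (Vec d) → Rand (List (Vec d))
  | 0, W => pure W
  | t + 1, W => do
      let W' ← adaptiveRound P s W
      adaptiveRounds P s t W'

/-- Dimension reduction by adaptive sampling: an orthonormal basis of the span of the sampled
points. -/
def dimensionReduction (P : Fin n → Vec d) (t s : ℕ) : Rand (List (Vec d)) := do
  let W ← adaptiveRounds P s t []
  det (normalizeAll W)

/-- Algorithm Symmetric-Sampling: the mean points of all the (nonempty) subsets of `S ∪ -S`, where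
`-S` is the reflection of `S` in `o`. -/
def symmetricSampling (S : List (Vec d)) (o : Vec d) : Timed (List (Vec d)) := do
  let S' ← mapSteps (fun s => do
    let q ← vadd o o
    vsub q s) S
  subsetMeans (S ++ S')

/-- The grid points `∑ z_b (a b)`, `b ∈ B`, with integers `-M ≤ z_b ≤ M`. -/
def grid (M : ℕ) (a : ℝ) : List (Vec d) → Timed (List (Vec d))
  | [] => do
      let z ← vzero
      pure [z]
  | b :: B => do
      let G ← grid M a B
      let L ← mapSteps (fun t : ℕ => do
        let z ← rsub t M
        let c ← rmul z a
        let v ← vsmul c b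
        mapSteps (fun g => vadd g v) G) (List.range (2 * M + 1))
      concat L

/-- The subtree below a node of Algorithm Recursive-Projection: the lists of directions that belong
to its leaves. The node is given by its height `h` above the leaves and by the pairwise orthogonal
directions `W` collected so far; its flat `f` is the orthogonal complement of `W` through `o`.
The points are projected to `f`, a random sample of size `r` is drawn, and Algorithm
Symmetric-Sampling is applied; around each resulting point there is one child for every grid
vector in `G`. The direction of the child is the component within `f` of the vector from `o` to
the child's point; where it is zero no direction is added. -/
def growTree [NeZero n] (P : Fin n → Vec d) (o : Vec d) (r : ℕ) (G : List (Vec d)) :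
    ℕ → List (Vec d) → Rand (List (List (Vec d)))
  | 0, W => pure [W]
  | h + 1, W => do
      let P' ← det (table fun i => do
        let x ← vsub (P i) o
        let y ← orthPart W x
        vadd o y)
      let Q ← drawSample r P'
      let S ← det (symmetricSampling Q o)
      let C ← det (mapSteps (fun s => mapSteps (fun g => vadd s g) G) S)
      let C' ← det (concat C)
      let L ← forEach (fun t => do
        let x ← det (vsub t o)
        let W' ← det (extend W x)
        growTree P o r G h W') C'
      det (concat L)

/-- Algorithm Recursive-Projection for an unknown cluster: the point `o` runs over the mean points
of the (nonempty) subsets of a random sample of size `r`. The result is the list of the `j`-flats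
that are given by the root-to-leaf paths. -/
def recursiveProjection [NeZero n] (P : Fin n → Vec d) (j r : ℕ) (G : List (Vec d)) :
    Rand (List (FlatRep d)) := do
  let Q ← drawSample r P
  let O ← det (subsetMeans Q)
  let L ← forEach (fun o => do
    let Ws ← growTree P o r G j []
    det (mapSteps (fun W => do
      let W' ← complete j W
      pure (o, W')) Ws)) O
  det (concat L)

/-- The parameters of Algorithm Projective-Clustering: the number of rounds of adaptive sampling and
the number of points per round in the dimension reduction, the sample size, the ratio of the radius
of the balls to `√L`, and the number of grid cells along a radius. -/
structure Params where
  rounds : ℕ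
  batch : ℕ
  sampleSize : ℕ
  radius : ℝ
  cells : ℕ

/-- Algorithm Projective-Clustering: (1) reduce the dimension; (2, 3) run Algorithm
Recursive-Projection `k` times; (4) let `L` be the smallest objective value of a combination of `k`
flats, one from each tree; (5) run Algorithm Recursive-Projection `k` times again, with a grid
around each point returned by Algorithm Symmetric-Sampling; (6) return the best combination. -/
def projectiveClustering [NeZero n] (prm : Params) (k j : ℕ) (P : Fin n → Vec d) :
    Rand (List (FlatRep d)) := do
  let B ← dimensionReduction P prm.rounds prm.batch
  let P' ← det (table fun i => project B (P i))
  let z ← det vzero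
  let T ← repeatRand k (recursiveProjection P' j prm.sampleSize [z])
  let best ← det (bestCombination P T)
  let L := (best.map Prod.fst).getD 0
  let q ← det (rsqrt L)
  let R ← det (rmul prm.radius q)
  let a ← det (rdiv R prm.cells)
  let G ← det (grid prm.cells a B)
  let T' ← repeatRand k (recursiveProjection P' j prm.sampleSize G)
  let best' ← det (bestCombination P T')
  pure ((best'.map Prod.snd).getD [])

end Vectors

/-- The output represents `k` flats of dimension `j` whose objective value is at most `c`. -/
def IsSolution {d n : ℕ} (k j : ℕ) (P : Fin n → Vec d) (c : ℝ) (out : List (FlatRep d)) : Prop :=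
  ∃ G : Fin k → AffineSubspace ℝ (Vec d), out.map FlatRep.toFlat = List.ofFn G ∧
    (∀ l, IsFlat j (G l)) ∧ objective P G ≤ c

end ProjClust

end

open scoped BigOperators

noncomputable section

namespace ProjClust

open scoped ENNReal

/-! All constants are governed by one integer `X = ⌈kjω/(εα)⌉`, which dominates every combination of
the parameters that occurs (`IsScale`). Let `Z` be `n` times the optimum.

Dimension reduction. Sampling with probability proportional to the squared distance to the current
span `W` has two effects. First, let `S` be a subspace through `W` with squared error at most `B`,
for instance the span of the centers and directions of all optimal flats. With high probability a
sampled point lets `S` be tilted so that it contains the point, at the price of a factor `4Γ` in the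
squared error, and one dimension less is missing (`adaptiveRound_tilt`). After about `k(j+1)` rounds
the error of the span itself is bounded by a data-independent multiple of `Z`
(`adaptiveRounds_start`). Secondly, importance sampling estimates the few linear combinations of the
points that describe near-optimal flats, with variance proportional to the current error
(`adaptiveRound_captures`). So each further round halves the excess of the error over `2Z`
(`adaptiveRounds_captures`), and the final span `V` contains flats of cost at most `(1 + 1/(8X)) Z`
(`dimensionReduction_captures`).

Following one cluster down a tree. Some subset of a uniform sample has a mean close to the centroid
of the cluster in the directions orthogonal to the sought flat (`exists_center_except`). Below this
root an invisible subspace `S ≤ V` containing the collected directions `W` is maintained. By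
regularity a positive fraction of the cluster has a component in `S` orthogonal to `W` comparable to
the root mean square, and Chebyshev's inequality makes most of these points also close to `S`
(`card_isGood_ge`). If such a good point is sampled, `S` can be tilted to contain it
(`exists_tilt`): the tilt turns `S` by an angle of order distance over length, so the deviation
grows by a bounded factor (`exists_tilt_of_isGood`). At height zero no dimension is left and `S` is
the span of the collected directions (`growTree_except`). This gives a constant factor, `(36X²)^j`
before squaring, for the objective `L` of the first phase (`IsScale.coarse_except`).

The grid. The value `L` calibrates lengths: a good point is within a multiple of `√L` of `S`, so a
grid of that radius contains a vector that moves it almost onto `S`, and tilting towards the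
corrected point adds only a small error (`exists_tilt_of_near`, `IsScale.fine_except`). As `L`
exceeds the optimum at most by a factor depending on `X`, a number of cells depending on `X` is
enough, and the errors sum to `ε Z` (`IsScale.sum_fine_le`).

Assembly. The `l`-th of the `k` independent runs is held responsible for the `l`-th cluster
(`except_repeatRand_ofFn`), and the best combination is no worse than the one that handles all
clusters (`bestCombination_spec`). All failure probabilities add up to less than `1/2`
(`IsScale.projectiveClustering_except`). The running time is a count of tree nodes: the depth is `j`
and the degree depends on `X` only, while every node costs `O(nd)` up to factors in `X`
(`always_projectiveClustering`). -/

/-! ### Expectations, failure probabilities and step bounds of randomized computations -/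

/-- The expected value of a function of the result. -/
def Rand.mean {α : Type} (m : Rand α) (g : α → ℝ≥0∞) : ℝ≥0∞ := ∑' t, m.law t * g t.val

/-- The indicator function of the failure of `G`. -/
def failure {α : Type} (G : α → Prop) : α → ℝ≥0∞ := {a | ¬ G a}.indicator 1

/-- The result satisfies `G` except with probability at most `δ`. -/
def Rand.Except {α : Type} (m : Rand α) (δ : ℝ) (G : α → Prop) : Prop :=
  0 ≤ δ ∧ m.mean (failure G) ≤ ENNReal.ofReal δ

/-- The result always satisfies `G` and is always obtained within `c` steps. -/
def Rand.Always {α : Type} (m : Rand α) (c : ℕ) (G : α → Prop) : Prop :=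
  ∀ t ∈ m.law.support, G t.val ∧ t.steps ≤ c

/-- The result of a deterministic computation satisfies `G` and is obtained within `c` steps. -/
def Timed.Always {α : Type} (m : Timed α) (c : ℕ) (G : α → Prop) : Prop :=
  G m.val ∧ m.steps ≤ c

section Framework

variable {α β : Type}

@[simp] lemma Timed.val_pure (a : α) : (pure a : Timed α).val = a := rfl
@[simp] lemma Timed.steps_pure (a : α) : (pure a : Timed α).steps = 0 := rfl
@[simp] lemma Timed.val_bind (m : Timed α) (f : α → Timed β) :
    (m >>= f).val = (f m.val).val := rfl
@[simp] lemma Timed.steps_bind (m : Timed α) (f : α → Timed β) :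
    (m >>= f).steps = m.steps + (f m.val).steps := rfl
@[simp] lemma tick_val (c : ℕ) : (tick c).val = () := rfl
@[simp] lemma tick_steps (c : ℕ) : (tick c).steps = c := rfl

lemma failure_of {G : α → Prop} {a : α} (h : G a) : failure G a = 0 := by
  simp [failure, h]

lemma failure_of_not {G : α → Prop} {a : α} (h : ¬ G a) : failure G a = 1 := by
  simp [failure, h]

lemma failure_le_one (G : α → Prop) (a : α) : failure G a ≤ 1 := by
  by_cases h : G a <;> simp [failure_of, failure_of_not, h]

lemma failure_mono {G : α → Prop} {G' : β → Prop} {a : α} {b : β} (h : G a → G' b) :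
    failure G' b ≤ failure G a := by
  by_cases hG : G a
  · simp [failure_of (h hG)]
  · rw [failure_of_not hG]; exact failure_le_one _ _

lemma law_det (t : Timed α) : (det t).law = PMF.pure t := rfl

lemma law_pure (a : α) : (pure a : Rand α).law = PMF.pure ⟨a, 0⟩ := rfl

lemma law_bind (m : Rand α) (f : α → Rand β) : (m >>= f).law =
    m.law.bind fun t => (f t.val).law.map fun s => ⟨s.val, t.steps + s.steps⟩ := rfl

lemma law_uniformIndex (n : ℕ) [NeZero n] : (uniformIndex n).law =
    PMF.map (fun i => ⟨i, 1⟩) (PMF.uniformOfFintype (Fin n)) := rfl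

lemma law_weightedIndex_of_eq_zero {n : ℕ} {w : Fin n → ℝ}
    (h : ∑ i, ENNReal.ofReal (w i) = 0) :
    (weightedIndex w).law = PMF.pure ⟨none, 2 * n + 1⟩ := by
  have : weightedIndex w = PMF.pure ⟨none, 2 * n + 1⟩ := dif_pos h
  rw [this]; rfl

lemma law_weightedIndex_of_ne_zero {n : ℕ} {w : Fin n → ℝ}
    (h : ∑ i, ENNReal.ofReal (w i) ≠ 0) :
    (weightedIndex w).law = PMF.map (fun i => ⟨some i, 2 * n + 1⟩)
    (PMF.normalize (fun i => ENNReal.ofReal (w i)) (by rwa [tsum_fintype])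
      (by rw [tsum_fintype]; exact ENNReal.sum_ne_top.2 fun _ _ => ENNReal.ofReal_ne_top)) := by
  have : weightedIndex w = PMF.map (fun i => ⟨some i, 2 * n + 1⟩)
    (PMF.normalize (fun i => ENNReal.ofReal (w i)) (by rwa [tsum_fintype])
      (by rw [tsum_fintype]; exact ENNReal.sum_ne_top.2 fun _ _ => ENNReal.ofReal_ne_top)) :=
    dif_neg h
  rw [this]; rfl

lemma Rand.mean_mono (m : Rand α) {g h : α → ℝ≥0∞} (H : ∀ a, g a ≤ h a) :
    m.mean g ≤ m.mean h :=
  ENNReal.tsum_le_tsum fun _ => mul_le_mul_right (H _) _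

lemma Rand.mean_const (m : Rand α) (c : ℝ≥0∞) : m.mean (fun _ => c) = c := by
  unfold Rand.mean
  rw [ENNReal.tsum_mul_right, PMF.tsum_coe, one_mul]

lemma Rand.mean_add (m : Rand α) (g h : α → ℝ≥0∞) :
    m.mean (fun a => g a + h a) = m.mean g + m.mean h := by
  unfold Rand.mean
  rw [← ENNReal.tsum_add]
  exact tsum_congr fun t => mul_add _ _ _

lemma Rand.mean_sum {ι : Type*} (s : Finset ι) (m : Rand α) (g : ι → α → ℝ≥0∞) :
    m.mean (fun a => ∑ i ∈ s, g i a) = ∑ i ∈ s, m.mean (g i) := by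
  classical
  induction s using Finset.induction_on with
  | empty => simpa using m.mean_const 0
  | insert a s ha ih => simp only [Finset.sum_insert ha, Rand.mean_add, ih]

lemma Rand.mean_mul_const (m : Rand α) (g : α → ℝ≥0∞) (c : ℝ≥0∞) :
    m.mean (fun a => g a * c) = m.mean g * c := by
  unfold Rand.mean
  rw [← ENNReal.tsum_mul_right]
  exact tsum_congr fun t => (mul_assoc _ _ _).symm

lemma tsum_map_mul {γ δ : Type} (p : PMF γ) (f : γ → δ) (g : δ → ℝ≥0∞) :
    ∑' b, (p.map f) b * g b = ∑' a, p a * g (f a) := by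
  classical
  simp_rw [PMF.map_apply, ← ENNReal.tsum_mul_right]
  rw [ENNReal.tsum_comm]
  refine tsum_congr fun a => ?_
  rw [tsum_eq_single (f a)]
  · simp
  · intro b hb
    simp [hb]

@[simp] lemma Rand.mean_det (t : Timed α) (g : α → ℝ≥0∞) : (det t).mean g = g t.val := by
  classical
  rw [Rand.mean, law_det, tsum_eq_single t]
  · simp
  · intro b hb
    rw [PMF.pure_apply_of_ne _ _ hb, zero_mul]

@[simp] lemma Rand.mean_pure (a : α) (g : α → ℝ≥0∞) : (pure a : Rand α).mean g = g a :=
  Rand.mean_det ⟨a, 0⟩ g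

lemma Rand.mean_bind (m : Rand α) (f : α → Rand β) (g : β → ℝ≥0∞) :
    (m >>= f).mean g = m.mean fun a => (f a).mean g := by
  unfold Rand.mean
  rw [law_bind]
  simp_rw [PMF.bind_apply, ← ENNReal.tsum_mul_right]
  rw [ENNReal.tsum_comm]
  refine tsum_congr fun t => ?_
  simp_rw [mul_assoc]
  rw [ENNReal.tsum_mul_left, tsum_map_mul]

lemma Rand.toOuterMeasure_ge {m : Rand α} {δ : ℝ} {G : α → Prop} (h : m.Except δ G) :
    ENNReal.ofReal (1 - δ) ≤ m.law.toOuterMeasure {t | G t.val} := by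
  have h1 : 1 ≤ m.law.toOuterMeasure {t | G t.val} + m.mean (failure G) := by
    rw [PMF.toOuterMeasure_apply, Rand.mean, ← ENNReal.tsum_add, ← PMF.tsum_coe m.law]
    refine ENNReal.tsum_le_tsum fun t => ?_
    by_cases h : G t.val
    · simp [Set.indicator, h]
    · simp [failure_of_not h]
  rw [ENNReal.ofReal_sub _ h.1, ENNReal.ofReal_one]
  exact tsub_le_iff_right.2 (h1.trans (by gcongr; exact h.2))

lemma Rand.Except.mono {m : Rand α} {δ δ' : ℝ} {G G' : α → Prop} (h : m.Except δ G)
    (hδ : δ ≤ δ') (hG : ∀ a, G a → G' a) : m.Except δ' G' :=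
  ⟨h.1.trans hδ, le_trans (m.mean_mono fun a => failure_mono (hG a))
    (h.2.trans (ENNReal.ofReal_le_ofReal hδ))⟩

lemma Rand.mean_failure_le_one (m : Rand α) (G : α → Prop) : m.mean (failure G) ≤ 1 :=
  le_trans (m.mean_mono fun b => failure_le_one G b) (m.mean_const 1).le

/-- The union bound for consecutive stages: if the first stage fails, the second is charged with
probability one. -/
lemma Rand.Except.bind {m : Rand α} {f : α → Rand β} {δ₁ δ₂ : ℝ} {G : α → Prop} {H : β → Prop}
    (h₁ : m.Except δ₁ G) (hδ : 0 ≤ δ₂) (h₂ : ∀ a, G a → (f a).Except δ₂ H) :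
    (m >>= f).Except (δ₁ + δ₂) H := by
  refine ⟨add_nonneg h₁.1 hδ, ?_⟩
  rw [Rand.mean_bind, ENNReal.ofReal_add h₁.1 hδ]
  calc m.mean (fun a => (f a).mean (failure H))
      ≤ m.mean (fun a => failure G a + ENNReal.ofReal δ₂) := by
        refine m.mean_mono fun a => ?_
        by_cases ha : G a
        · exact le_add_left (h₂ a ha).2
        · rw [failure_of_not ha]
          exact le_add_right ((f a).mean_failure_le_one H)
    _ = m.mean (failure G) + ENNReal.ofReal δ₂ := by
        rw [Rand.mean_add, Rand.mean_const]
    _ ≤ _ := by gcongr; exact h₁.2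

lemma Rand.Except.and {m : Rand α} {δ₁ δ₂ : ℝ} {G H : α → Prop}
    (h₁ : m.Except δ₁ G) (h₂ : m.Except δ₂ H) : m.Except (δ₁ + δ₂) fun a => G a ∧ H a := by
  refine ⟨add_nonneg h₁.1 h₂.1, ?_⟩
  rw [ENNReal.ofReal_add h₁.1 h₂.1]
  refine le_trans (le_trans (m.mean_mono fun a => ?_) (m.mean_add _ _).le) (add_le_add h₁.2 h₂.2)
  by_cases ha : G a <;> by_cases hb : H a <;> simp [failure, ha, hb]

lemma Rand.except_pure {a : α} {G : α → Prop} (h : G a) : (pure a : Rand α).Except 0 G :=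
  ⟨le_rfl, by simp [failure_of h]⟩

lemma Rand.except_det {t : Timed α} {G : α → Prop} (h : G t.val) : (det t).Except 0 G :=
  ⟨le_rfl, by simp [failure_of h]⟩

lemma Rand.Except.det_bind {t : Timed α} {f : α → Rand β} {δ : ℝ} {H : β → Prop}
    (h : (f t.val).Except δ H) : (det t >>= f).Except δ H :=
  ⟨h.1, by rw [Rand.mean_bind, Rand.mean_det]; exact h.2⟩

/-- Markov's inequality. -/
lemma Rand.except_of_mean_le {m : Rand α} {g : α → ℝ} {b δ : ℝ} (hδ : 0 < δ) (hb : 0 ≤ b)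
    (h : m.mean (fun a => ENNReal.ofReal (g a)) ≤ ENNReal.ofReal b) :
    m.Except δ fun a => g a ≤ b / δ := by
  refine ⟨hδ.le, ?_⟩
  rcases hb.eq_or_lt with rfl | hb
  · have h0 : m.mean (fun a => ENNReal.ofReal (g a)) = 0 := by simpa using h
    have : m.mean (failure fun a => g a ≤ 0 / δ) = 0 := by
      unfold Rand.mean at h0 ⊢
      rw [ENNReal.tsum_eq_zero] at h0 ⊢
      intro t
      rcases mul_eq_zero.1 (h0 t) with h1 | h1
      · rw [h1, zero_mul]
      · have : g t.val ≤ 0 := by simpa using h1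
        rw [failure_of (by simpa using this), mul_zero]
    rw [this]; exact zero_le
  · have hc : 0 < b / δ := by positivity
    have h1 : m.mean (failure fun a => g a ≤ b / δ)
        ≤ m.mean (fun a => ENNReal.ofReal (g a) * ENNReal.ofReal (b / δ)⁻¹) := by
      refine m.mean_mono fun a => ?_
      by_cases ha : g a ≤ b / δ
      · rw [failure_of (G := fun a => g a ≤ b / δ) ha]; exact zero_le
      · have : (1 : ℝ) ≤ g a * (b / δ)⁻¹ := by
          rw [← div_eq_mul_inv, le_div_iff₀ hc]; linarith
        rw [← ENNReal.ofReal_mul' (by positivity),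
          failure_of_not (G := fun a => g a ≤ b / δ) ha]
        exact ENNReal.one_le_ofReal.2 this
    refine h1.trans ?_
    rw [Rand.mean_mul_const]
    refine (mul_le_mul_left h _).trans ?_
    rw [← ENNReal.ofReal_mul hb.le]
    refine ENNReal.ofReal_le_ofReal (le_of_eq ?_)
    field_simp

lemma Rand.Always.except {m : Rand α} {c : ℕ} {G : α → Prop} (h : m.Always c G) :
    m.Except 0 G := by
  refine ⟨le_rfl, ?_⟩
  rw [ENNReal.ofReal_zero, nonpos_iff_eq_zero]
  unfold Rand.mean
  rw [ENNReal.tsum_eq_zero]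
  intro t
  by_cases ht : t ∈ m.law.support
  · rw [failure_of (h t ht).1, mul_zero]
  · rw [(PMF.apply_eq_zero_iff _ _).2 ht, zero_mul]

lemma Rand.Except.and_always {m : Rand α} {δ : ℝ} {c : ℕ} {G H : α → Prop}
    (h₁ : m.Except δ G) (h₂ : m.Always c H) : m.Except δ fun a => G a ∧ H a := by
  simpa using h₁.and h₂.except

lemma Rand.Always.mono {m : Rand α} {c c' : ℕ} {G G' : α → Prop} (h : m.Always c G)
    (hc : c ≤ c') (hG : ∀ a, G a → G' a) : m.Always c' G' :=
  fun t ht => ⟨hG _ (h t ht).1, (h t ht).2.trans hc⟩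

lemma Rand.Always.bind {m : Rand α} {f : α → Rand β} {c₁ c₂ : ℕ} {G : α → Prop} {H : β → Prop}
    (h₁ : m.Always c₁ G) (h₂ : ∀ a, G a → (f a).Always c₂ H) :
    (m >>= f).Always (c₁ + c₂) H := by
  intro t ht
  rw [law_bind, PMF.mem_support_bind_iff] at ht
  obtain ⟨u, hu, ht⟩ := ht
  rw [PMF.mem_support_map_iff] at ht
  obtain ⟨s, hs, rfl⟩ := ht
  have := h₁ u hu
  have h3 := h₂ _ this.1 s hs
  exact ⟨h3.1, add_le_add this.2 h3.2⟩

lemma Rand.always_pure {a : α} {G : α → Prop} (h : G a) : (pure a : Rand α).Always 0 G := by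
  intro t ht
  rw [law_pure, PMF.mem_support_pure_iff] at ht
  subst ht
  exact ⟨h, le_rfl⟩

lemma Rand.always_det {t : Timed α} {c : ℕ} {G : α → Prop} (h : t.Always c G) :
    (det t).Always c G := by
  intro u hu
  rw [law_det, PMF.mem_support_pure_iff] at hu
  subst hu
  exact h

lemma Timed.Always.bind {m : Timed α} {f : α → Timed β} {c₁ c₂ : ℕ} {G : α → Prop}
    {H : β → Prop} (h₁ : m.Always c₁ G) (h₂ : ∀ a, G a → (f a).Always c₂ H) :
    (m >>= f).Always (c₁ + c₂) H :=
  ⟨(h₂ _ h₁.1).1, add_le_add h₁.2 (h₂ _ h₁.1).2⟩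

/-! ### Random indices -/

lemma mean_uniformIndex {n : ℕ} [NeZero n] (g : Fin n → ℝ≥0∞) :
    (uniformIndex n).mean g = ∑ i, (n : ℝ≥0∞)⁻¹ * g i := by
  rw [Rand.mean, law_uniformIndex, tsum_map_mul, tsum_fintype]
  simp

lemma mean_uniformIndex_ofReal {n : ℕ} [NeZero n] {g : Fin n → ℝ} (hg : ∀ i, 0 ≤ g i) :
    (uniformIndex n).mean (fun i => ENNReal.ofReal (g i)) =
      ENNReal.ofReal (∑ i, (n : ℝ)⁻¹ * g i) := by
  have hn : (0 : ℝ) < n := Nat.cast_pos.2 (NeZero.pos n)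
  rw [mean_uniformIndex, ENNReal.ofReal_sum_of_nonneg
    (fun i _ => mul_nonneg (inv_nonneg.2 hn.le) (hg i))]
  refine Finset.sum_congr rfl fun i _ => ?_
  rw [ENNReal.ofReal_mul (inv_nonneg.2 hn.le), ENNReal.ofReal_inv_of_pos hn,
    ENNReal.ofReal_natCast]

lemma mean_weightedIndex_ofReal {n : ℕ} {w : Fin n → ℝ} (hw : ∀ i, 0 ≤ w i)
    (hE : 0 < ∑ i, w i) {g : Option (Fin n) → ℝ} (hg : ∀ i, 0 ≤ g i) :
    (weightedIndex w).mean (fun i => ENNReal.ofReal (g i)) =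
      ENNReal.ofReal (∑ i, w i / (∑ l, w l) * g (some i)) := by
  have hs : ∑ i, ENNReal.ofReal (w i) = ENNReal.ofReal (∑ i, w i) :=
    (ENNReal.ofReal_sum_of_nonneg fun i _ => hw i).symm
  have hne : ∑ i, ENNReal.ofReal (w i) ≠ 0 := by
    rw [hs]; simpa using hE
  rw [Rand.mean, law_weightedIndex_of_ne_zero hne, tsum_map_mul, tsum_fintype, ENNReal.ofReal_sum_of_nonneg
    (fun i _ => mul_nonneg (div_nonneg (hw i) hE.le) (hg _))]
  refine Finset.sum_congr rfl fun i _ => ?_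
  rw [PMF.normalize_apply, tsum_fintype, hs, ENNReal.ofReal_mul (div_nonneg (hw i) hE.le),
    ENNReal.ofReal_div_of_pos hE, div_eq_mul_inv]

lemma mean_weightedIndex_of_sum_eq_zero {n : ℕ} {w : Fin n → ℝ}
    (hE : ∀ i, w i = 0) (g : Option (Fin n) → ℝ≥0∞) :
    (weightedIndex w).mean g = g none := by
  have hne : ∑ i, ENNReal.ofReal (w i) = 0 := by simp [hE]
  rw [Rand.mean, law_weightedIndex_of_eq_zero hne]
  exact Rand.mean_det ⟨none, 2 * n + 1⟩ g

lemma always_uniformIndex (n : ℕ) [NeZero n] : (uniformIndex n).Always 1 fun _ => True := by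
  intro t ht
  rw [law_uniformIndex, PMF.mem_support_map_iff] at ht
  obtain ⟨i, -, rfl⟩ := ht
  exact ⟨trivial, le_rfl⟩

lemma always_weightedIndex {n : ℕ} (w : Fin n → ℝ) :
    (weightedIndex w).Always (2 * n + 1) fun _ => True := by
  intro t ht
  by_cases h : ∑ i, ENNReal.ofReal (w i) = 0
  · rw [law_weightedIndex_of_eq_zero h, PMF.mem_support_pure_iff] at ht
    subst ht
    exact ⟨trivial, le_rfl⟩
  · rw [law_weightedIndex_of_ne_zero h, PMF.mem_support_map_iff] at ht
    obtain ⟨i, -, rfl⟩ := ht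
    exact ⟨trivial, le_rfl⟩

/-! ### Loops -/

lemma foldSteps_cons (f : β → α → Timed β) (b : β) (a : α) (l : List α) :
    (foldSteps f b (a :: l)).val = (foldSteps f (f b a).val l).val := rfl

/-- The invariant `I m` depends on the number `m` of completed iterations, because the sizes of the
lists, and hence the costs, grow along the loop. The cap `N` lets the cost bound be verified only
for sizes that are reached. -/
lemma always_foldSteps {f : β → α → Timed β} {c : ℕ} (I : ℕ → β → Prop) (l : List α)
    (N : ℕ) (hf : ∀ m < N, ∀ b, I m b → ∀ a ∈ l, (f b a).Always c (I (m + 1))) :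
    ∀ m b, m + l.length ≤ N → I m b →
      (foldSteps f b l).Always (l.length * (c + 1)) (I (m + l.length)) := by
  induction l with
  | nil => intro m b _ hb; exact ⟨hb, by simp [foldSteps]⟩
  | cons a l ih =>
    intro m b hm hb
    simp only [List.length_cons] at hm
    have h1 := hf m (by omega) b hb a (by simp)
    have h2 := ih (fun m hm b hb a ha => hf m hm b hb a (by simp [ha])) (m + 1) (f b a).val
      (by omega) h1.1
    refine ⟨by rw [foldSteps_cons, List.length_cons]; convert h2.1 using 1; omega, ?_⟩
    have : (foldSteps f b (a :: l)).steps
      = 1 + ((f b a).steps + (foldSteps f (f b a).val l).steps) := rfl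
    rw [this, List.length_cons]
    have := h1.2; have := h2.2
    rw [add_mul]; omega

@[simp] lemma mapSteps_val (f : α → Timed β) (l : List α) :
    (mapSteps f l).val = l.map fun a => (f a).val := by
  induction l with
  | nil => rfl
  | cons a l ih =>
    change (f a).val :: (mapSteps f l).val = _
    rw [ih]; rfl

lemma mapSteps_steps_le {f : α → Timed β} {c : ℕ} {l : List α} (h : ∀ a ∈ l, (f a).steps ≤ c) :
    (mapSteps f l).steps ≤ l.length * (c + 1) := by
  induction l with
  | nil => exact Nat.zero_le _
  | cons a l ih =>
    have h1 : (mapSteps f (a :: l)).steps = 1 + ((f a).steps + ((mapSteps f l).steps + 0)) := rfl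
    have h2 := ih fun b hb => h b (by simp [hb])
    have h3 := h a (by simp)
    rw [h1, List.length_cons, add_mul]; omega

lemma always_forEach {f : α → Rand β} {c : ℕ} {G : β → Prop} {l : List α}
    (h : ∀ a ∈ l, (f a).Always c G) :
    (forEach f l).Always (l.length * (c + 1))
      fun L => L.length = l.length ∧ ∀ b ∈ L, G b := by
  induction l with
  | nil => exact (Rand.always_pure (by simp)).mono (by simp) fun _ h => h
  | cons a l ih =>
    have h2 := ih fun b hb => h b (by simp [hb])
    refine Rand.Always.mono (c := 1 + (c + (l.length * (c + 1) + 0)))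
      (Rand.Always.bind (G := fun _ => True) (Rand.always_det ⟨trivial, le_rfl⟩) fun _ _ =>
      Rand.Always.bind (h a (by simp)) fun b hb => Rand.Always.bind h2 fun L hL =>
        Rand.always_pure (G := fun L : List β => L.length = l.length + 1 ∧ ∀ b ∈ L, G b) ?_) ?_ ?_
    · simpa [hL.1] using ⟨hb, hL.2⟩
    · rw [List.length_cons, add_mul]; omega
    · exact fun _ h => h

lemma mean_forEach_cons (f : α → Rand β) (a : α) (l : List α) (g : List β → ℝ≥0∞) :
    (forEach f (a :: l)).mean g =
      (f a).mean fun b => (forEach f l).mean fun L => g (b :: L) := by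
  simp only [forEach, Rand.mean_bind, Rand.mean_det, Rand.mean_pure]

@[simp] lemma mean_forEach_nil (f : α → Rand β) (g : List β → ℝ≥0∞) :
    (forEach f []).mean g = g [] := by
  simp only [forEach, Rand.mean_pure]

/-- The loop list of `repeatRand` serves as a counter only; this replaces the shifted tail of a
range by a range. -/
lemma mean_forEach_const_congr (f : Rand β) (l : List α) (l' : List α)
    (h : l.length = l'.length) (g : List β → ℝ≥0∞) :
    (forEach (fun _ => f) l).mean g = (forEach (fun _ => f) l').mean g := by
  induction l generalizing l' g with
  | nil => rw [List.length_nil] at h; rw [List.length_eq_zero_iff.1 h.symm]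
  | cons a l ih =>
    cases l' with
    | nil => simp at h
    | cons a' l' =>
      simp only [mean_forEach_cons]
      congr 1; funext b
      exact ih l' (by simpa using h) _

@[simp] lemma mean_repeatRand_zero (f : Rand β) (g : List β → ℝ≥0∞) :
    (repeatRand 0 f).mean g = g [] := mean_forEach_nil _ _

lemma mean_repeatRand_succ (s : ℕ) (f : Rand β) (g : List β → ℝ≥0∞) :
    (repeatRand (s + 1) f).mean g = f.mean fun b => (repeatRand s f).mean fun L => g (b :: L) := by
  unfold repeatRand
  rw [List.range_succ_eq_map, mean_forEach_cons]
  congr 1; funext b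
  exact mean_forEach_const_congr f _ _ (by simp) _

/-- Only the iteration for `a` is followed and all others are averaged out, so the failure
probability does not grow with the length of the list. This is why a tree may have many children
when only one of them is wanted. -/
lemma except_forEach_exists {f : α → Rand β} {l : List α} {a : α} (ha : a ∈ l) {δ : ℝ}
    {H : β → Prop} (h : (f a).Except δ H) : (forEach f l).Except δ fun L => ∃ b ∈ L, H b := by
  refine ⟨h.1, le_trans ?_ h.2⟩
  induction l with
  | nil => simp at ha
  | cons a' l ih =>
    rw [mean_forEach_cons]
    rcases List.mem_cons.1 ha with rfl | ha
    · refine Rand.mean_mono _ fun b => ?_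
      by_cases hb : H b
      · refine le_trans (Rand.mean_mono _ (h := fun _ => 0) fun L => ?_) (by simp [Rand.mean_const])
        rw [failure_of ⟨b, by simp, hb⟩]
      · refine le_trans (Rand.mean_mono _ (h := fun _ => 1) fun L => failure_le_one _ _) ?_
        simp [Rand.mean_const, failure_of_not hb]
    · refine le_trans (Rand.mean_mono _ (h := fun _ => (f a).mean (failure H))
        fun b => le_trans (Rand.mean_mono _ fun L => ?_) (ih ha)) (Rand.mean_const _ _).le
      refine failure_mono ?_
      rintro ⟨c, hc, hc'⟩
      exact ⟨c, by simp [hc], hc'⟩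

lemma except_repeatRand_exists {f : Rand β} {s : ℕ} (hs : 0 < s) {δ : ℝ}
    {H : β → Prop} (h : f.Except δ H) : (repeatRand s f).Except δ fun L => ∃ b ∈ L, H b :=
  except_forEach_exists (a := 0) (List.mem_range.2 hs) h

lemma mean_repeatRand_failure_exists_le (f : Rand β) (H : β → Prop) (s : ℕ) :
    (repeatRand s f).mean (failure fun L => ∃ b ∈ L, H b) ≤ f.mean (failure H) ^ s := by
  induction s with
  | zero => rw [mean_repeatRand_zero]; simpa using failure_le_one _ _
  | succ s ih =>
    rw [mean_repeatRand_succ, pow_succ', ← Rand.mean_mul_const]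
    refine Rand.mean_mono _ fun b => ?_
    by_cases hb : H b
    · refine le_trans (Rand.mean_mono _ (h := fun _ => 0) fun L => ?_) (by simp [Rand.mean_const])
      rw [failure_of ⟨b, by simp, hb⟩]
    · rw [failure_of_not hb, one_mul]
      refine le_trans (Rand.mean_mono _ fun L => failure_mono ?_) ih
      rintro ⟨c, hc, hc'⟩
      exact ⟨c, by simp [hc], hc'⟩

/-- Among `s` independent trials with success probability at least `p` one succeeds, except with
probability at most `1 / (s p)`. -/
lemma except_repeatRand_exists_of_prob {f : Rand β} {H : β → Prop} {p : ℝ} (hp : 0 < p)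
    (hp1 : p ≤ 1) (h : f.Except (1 - p) H) {s : ℕ} (hs : 0 < s) :
    (repeatRand s f).Except (1 / (s * p)) fun L => ∃ b ∈ L, H b := by
  refine ⟨by positivity, (mean_repeatRand_failure_exists_le f H s).trans ?_⟩
  refine (pow_le_pow_left₀ zero_le h.2 s).trans ?_
  rw [← ENNReal.ofReal_pow (by linarith)]
  refine ENNReal.ofReal_le_ofReal ?_
  have hs' : (0 : ℝ) < s := Nat.cast_pos.2 hs
  rw [le_div_iff₀ (by positivity)]
  -- Bernoulli's inequality together with `(1 - p)(1 + p) ≤ 1` gives `(1 - p)^s ≤ 1 / (1 + s p)`.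
  have h1 : 1 + (s : ℝ) * p ≤ (1 + p) ^ s := one_add_mul_le_pow (by linarith) s
  have h2 : (0 : ℝ) ≤ (1 - p) ^ s := pow_nonneg (by linarith) s
  have h3 : (1 - p) ^ s * (1 + p) ^ s ≤ 1 := by
    rw [← mul_pow]
    exact pow_le_one₀ (by nlinarith) (by nlinarith)
  nlinarith [mul_le_mul_of_nonneg_left h1 h2]

/-- A union bound over the iterations. -/
lemma except_forEach_forall₂ {f : α → Rand β} {l : List α} {δ : ℝ} (hδ : 0 ≤ δ)
    {H : α → β → Prop} (h : ∀ a ∈ l, (f a).Except δ (H a)) :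
    (forEach f l).Except (l.length * δ) fun L => List.Forall₂ H l L := by
  induction l with
  | nil => simpa [forEach] using Rand.except_pure (G := fun L => List.Forall₂ H [] L) .nil
  | cons a l ih =>
    have h2 := ih fun b hb => h b (by simp [hb])
    refine Rand.Except.det_bind (Rand.Except.mono (Rand.Except.bind (h a (by simp))
      (by positivity) fun b hb => Rand.Except.bind h2 le_rfl fun L hL =>
        Rand.except_pure (G := fun L => List.Forall₂ H (a :: l) L) (.cons hb hL)) ?_ fun _ h => h)
    rw [List.length_cons]; push_cast; linarith

/-- The second moment of a sum of independent centered vectors. -/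
lemma mean_repeatRand_norm_sq_le {E : Type*} [NormedAddCommGroup E] {f : Rand α}
    {φ : α → E} {v : ℝ} (hv : 0 ≤ v)
    (h : ∀ y : E, f.mean (fun a => ENNReal.ofReal (‖y + φ a‖ ^ 2)) ≤
      ENNReal.ofReal (‖y‖ ^ 2 + v)) (s : ℕ) (y : E) :
    (repeatRand s f).mean (fun L => ENNReal.ofReal (‖y + (L.map φ).sum‖ ^ 2)) ≤
      ENNReal.ofReal (‖y‖ ^ 2 + s * v) := by
  induction s generalizing y with
  | zero => simp
  | succ s ih =>
    rw [mean_repeatRand_succ]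
    -- The first sample is absorbed into the offset `y`. Having the one-step bound for every offset
    -- replaces the computation with vanishing cross terms.
    calc _ ≤ f.mean (fun a => ENNReal.ofReal (‖y + φ a‖ ^ 2) + ENNReal.ofReal (s * v)) := by
          refine f.mean_mono fun a => ?_
          rw [← ENNReal.ofReal_add (by positivity) (by positivity)]
          refine le_trans (le_of_eq ?_) (ih (y + φ a))
          simp only [List.map_cons, List.sum_cons, add_assoc]
      _ = f.mean (fun a => ENNReal.ofReal (‖y + φ a‖ ^ 2)) + ENNReal.ofReal (s * v) := by
          rw [Rand.mean_add, Rand.mean_const]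
      _ ≤ ENNReal.ofReal (‖y‖ ^ 2 + v) + ENNReal.ofReal (s * v) := by gcongr; exact h y
      _ = _ := by
          rw [← ENNReal.ofReal_add (by positivity) (by positivity)]
          congr 1; push_cast; ring

/-- Centering a random vector does not increase its second moment. -/
lemma sum_mul_norm_add_sub_sq_le {E ι : Type*} [NormedAddCommGroup E] [InnerProductSpace ℝ E]
    [Fintype ι] {π : ι → ℝ} (h1 : ∑ i, π i = 1) (ξ : ι → E) (y : E) :
    ∑ i, π i * ‖y + (ξ i - ∑ l, π l • ξ l)‖ ^ 2 ≤ ‖y‖ ^ 2 + ∑ i, π i * ‖ξ i‖ ^ 2 := by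
  set μ := ∑ l, π l • ξ l with hμ
  -- Expanding around `y - μ` makes the weighted sum equal to `‖y‖² - ‖μ‖² + ∑ π ‖ξ‖²`, and the term
  -- `-‖μ‖²` is dropped.
  have key : ∀ i, π i * ‖y + (ξ i - μ)‖ ^ 2 =
      π i * ‖y - μ‖ ^ 2 + 2 * inner ℝ (y - μ) (π i • ξ i) + π i * ‖ξ i‖ ^ 2 := by
    intro i
    have : y + (ξ i - μ) = (y - μ) + ξ i := by abel
    rw [this, norm_add_sq_real, inner_smul_right]; ring
  simp_rw [key, Finset.sum_add_distrib, ← Finset.sum_mul, ← Finset.mul_sum, ← inner_sum, h1, ← hμ]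
  have : ‖y‖ ^ 2 = ‖y - μ‖ ^ 2 + 2 * inner ℝ (y - μ) μ + ‖μ‖ ^ 2 := by
    rw [← norm_add_sq_real, sub_add_cancel]
  nlinarith [sq_nonneg ‖μ‖]

lemma mean_drawSample {n d : ℕ} [NeZero n] (P : Fin n → Vec d) (r : ℕ)
    (g : List (Vec d) → ℝ≥0∞) :
    (drawSample r P).mean g = (repeatRand r (uniformIndex n)).mean fun I => g (I.map P) := by
  unfold drawSample
  induction r generalizing g with
  | zero => simp
  | succ r ih =>
    simp only [mean_repeatRand_succ, Rand.mean_bind, Rand.mean_pure, ih, List.map_cons]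

lemma except_drawSample {n d : ℕ} [NeZero n] {P : Fin n → Vec d} {r : ℕ} {δ : ℝ}
    {G : List (Vec d) → Prop}
    (h : (repeatRand r (uniformIndex n)).Except δ fun I => G (I.map P)) :
    (drawSample r P).Except δ G :=
  ⟨h.1, by rw [mean_drawSample]; exact h.2⟩

end Framework

/-! ### The component orthogonal to a subspace -/

section Residual

variable {d : ℕ}

/-- The component of a vector orthogonal to a subspace. -/
def res (U : Submodule ℝ (Vec d)) : Vec d →ₗ[ℝ] Vec d :=
  LinearMap.id - (U.starProjection : Vec d →ₗ[ℝ] Vec d)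

lemma res_apply (U : Submodule ℝ (Vec d)) (x : Vec d) : res U x = x - U.starProjection x := rfl

lemma inner_res_left (U : Submodule ℝ (Vec d)) (x : Vec d) {u : Vec d} (hu : u ∈ U) :
    inner ℝ (res U x) u = 0 := U.starProjection_inner_eq_zero x u hu

lemma inner_res_right (U : Submodule ℝ (Vec d)) (x : Vec d) {u : Vec d} (hu : u ∈ U) :
    inner ℝ u (res U x) = 0 := by rw [real_inner_comm, inner_res_left U x hu]

lemma sub_res_mem (U : Submodule ℝ (Vec d)) (x : Vec d) : x - res U x ∈ U := by
  simp [res_apply]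

lemma proj_mem (U : Submodule ℝ (Vec d)) (x : Vec d) : U.starProjection x ∈ U := by simp

lemma eq_res_of {U : Submodule ℝ (Vec d)} {x y : Vec d} (h1 : x - y ∈ U)
    (h2 : ∀ u ∈ U, inner ℝ y u = 0) : y = res U x := by
  have := Submodule.eq_starProjection_of_mem_of_inner_eq_zero (u := x) (v := x - y) h1
    (fun u hu => by simpa using h2 u hu)
  rw [res_apply, this]; abel

lemma res_of_mem {U : Submodule ℝ (Vec d)} {x : Vec d} (hx : x ∈ U) : res U x = 0 := by
  rw [res_apply, U.starProjection_eq_self_iff.2 hx, sub_self]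

lemma norm_sub_sq_eq (U : Submodule ℝ (Vec d)) (x : Vec d) {u : Vec d} (hu : u ∈ U) :
    ‖x - u‖ ^ 2 = ‖res U x‖ ^ 2 + ‖U.starProjection x - u‖ ^ 2 := by
  have h : x - u = res U x + (U.starProjection x - u) := by rw [res_apply]; abel
  rw [h, norm_add_sq_real, inner_res_left U x (U.sub_mem (proj_mem U x) hu)]
  ring

lemma norm_res_le (U : Submodule ℝ (Vec d)) (x : Vec d) {u : Vec d} (hu : u ∈ U) :
    ‖res U x‖ ≤ ‖x - u‖ := by
  have := norm_sub_sq_eq U x hu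
  refine (sq_le_sq₀ (norm_nonneg _) (norm_nonneg _)).1 ?_
  nlinarith [sq_nonneg ‖U.starProjection x - u‖]

lemma norm_res_le_norm (U : Submodule ℝ (Vec d)) (x : Vec d) : ‖res U x‖ ≤ ‖x‖ := by
  simpa using norm_res_le U x U.zero_mem

lemma norm_res_mono {U U' : Submodule ℝ (Vec d)} (h : U ≤ U') (x : Vec d) :
    ‖res U' x‖ ≤ ‖res U x‖ := norm_res_le U' x (h (proj_mem U x))

lemma norm_res_sq_of_le {W S : Submodule ℝ (Vec d)} (h : W ≤ S) (x : Vec d) :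
    ‖res W x‖ ^ 2 = ‖res S x‖ ^ 2 + ‖S.starProjection x - W.starProjection x‖ ^ 2 :=
  norm_sub_sq_eq S x (h (proj_mem W x))

/-- Splitting a point along a subspace that contains the direction. -/
lemma norm_res_sub_sq {D V : Submodule ℝ (Vec d)} (h : D ≤ V) (x : Vec d) {c : Vec d}
    (hc : c ∈ V) :
    ‖res D (x - c)‖ ^ 2 = ‖res V x‖ ^ 2 + ‖res D (V.starProjection x - c)‖ ^ 2 := by
  have h1 : res D (x - c) = res V x + res D (V.starProjection x - c) := by
    have h2 : res D (res V x) = res V x := by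
      rw [res_apply D, sub_eq_self, Submodule.starProjection_apply_eq_zero_iff]
      exact fun u hu => inner_res_right V x (h hu)
    have h3 : x - c = res V x + (V.starProjection x - c) := by rw [res_apply]; abel
    rw [h3, map_add, h2]
  have h4 : res D (V.starProjection x - c) ∈ V := by
    rw [res_apply]
    exact V.sub_mem (V.sub_mem (proj_mem V x) hc) (h (proj_mem D _))
  rw [h1, norm_add_sq_real, inner_res_left V x h4]; ring

end Residual

/-! ### Vector operations -/

section VectorOps

variable {d n : ℕ}

@[simp] lemma vadd_val (x y : Vec d) : (vadd x y).val = x + y := by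
  ext i; simp [vadd, vecLoop, radd]
@[simp] lemma vsub_val (x y : Vec d) : (vsub x y).val = x - y := by
  ext i; simp [vsub, vecLoop, rsub]
@[simp] lemma vsmul_val (c : ℝ) (x : Vec d) : (vsmul c x).val = c • x := by
  ext i; simp [vsmul, vecLoop, rmul]
@[simp] lemma vzero_val : (vzero : Timed (Vec d)).val = 0 := by
  ext i; simp [vzero, vecLoop]
@[simp] lemma vunit_val (i : Fin d) : (vunit i).val = EuclideanSpace.single i 1 := by
  ext l; simp [vunit, vecLoop]
@[simp] lemma vdot_val (x y : Vec d) : (vdot x y).val = inner ℝ x y := by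
  simp [vdot, sumLoop, rmul, PiLp.inner_apply, mul_comm]
@[simp] lemma rdiv_val (x y : ℝ) : (rdiv x y).val = x / y := rfl
@[simp] lemma rsub_val (x y : ℝ) : (rsub x y).val = x - y := rfl
@[simp] lemma rmul_val (x y : ℝ) : (rmul x y).val = x * y := rfl
@[simp] lemma rsqrt_val (x : ℝ) : (rsqrt x).val = √x := rfl
@[simp] lemma rle_val (x y : ℝ) : (rle x y).val = decide (x ≤ y) := rfl
@[simp] lemma rIsZero_val (x : ℝ) : (rIsZero x).val = decide (x = 0) := rfl
@[simp] lemma table_val {α : Type} (f : Fin n → Timed α) :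
    (table f).val = fun i => (f i).val := rfl
@[simp] lemma sumLoop_val (f : Fin n → Timed ℝ) : (sumLoop f).val = ∑ i, (f i).val := rfl
@[simp] lemma concat_val {α : Type} (L : List (List α)) : (concat L).val = L.flatten := rfl

@[simp] lemma vadd_steps (x y : Vec d) : (vadd x y).steps = 2 * d := by
  simp [vadd, vecLoop, radd, mul_comm]
@[simp] lemma vsub_steps (x y : Vec d) : (vsub x y).steps = 2 * d := by
  simp [vsub, vecLoop, rsub, mul_comm]
@[simp] lemma vsmul_steps (c : ℝ) (x : Vec d) : (vsmul c x).steps = 2 * d := by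
  simp [vsmul, vecLoop, rmul, mul_comm]
@[simp] lemma vzero_steps : (vzero : Timed (Vec d)).steps = d := by
  simp [vzero, vecLoop]
@[simp] lemma vunit_steps (i : Fin d) : (vunit i).steps = d := by
  simp [vunit, vecLoop]
@[simp] lemma vdot_steps (x y : Vec d) : (vdot x y).steps = 3 * d := by
  simp [vdot, sumLoop, rmul, mul_comm]
@[simp] lemma rdiv_steps (x y : ℝ) : (rdiv x y).steps = 1 := rfl
@[simp] lemma rsub_steps (x y : ℝ) : (rsub x y).steps = 1 := rfl
@[simp] lemma rmul_steps (x y : ℝ) : (rmul x y).steps = 1 := rfl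
@[simp] lemma rsqrt_steps (x : ℝ) : (rsqrt x).steps = 1 := rfl
@[simp] lemma rle_steps (x y : ℝ) : (rle x y).steps = 1 := rfl
@[simp] lemma rIsZero_steps (x : ℝ) : (rIsZero x).steps = 1 := rfl
@[simp] lemma concat_steps {α : Type} (L : List (List α)) :
    (concat L).steps = L.flatten.length + L.length := rfl

lemma table_steps_le {α : Type} {f : Fin n → Timed α} {c : ℕ} (h : ∀ i, (f i).steps ≤ c) :
    (table f).steps ≤ n * (c + 1) := by
  change ∑ i, ((f i).steps + 1) ≤ _
  refine (Finset.sum_le_sum fun i _ => Nat.add_le_add_right (h i) 1).trans ?_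
  simp

lemma sumLoop_steps_le {f : Fin n → Timed ℝ} {c : ℕ} (h : ∀ i, (f i).steps ≤ c) :
    (sumLoop f).steps ≤ n * (c + 2) := by
  change ∑ i, ((f i).steps + 2) ≤ _
  refine (Finset.sum_le_sum fun i _ => Nat.add_le_add_right (h i) 2).trans ?_
  simp

/-! ### Lists of orthogonal directions -/

/-- The span of a list of vectors. -/
def sp (W : List (Vec d)) : Submodule ℝ (Vec d) := Submodule.span ℝ {w | w ∈ W}

/-- The vectors of the list are nonzero and pairwise orthogonal. -/
def Orth (W : List (Vec d)) : Prop :=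
  W.Pairwise (fun x y => inner ℝ x y = 0) ∧ ∀ w ∈ W, w ≠ 0

lemma orth_nil : Orth ([] : List (Vec d)) := ⟨.nil, by simp⟩

@[simp] lemma sp_nil : sp ([] : List (Vec d)) = ⊥ := by simp [sp]

lemma sp_cons (w : Vec d) (W : List (Vec d)) : sp (w :: W) = Submodule.span ℝ {w} ⊔ sp W := by
  rw [sp, sp, ← Submodule.span_union]; congr 1; ext x; simp

lemma mem_sp {w : Vec d} {W : List (Vec d)} (h : w ∈ W) : w ∈ sp W := Submodule.subset_span h

lemma orth_cons {w : Vec d} {W : List (Vec d)} :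
    Orth (w :: W) ↔ (∀ u ∈ sp W, inner ℝ w u = 0) ∧ w ≠ 0 ∧ Orth W := by
  have key : (∀ u ∈ sp W, inner ℝ w u = 0) ↔ ∀ u ∈ W, inner ℝ w u = 0 := by
    refine ⟨fun h u hu => h u (mem_sp hu), fun h u hu => ?_⟩
    refine Submodule.span_induction (p := fun u _ => inner ℝ w u = 0) (fun u hu => h u hu)
      (by simp) (fun x y _ _ hx hy => by rw [inner_add_right, hx, hy, add_zero])
      (fun a x _ hx => by rw [inner_smul_right, hx, mul_zero]) hu
  rw [key]
  simp only [Orth, List.pairwise_cons, List.mem_cons, forall_eq_or_imp]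
  tauto

lemma orthPart_cons (w : Vec d) (W : List (Vec d)) (x : Vec d) :
    (orthPart (w :: W) x).val = (orthPart W (x - (inner ℝ x w / inner ℝ w w) • w)).val := by
  unfold orthPart
  rw [foldSteps_cons]
  simp

/-- Subtracting one component after the other is a projection because `w` is orthogonal to the span
of the remaining directions, so that the later subtractions do not reintroduce a component along
`w`. -/
lemma orthPart_val {W : List (Vec d)} (hW : Orth W) (x : Vec d) :
    (orthPart W x).val = res (sp W) x := by
  induction W generalizing x with
  | nil =>
    refine eq_res_of (by simp [orthPart, foldSteps]) fun u hu => ?_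
    rw [sp_nil, Submodule.mem_bot] at hu
    simp [hu]
  | cons w W ih =>
    rw [orth_cons] at hW
    rw [orthPart_cons]
    set y := x - (inner ℝ x w / inner ℝ w w) • w with hy
    rw [ih hW.2.2 y]
    refine eq_res_of ?_ fun u hu => ?_
    · have : x - res (sp W) y = (inner ℝ x w / inner ℝ w w) • w + (y - res (sp W) y) := by
        rw [hy]; abel
      rw [this, sp_cons]
      exact Submodule.add_mem_sup
        (Submodule.smul_mem _ _ (Submodule.mem_span_singleton_self w)) (sub_res_mem _ _)
    · rw [sp_cons, Submodule.mem_sup] at hu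
      obtain ⟨v, hv, u, hu, rfl⟩ := hu
      obtain ⟨a, rfl⟩ := Submodule.mem_span_singleton.1 hv
      have h1 : inner ℝ (res (sp W) y) w = 0 := by
        have h2 : inner ℝ y w = 0 := by
          have : (inner ℝ w w : ℝ) ≠ 0 := inner_self_ne_zero.2 hW.2.1
          rw [hy, inner_sub_left, inner_smul_left]
          change inner ℝ x w - inner ℝ x w / inner ℝ w w * inner ℝ w w = 0
          rw [div_mul_cancel₀ _ this, sub_self]
        have h3 := hW.1 _ (sub_res_mem (sp W) y)
        rw [real_inner_comm, inner_sub_left, h2] at h3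
        linarith
      rw [inner_add_right, inner_smul_right, h1, inner_res_left _ _ hu]; simp

lemma orthPart_steps (W : List (Vec d)) (x : Vec d) :
    (orthPart W x).steps ≤ W.length * (10 * d + 2) := by
  refine (always_foldSteps (c := 10 * d + 1) (fun _ _ => True) W W.length
    (fun _ _ _ _ _ _ => ⟨trivial, ?_⟩) 0 x (by simp) trivial).2.trans (by simp)
  simp; omega

lemma extend_steps (W : List (Vec d)) (x : Vec d) :
    (extend W x).steps ≤ W.length * (10 * d + 2) + 3 * d + 1 := by
  have := orthPart_steps W x
  simp [extend]; omega

lemma extend_length (W : List (Vec d)) (x : Vec d) :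
    (extend W x).val.length ≤ W.length + 1 ∧ W.length ≤ (extend W x).val.length := by
  simp only [extend, Timed.val_bind, Timed.val_pure]
  split_ifs <;> simp

lemma extend_val {W : List (Vec d)} (hW : Orth W) (x : Vec d) :
    Orth (extend W x).val ∧ sp (extend W x).val = sp W ⊔ Submodule.span ℝ {x} := by
  simp only [extend, Timed.val_bind, Timed.val_pure, orthPart_val hW, vdot_val, rIsZero_val,
    decide_eq_true_eq, inner_self_eq_zero]
  have hx : x = (x - res (sp W) x) + res (sp W) x := by abel
  split_ifs with h
  · refine ⟨hW, (sup_eq_left.2 ?_).symm⟩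
    rw [Submodule.span_singleton_le_iff_mem]
    simpa [h] using sub_res_mem (sp W) x
  · refine ⟨orth_cons.2 ⟨fun u hu => inner_res_left _ _ hu, h, hW⟩, ?_⟩
    rw [sp_cons, sup_comm]
    refine le_antisymm (sup_le le_sup_left ?_) (sup_le le_sup_left ?_)
    · rw [Submodule.span_singleton_le_iff_mem]
      have : res (sp W) x = - (x - res (sp W) x) + x := by abel
      rw [this]
      exact Submodule.add_mem_sup (Submodule.neg_mem _ (sub_res_mem _ _))
        (Submodule.mem_span_singleton_self x)
    · rw [Submodule.span_singleton_le_iff_mem]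
      nth_rewrite 2 [hx]
      exact Submodule.add_mem_sup (sub_res_mem _ _) (Submodule.mem_span_singleton_self _)

lemma sqDist_val {W : List (Vec d)} (hW : Orth W) (x : Vec d) :
    (sqDist W x).val = ‖res (sp W) x‖ ^ 2 := by
  simp [sqDist, orthPart_val hW]

lemma sqDist_steps (W : List (Vec d)) (x : Vec d) :
    (sqDist W x).steps ≤ W.length * (10 * d + 2) + 3 * d := by
  have := orthPart_steps W x
  simp [sqDist]; omega

lemma project_val {W : List (Vec d)} (hW : Orth W) (x : Vec d) :
    (project W x).val = (sp W).starProjection x := by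
  simp [project, orthPart_val hW, res_apply]

lemma project_steps (W : List (Vec d)) (x : Vec d) :
    (project W x).steps ≤ W.length * (10 * d + 2) + 2 * d := by
  have := orthPart_steps W x
  simp [project]; omega

lemma Orth.finrank_sp {W : List (Vec d)} (hW : Orth W) :
    Module.finrank ℝ (sp W) = W.length := by
  have hset : {w | w ∈ W} = Set.range W.get := by
    ext x; simp [List.mem_iff_get]
  have hli : LinearIndependent ℝ W.get := by
    refine linearIndependent_of_ne_zero_of_inner_eq_zero (𝕜 := ℝ)
      (fun i => hW.2 _ (List.get_mem W i)) fun i j hij => ?_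
    rcases lt_or_gt_of_ne hij with h | h
    · exact List.pairwise_iff_get.1 hW.1 i j h
    · rw [real_inner_comm]; exact List.pairwise_iff_get.1 hW.1 j i h
  rw [sp, hset, finrank_span_eq_card hli, Fintype.card_fin]

lemma foldSteps_vadd (z : Vec d) (S : List (Vec d)) : (foldSteps vadd z S).val = z + S.sum := by
  induction S generalizing z with
  | nil => simp [foldSteps]
  | cons a S ih => rw [foldSteps_cons, ih, vadd_val, List.sum_cons, add_assoc]

lemma meanPoint_val (S : List (Vec d)) : (meanPoint S).val = (S.length : ℝ)⁻¹ • S.sum := by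
  simp [meanPoint, foldSteps_vadd]

lemma meanPoint_steps (S : List (Vec d)) :
    (meanPoint S).steps ≤ S.length * (2 * d + 1) + 3 * d + 1 := by
  have := (always_foldSteps (f := vadd) (c := 2 * d) (fun _ _ => True) S S.length
    (fun _ _ _ _ _ _ => ⟨trivial, by simp⟩) 0 (0 : Vec d) (by simp) trivial).2
  simp [meanPoint]; omega

lemma mem_subsetMeans {S T : List (Vec d)} (h : T.Sublist S) (hT : T ≠ []) :
    (T.length : ℝ)⁻¹ • T.sum ∈ (subsetMeans S).val := by
  rw [subsetMeans, mapSteps_val, List.mem_map]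
  exact ⟨T, by simp [h, hT], meanPoint_val T⟩

lemma subsetMeans_length_le (S : List (Vec d)) :
    (subsetMeans S).val.length ≤ 2 ^ S.length := by
  rw [subsetMeans, mapSteps_val, List.length_map, ← List.length_sublists]
  exact List.length_filter_le _ _

lemma subsetMeans_steps (S : List (Vec d)) :
    (subsetMeans S).steps ≤ 2 ^ S.length * (S.length * (2 * d + 1) + 3 * d + 2) := by
  refine (mapSteps_steps_le (c := S.length * (2 * d + 1) + 3 * d + 1) fun T hT => ?_).trans ?_
  · refine (meanPoint_steps T).trans ?_
    have : T.length ≤ S.length := by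
      simp only [List.mem_filter, List.mem_sublists] at hT
      exact hT.1.length_le
    gcongr
  · gcongr
    rw [← List.length_sublists]
    exact List.length_filter_le _ _

lemma normalizeAll_val (W : List (Vec d)) :
    (normalizeAll W).val = W.map fun w => ‖w‖⁻¹ • w := by
  rw [normalizeAll, mapSteps_val]
  refine List.map_congr_left fun w _ => ?_
  simp

lemma normalizeAll_steps (W : List (Vec d)) :
    (normalizeAll W).steps ≤ W.length * (5 * d + 3) := by
  refine (mapSteps_steps_le (c := 5 * d + 2) fun w _ => ?_).trans (by simp)
  simp; omega

lemma Orth.normalize {W : List (Vec d)} (hW : Orth W) :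
    Orth (W.map fun w => ‖w‖⁻¹ • w) ∧ sp (W.map fun w => ‖w‖⁻¹ • w) = sp W ∧
      ∀ w ∈ W.map fun w => ‖w‖⁻¹ • w, ‖w‖ = 1 := by
  refine ⟨⟨?_, ?_⟩, ?_, ?_⟩
  · rw [List.pairwise_map]
    exact hW.1.imp fun h => by simp [inner_smul_left, inner_smul_right, h]
  · simp only [List.mem_map, forall_exists_index, and_imp]
    rintro _ w hw rfl
    simpa using hW.2 w hw
  · induction W with
    | nil => simp
    | cons w W ih =>
      rw [orth_cons] at hW
      rw [List.map_cons, sp_cons, sp_cons, ih hW.2.2, Submodule.span_singleton_smul_eq]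
      simpa using hW.2.1
  · simp only [List.mem_map, forall_exists_index, and_imp]
    rintro _ w hw rfl
    have := hW.2 w hw
    simp [norm_smul, this]

/-! ### Completing a list of directions -/

/-- The final alternative decides the length: if the list never becomes full, every unit vector that
is offered ends up in the span. -/
lemma complete_aux {j : ℕ} (l : List (Fin d)) {W : List (Vec d)} (hW : Orth W)
    (hl : W.length ≤ j) :
    let W' := (foldSteps (fun W i => do
      tick 1
      if W.length < j then do
        let e ← vunit i
        extend W e
      else pure W) W l).val
    Orth W' ∧ W'.length ≤ j ∧ sp W ≤ sp W' ∧
      (W'.length = j ∨ ∀ i ∈ l, EuclideanSpace.single i (1 : ℝ) ∈ sp W') := by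
  induction l generalizing W with
  | nil => exact ⟨hW, hl, le_rfl, Or.inr (by simp)⟩
  | cons i l ih =>
    rw [foldSteps_cons]
    by_cases h : W.length < j
    · have h1 := extend_val hW (EuclideanSpace.single i (1 : ℝ))
      have h2 := ih h1.1 ((extend_length _ _).1.trans h)
      have h3 : sp W ≤ sp (extend W (EuclideanSpace.single i (1 : ℝ))).val := by
        rw [h1.2]; exact le_sup_left
      simp only [Timed.val_bind, if_pos h, vunit_val]
      refine ⟨h2.1, h2.2.1, h3.trans h2.2.2.1, h2.2.2.2.imp_right fun h4 => ?_⟩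
      intro i' hi'
      rcases List.mem_cons.1 hi' with rfl | hi'
      · refine h2.2.2.1 ?_
        rw [h1.2]
        exact Submodule.mem_sup_right (Submodule.mem_span_singleton_self _)
      · exact h4 i' hi'
    · have h2 := ih hW hl
      simp only [Timed.val_bind, if_neg h, Timed.val_pure]
      refine ⟨h2.1, h2.2.1, h2.2.2.1, Or.inl (le_antisymm h2.2.1 ?_)⟩
      have := Submodule.finrank_mono h2.2.2.1
      rw [hW.finrank_sp, h2.1.finrank_sp] at this
      omega

lemma complete_val {j : ℕ} (hj : j ≤ d) {W : List (Vec d)} (hW : Orth W) (hl : W.length ≤ j) :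
    Orth (complete j W).val ∧ (complete j W).val.length = j ∧ sp W ≤ sp (complete j W).val := by
  have h := complete_aux ((List.finRange d).take j) hW hl
  refine ⟨h.1, le_antisymm h.2.1 ?_, h.2.2.1⟩
  rcases h.2.2.2 with h1 | h1
  · exact h1.ge
  -- The first `j` unit vectors are independent and lie in the span, whose dimension is the length
  -- of the list.
  · change j ≤ (complete j W).val.length
    rw [← Orth.finrank_sp (W := (complete j W).val) h.1]
    have hli : LinearIndependent ℝ (fun i : Fin j =>
        (EuclideanSpace.single (Fin.castLE hj i) (1 : ℝ) : Vec d)) := by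
      have := (EuclideanSpace.basisFun (Fin d) ℝ).toBasis.linearIndependent
      simpa [Function.comp_def] using this.comp (Fin.castLE hj) (Fin.castLE_injective hj)
    have := finrank_span_eq_card hli
    rw [Fintype.card_fin] at this
    refine this.ge.trans (Submodule.finrank_mono (Submodule.span_le.2 ?_))
    rintro _ ⟨i, rfl⟩
    refine h1 _ ?_
    rw [List.mem_take_iff_getElem]
    exact ⟨i, by simp [hj], by simp [Fin.ext_iff]⟩

lemma complete_steps {j : ℕ} {W : List (Vec d)} (hl : W.length ≤ j) :
    (complete j W).steps ≤ j * (j * (10 * d + 2) + 4 * d + 3) := by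
  refine (always_foldSteps (c := j * (10 * d + 2) + 4 * d + 2) (fun _ W => W.length ≤ j)
    ((List.finRange d).take j) _ (fun m _ V hV i _ => ?_) 0 W le_rfl hl).2.trans ?_
  · by_cases h : V.length < j
    · refine ⟨?_, ?_⟩
      · simp only [Timed.val_bind, if_pos h]
        exact (extend_length _ _).1.trans h
      · have h1 := extend_steps V (EuclideanSpace.single i (1 : ℝ))
        have h2 : V.length * (10 * d + 2) ≤ j * (10 * d + 2) := Nat.mul_le_mul_right _ hV
        simp only [Timed.steps_bind, if_pos h, tick_steps, vunit_steps, vunit_val]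
        omega
    · simp [Timed.Always, h, hV]
  · gcongr
    simp

/-! ### Flats and objective values -/

/-- The squared distance of a point to a stored flat. -/
def fsd (p : Vec d) (F : FlatRep d) : ℝ := ‖res (sp F.2) (p - F.1)‖ ^ 2

lemma flatSqDist_val {F : FlatRep d} (hF : Orth F.2) (p : Vec d) :
    (flatSqDist p F).val = fsd p F := by
  simp [flatSqDist, sqDist_val hF, fsd]

lemma flatSqDist_steps (p : Vec d) (F : FlatRep d) :
    (flatSqDist p F).steps ≤ F.2.length * (10 * d + 2) + 5 * d := by
  have := sqDist_steps F.2 (p - F.1)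
  simp [flatSqDist]; omega

lemma infDist_mk' (p o : Vec d) (D : Submodule ℝ (Vec d)) :
    Metric.infDist p (AffineSubspace.mk' o D : Set (Vec d)) = ‖res D (p - o)‖ := by
  have hne : (AffineSubspace.mk' o D : Set (Vec d)).Nonempty := ⟨o, AffineSubspace.self_mem_mk' o D⟩
  refine le_antisymm ?_ ((Metric.le_infDist hne).2 fun y hy => ?_)
  · have hmem : o + D.starProjection (p - o) ∈ (AffineSubspace.mk' o D : Set (Vec d)) := by
      rw [SetLike.mem_coe, AffineSubspace.mem_mk', vsub_eq_sub, add_sub_cancel_left]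
      exact proj_mem D _
    refine (Metric.infDist_le_dist_of_mem hmem).trans (le_of_eq ?_)
    rw [dist_eq_norm, res_apply]; congr 1; abel
  · rw [SetLike.mem_coe, AffineSubspace.mem_mk', vsub_eq_sub] at hy
    refine (norm_res_le D (p - o) hy).trans (le_of_eq ?_)
    rw [dist_eq_norm]; congr 1; abel

lemma infDist_toFlat_sq (p : Vec d) (F : FlatRep d) :
    Metric.infDist p (F.toFlat : Set (Vec d)) ^ 2 = fsd p F := by
  rw [FlatRep.toFlat, infDist_mk']; rfl

lemma isFlat_toFlat {F : FlatRep d} (hF : Orth F.2) : IsFlat F.2.length F.toFlat :=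
  ⟨⟨F.1, AffineSubspace.self_mem_mk' _ _⟩, by
    rw [FlatRep.toFlat, AffineSubspace.direction_mk']; exact hF.finrank_sp⟩

lemma foldSteps_min (g : FlatRep d → ℝ) (f : FlatRep d → Timed ℝ) (l : List (FlatRep d))
    (hf : ∀ F ∈ l, (f F).val = g F) (a : ℝ) :
    let b := (foldSteps (fun a G => do
        let b ← f G
        let c ← rle a b
        pure (if c then a else b)) a l).val
    b ≤ a ∧ (∀ F ∈ l, b ≤ g F) ∧ (b = a ∨ ∃ F ∈ l, b = g F) := by
  induction l generalizing a with
  | nil => exact ⟨le_rfl, by simp, Or.inl rfl⟩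
  | cons F l ih =>
    have h1 := ih (fun F hF => hf F (by simp [hF])) (if a ≤ g F then a else g F)
    rw [foldSteps_cons]
    simp only [Timed.val_bind, Timed.val_pure, rle_val, decide_eq_true_eq, hf F (by simp)]
    obtain ⟨h2, h3, h4⟩ := h1
    refine ⟨h2.trans ?_, ?_, ?_⟩
    · split_ifs with h
      · exact le_rfl
      · exact (not_le.1 h).le
    · intro G hG
      rcases List.mem_cons.1 hG with rfl | hG
      · refine h2.trans ?_
        split_ifs with h
        · exact h
        · exact le_rfl
      · exact h3 G hG
    · rcases h4 with h4 | ⟨G, hG, h4⟩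
      · rw [h4]
        split_ifs with h
        · exact Or.inl rfl
        · exact Or.inr ⟨F, by simp, rfl⟩
      · exact Or.inr ⟨G, by simp [hG], h4⟩

lemma minSqDist_val (p : Vec d) {Fs : List (FlatRep d)} (hne : Fs ≠ [])
    (hF : ∀ F ∈ Fs, Orth F.2) :
    (∀ F ∈ Fs, (minSqDist p Fs).val ≤ fsd p F) ∧ ∃ F ∈ Fs, (minSqDist p Fs).val = fsd p F := by
  cases Fs with
  | nil => exact absurd rfl hne
  | cons F Fs =>
    obtain ⟨h2, h3, h4⟩ := foldSteps_min (fsd p) (flatSqDist p) Fs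
      (fun G hG => flatSqDist_val (hF G (by simp [hG])) p) (flatSqDist p F).val
    rw [flatSqDist_val (hF F (by simp))] at h2 h4
    refine ⟨fun G hG => ?_, ?_⟩
    · rcases List.mem_cons.1 hG with rfl | hG
      · simpa [minSqDist, flatSqDist_val (hF G (by simp))] using h2
      · exact h3 G hG
    · rcases h4 with h4 | ⟨G, hG, h4⟩
      · exact ⟨F, by simp, by simpa [minSqDist, flatSqDist_val (hF F (by simp))] using h4⟩
      · exact ⟨G, by simp [hG],
          by simpa [minSqDist, flatSqDist_val (hF F (by simp))] using h4⟩

lemma minSqDist_steps (p : Vec d) {Fs : List (FlatRep d)} {j : ℕ}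
    (hF : ∀ F ∈ Fs, F.2.length ≤ j) :
    (minSqDist p Fs).steps ≤ Fs.length * (j * (10 * d + 2) + 5 * d + 2) := by
  have key : ∀ F : FlatRep d, F.2.length ≤ j →
      (flatSqDist p F).steps ≤ j * (10 * d + 2) + 5 * d := fun F hF =>
    (flatSqDist_steps p F).trans (by gcongr)
  cases Fs with
  | nil => simp [minSqDist]
  | cons F Fs =>
    have h1 := key F (hF F (by simp))
    have h2 := (always_foldSteps (f := fun a G => do
        let b ← flatSqDist p G
        let c ← rle a b
        pure (if c then a else b)) (c := j * (10 * d + 2) + 5 * d + 1) (fun _ _ => True) Fs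
        Fs.length (fun _ _ _ _ G hG => ⟨trivial, by simpa using key G (hF G (by simp [hG]))⟩) 0
        (flatSqDist p F).val (by simp) trivial).2
    simp only [minSqDist, Timed.steps_bind, List.length_cons]
    refine (add_le_add h1 h2).trans ?_
    generalize j * (10 * d + 2) + 5 * d = K
    linarith

lemma evalObjective_val (P : Fin n → Vec d) {k : ℕ} (hk : 0 < k) {Fs : List (FlatRep d)}
    (hlen : Fs.length = k) (hF : ∀ F ∈ Fs, Orth F.2) :
    (evalObjective P Fs).val = objective P (fun l : Fin k => (Fs[l]).toFlat) := by
  have : Nonempty (Fin k) := ⟨⟨0, hk⟩⟩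
  have hne : Fs ≠ [] := by rintro rfl; simp at hlen; omega
  simp only [evalObjective, Timed.val_bind, sumLoop_val, rdiv_val, objective]
  congr 1
  refine Finset.sum_congr rfl fun i _ => ?_
  simp only [infDist_toFlat_sq]
  obtain ⟨h1, F, hF1, hF2⟩ := minSqDist_val (P i) hne hF
  refine le_antisymm (le_ciInf fun l => h1 _ (List.getElem_mem _)) ?_
  rw [hF2]
  obtain ⟨l, hl, rfl⟩ := List.getElem_of_mem hF1
  exact ciInf_le (Set.finite_range fun l : Fin k => fsd (P i) Fs[l]).bddBelow ⟨l, hlen ▸ hl⟩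

lemma evalObjective_steps (P : Fin n → Vec d) {Fs : List (FlatRep d)} {j : ℕ}
    (hF : ∀ F ∈ Fs, F.2.length ≤ j) :
    (evalObjective P Fs).steps ≤ n * (Fs.length * (j * (10 * d + 2) + 5 * d + 2) + 2) + 1 := by
  have := sumLoop_steps_le (f := fun i => minSqDist (P i) Fs) fun i => minSqDist_steps (P i) hF
  simp only [evalObjective, Timed.steps_bind, rdiv_steps]
  omega

/-- The loop invariant is that the stored number is the value of the stored element. The start
`none` is overwritten by the first element, so a nonempty list always yields a result. -/
lemma foldSteps_best {α : Type} {f : α → ℝ} {g : Option (ℝ × α) → α → Timed (Option (ℝ × α))}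
    (h₀ : ∀ a, (g none a).val = some (f a, a))
    (h₁ : ∀ b a, (g (some b) a).val = if b.1 ≤ f a then some b else some (f a, a))
    (l : List α) (b₀ : Option (ℝ × α)) (hb : ∀ b, b₀ = some b → b.1 = f b.2) :
    let r := (foldSteps g b₀ l).val
    (l ≠ [] ∨ b₀.isSome → ∃ b, r = some b) ∧
    ∀ b, r = some b → b.1 = f b.2 ∧ (some b = b₀ ∨ b.2 ∈ l) ∧
      (∀ b', b₀ = some b' → b.1 ≤ b'.1) ∧ ∀ a ∈ l, b.1 ≤ f a := by
  induction l generalizing b₀ with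
  | nil =>
    refine ⟨fun h => ?_, fun b hb' => ?_⟩
    · simpa [Option.isSome_iff_exists, foldSteps] using h
    · have hb' : b₀ = some b := hb'
      refine ⟨hb b hb', Or.inl hb'.symm, ?_, by simp⟩
      intro b' h; rw [hb'] at h; cases h; exact le_rfl
  | cons a l ih =>
    rw [foldSteps_cons]
    cases b₀ with
    | none =>
      rw [h₀]
      obtain ⟨h1, h2⟩ := ih (some (f a, a)) (by rintro b h; cases h; rfl)
      refine ⟨fun _ => h1 (Or.inr rfl), fun b hb' => ?_⟩
      obtain ⟨h3, h4, h5, h6⟩ := h2 b hb'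
      refine ⟨h3, Or.inr ?_, by simp, ?_⟩
      · rcases h4 with h4 | h4
        · cases h4; simp
        · simp [h4]
      · intro a' ha'
        rcases List.mem_cons.1 ha' with rfl | ha'
        · exact h5 _ rfl
        · exact h6 a' ha'
    | some b₁ =>
      rw [h₁]
      by_cases hle : b₁.1 ≤ f a
      · simp only [if_pos hle]
        obtain ⟨h1, h2⟩ := ih (some b₁) hb
        refine ⟨fun _ => h1 (Or.inr rfl), fun b hb' => ?_⟩
        obtain ⟨h3, h4, h5, h6⟩ := h2 b hb'
        refine ⟨h3, h4.imp_right (by simp +contextual), h5, ?_⟩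
        intro a' ha'
        rcases List.mem_cons.1 ha' with rfl | ha'
        · exact (h5 _ rfl).trans hle
        · exact h6 a' ha'
      · simp only [if_neg hle]
        obtain ⟨h1, h2⟩ := ih (some (f a, a)) (by rintro b h; cases h; rfl)
        refine ⟨fun _ => h1 (Or.inr rfl), fun b hb' => ?_⟩
        obtain ⟨h3, h4, h5, h6⟩ := h2 b hb'
        refine ⟨h3, Or.inr ?_, ?_, ?_⟩
        · rcases h4 with h4 | h4
          · cases h4; simp
          · simp [h4]
        · rintro b' h; cases h
          exact (h5 _ rfl).trans (not_le.1 hle).le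
        · intro a' ha'
          rcases List.mem_cons.1 ha' with rfl | ha'
          · exact h5 _ rfl
          · exact h6 a' ha'

lemma bestCombination_val (P : Fin n → Vec d) {T : List (List (FlatRep d))}
    {Fs : List (FlatRep d)} (hFs : List.Forall₂ (· ∈ ·) Fs T) :
    ∃ Gs : List (FlatRep d), (bestCombination P T).val = some ((evalObjective P Gs).val, Gs) ∧
      List.Forall₂ (· ∈ ·) Gs T ∧ (evalObjective P Gs).val ≤ (evalObjective P Fs).val := by
  have hmem : Fs ∈ T.sections := List.mem_sections.2 hFs
  obtain ⟨h1, h2⟩ := foldSteps_best (f := fun Fs => (evalObjective P Fs).val)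
    (g := fun best Fs => do
      tick T.length
      let v ← evalObjective P Fs
      match best with
      | none => pure (some (v, Fs))
      | some b => do
          let c ← rle b.1 v
          pure (if c then some b else some (v, Fs)))
    (fun _ => rfl) (fun b a => by simp) T.sections none (by simp)
  obtain ⟨b, hb⟩ := h1 (Or.inl (List.ne_nil_of_mem hmem))
  obtain ⟨h3, h4, -, h6⟩ := h2 b hb
  refine ⟨b.2, ?_, ?_, ?_⟩
  · rw [← h3]; exact hb
  · rcases h4 with h4 | h4
    · simp at h4
    · exact List.mem_sections.1 h4
  · rw [← h3]; exact h6 Fs hmem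

lemma length_sections_le {α : Type} {N : ℕ} {T : List (List α)} (h : ∀ L ∈ T, L.length ≤ N) :
    T.sections.length ≤ N ^ T.length := by
  induction T with
  | nil => simp
  | cons L T ih =>
    have h1 := ih fun L hL => h L (by simp [hL])
    have h2 := h L (by simp)
    simp only [List.sections, List.length_flatMap, List.length_map, List.length_cons, pow_succ]
    rw [List.map_const', List.sum_replicate, smul_eq_mul]
    gcongr

lemma bestCombination_steps (P : Fin n → Vec d) {T : List (List (FlatRep d))} {N j : ℕ}
    (hT : ∀ L ∈ T, L.length ≤ N ∧ ∀ F ∈ L, F.2.length ≤ j) :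
    (bestCombination P T).steps ≤ N ^ T.length *
      (T.length + (n * (T.length * (j * (10 * d + 2) + 5 * d + 2) + 2) + 1) + 1 + 1) := by
  refine (always_foldSteps (c := T.length +
    (n * (T.length * (j * (10 * d + 2) + 5 * d + 2) + 2) + 1) + 1) (fun _ _ => True) T.sections
    T.sections.length (fun _ _ b _ Fs hFs => ⟨trivial, ?_⟩) 0 none (by simp) trivial).2.trans ?_
  · rw [List.mem_sections] at hFs
    have h1 : ∀ F ∈ Fs, F.2.length ≤ j := by
      intro F hF
      obtain ⟨l, hl, rfl⟩ := List.getElem_of_mem hF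
      have := hFs.get hl (hFs.length_eq ▸ hl)
      exact (hT _ (List.getElem_mem (hFs.length_eq ▸ hl))).2 _ this
    have h2 := evalObjective_steps P h1
    rw [hFs.length_eq] at h2
    cases b with
    | none => simp; omega
    | some b => simp; omega
  · gcongr
    exact length_sections_le fun L hL => (hT L hL).1

/-! ### The grid -/

lemma grid_length (M : ℕ) (a : ℝ) (B : List (Vec d)) :
    (grid M a B).val.length = (2 * M + 1) ^ B.length := by
  induction B with
  | nil => simp [grid]
  | cons b B ih =>
    simp only [grid, Timed.val_bind, mapSteps_val, concat_val, List.length_flatten, List.map_map,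
      List.length_cons, pow_succ']
    rw [← ih]
    simp [Function.comp_def, List.map_const']

lemma grid_steps (M : ℕ) (a : ℝ) (B : List (Vec d)) :
    (grid M a B).steps ≤ (B.length + 1) * ((2 * M + 1) ^ B.length * (8 * d + 8)) := by
  induction B with
  | nil => simp [grid]; omega
  | cons b B ih =>
    have h1 : (mapSteps (fun t : ℕ => do
        let z ← rsub t M
        let c ← rmul z a
        let v ← vsmul c b
        mapSteps (fun g => vadd g v) (grid M a B).val) (List.range (2 * M + 1))).steps
        ≤ (2 * M + 1) * (((2 * M + 1) ^ B.length * (2 * d + 1) + 2 * d + 2) + 1) := by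
      refine (mapSteps_steps_le (c := (2 * M + 1) ^ B.length * (2 * d + 1) + 2 * d + 2)
        fun t _ => ?_).trans (by simp)
      have := mapSteps_steps_le (f := fun g => vadd g
        ((((t : ℝ) - M) * a) • b)) (c := 2 * d) (l := (grid M a B).val) (by simp)
      rw [grid_length] at this
      simp; omega
    have h2 : ((grid M a (b :: B)).steps) = (grid M a B).steps + ((mapSteps (fun t : ℕ => do
        let z ← rsub t M
        let c ← rmul z a
        let v ← vsmul c b
        mapSteps (fun g => vadd g v) (grid M a B).val) (List.range (2 * M + 1))).steps +
        ((2 * M + 1) ^ (b :: B).length + (2 * M + 1))) := by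
      rw [← grid_length M a (b :: B)]
      simp [grid]
    rw [h2]
    set q := (2 * M + 1) ^ B.length with hq
    have hq1 : 1 ≤ q := Nat.one_le_pow _ _ (by omega)
    rw [List.length_cons, pow_succ', ← hq]
    set m := 2 * M + 1
    have hm1 : 1 ≤ m := by omega
    have h3 : (B.length + 1) * (q * (8 * d + 8)) ≤ (B.length + 1) * (m * q * (8 * d + 8)) := by
      gcongr; nlinarith
    have h4 : m * ((q * (2 * d + 1) + 2 * d + 2) + 1) + (m * q + m) ≤ m * q * (8 * d + 8) := by
      have : m * ((q * (2 * d + 1) + 2 * d + 2) + 1) + (m * q + m)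
        = m * (q * (2 * d + 2) + 2 * d + 4) := by ring
      rw [this, mul_assoc]
      gcongr
      nlinarith
    have h5 : (B.length + 1 + 1) * (m * q * (8 * d + 8))
      = (B.length + 1) * (m * q * (8 * d + 8)) + m * q * (8 * d + 8) := by ring
    omega

/-- Every vector of the span within the radius of the grid is close to a grid point. -/
lemma exists_grid_near {M : ℕ} {a : ℝ} (ha : 0 ≤ a) {B : List (Vec d)} (hB : Orth B)
    (h1 : ∀ b ∈ B, ‖b‖ = 1) {u : Vec d} (hu : u ∈ sp B) (hM : ‖u‖ ≤ M * a) :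
    ∃ g ∈ (grid M a B).val, ‖g - u‖ ≤ B.length * a := by
  induction B generalizing u with
  | nil =>
    rw [sp_nil, Submodule.mem_bot] at hu
    exact ⟨0, by simp [grid], by simp [hu]⟩
  | cons b B ih =>
    rw [orth_cons] at hB
    have hb : ‖b‖ = 1 := h1 b (by simp)
    rw [sp_cons, Submodule.mem_sup] at hu
    obtain ⟨v, hv, u', hu', rfl⟩ := hu
    obtain ⟨c, rfl⟩ := Submodule.mem_span_singleton.1 hv
    have horth : inner ℝ (c • b) u' = 0 := by rw [inner_smul_left, hB.1 u' hu']; simp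
    have hn : ‖c • b + u'‖ ^ 2 = c ^ 2 + ‖u'‖ ^ 2 := by
      rw [norm_add_sq_real, horth, norm_smul, hb]; simp
    have hMa : 0 ≤ M * a := by positivity
    have hc : |c| ≤ M * a := abs_le_of_sq_le_sq (by nlinarith [norm_nonneg (c • b + u')]) hMa
    have hu'n : ‖u'‖ ≤ M * a := by
      refine abs_le_of_sq_le_sq' ?_ hMa |>.2
      nlinarith [norm_nonneg (c • b + u')]
    obtain ⟨g, hg, hgu⟩ := ih hB.2.2 (fun b hb => h1 b (by simp [hb])) hu' hu'n
    -- The coordinate `c` is rounded down to a multiple of `a`; `|c| ≤ M a` keeps the index in the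
    -- range. For `a = 0` it follows that `c = 0` and any index works.
    obtain ⟨t, ht, htc⟩ : ∃ t : ℕ, t < 2 * M + 1 ∧ |((t : ℝ) - M) * a - c| ≤ a := by
      rcases ha.eq_or_lt with rfl | ha
      · refine ⟨0, by omega, ?_⟩
        simp at hc; simp [hc]
      · have hc' := abs_le.1 hc
        have hnn : 0 ≤ c / a + M := by
          have : -(M : ℝ) ≤ c / a := by rw [le_div_iff₀ ha]; linarith
          linarith
        refine ⟨⌊c / a + M⌋₊, ?_, ?_⟩
        · rw [Nat.lt_succ_iff]
          refine Nat.floor_le_of_le ?_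
          have : c / a ≤ M := by rw [div_le_iff₀ ha]; linarith
          push_cast; linarith
        · have h3 := Nat.floor_le hnn
          have h4 := Nat.lt_floor_add_one (c / a + M)
          have h5 : c = c / a * a := by field_simp
          rw [abs_le]
          constructor <;> nlinarith
    refine ⟨g + (((t : ℝ) - M) * a) • b, ?_, ?_⟩
    · simp only [grid, Timed.val_bind, mapSteps_val, concat_val, List.mem_flatten, List.mem_map]
      exact ⟨_, ⟨t, by simpa using ht, rfl⟩, by simpa using hg⟩
    · have : g + (((t : ℝ) - M) * a) • b - (c • b + u') =
          (g - u') + (((t : ℝ) - M) * a - c) • b := by rw [sub_smul]; abel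
      rw [this]
      refine (norm_add_le _ _).trans ?_
      rw [norm_smul, hb, List.length_cons, Real.norm_eq_abs]
      push_cast; linarith

end VectorOps

/-! ### Root of sum of squares -/

section RootSum

variable {ι : Type*}

/-- The Euclidean norm of a family of numbers over a finite set of indices. -/
def rss (C : Finset ι) (f : ι → ℝ) : ℝ := √(∑ i ∈ C, f i ^ 2)

lemma rss_nonneg (C : Finset ι) (f : ι → ℝ) : 0 ≤ rss C f := Real.sqrt_nonneg _

lemma rss_sq (C : Finset ι) (f : ι → ℝ) : rss C f ^ 2 = ∑ i ∈ C, f i ^ 2 :=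
  Real.sq_sqrt (Finset.sum_nonneg fun _ _ => sq_nonneg _)

lemma rss_mono {C : Finset ι} {f g : ι → ℝ} (hf : ∀ i ∈ C, 0 ≤ f i) (h : ∀ i ∈ C, f i ≤ g i) :
    rss C f ≤ rss C g :=
  Real.sqrt_le_sqrt (Finset.sum_le_sum fun i hi => pow_le_pow_left₀ (hf i hi) (h i hi) 2)

lemma rss_mul_const {C : Finset ι} (f : ι → ℝ) {c : ℝ} (hc : 0 ≤ c) :
    rss C (fun i => f i * c) = rss C f * c := by
  unfold rss
  simp_rw [mul_pow, ← Finset.sum_mul]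
  rw [Real.sqrt_mul' _ (sq_nonneg c), Real.sqrt_sq hc]

lemma rss_add_le (C : Finset ι) (f g : ι → ℝ) :
    rss C (fun i => f i + g i) ≤ rss C f + rss C g := by
  refine Real.sqrt_le_iff.2 ⟨add_nonneg (rss_nonneg _ _) (rss_nonneg _ _), ?_⟩
  have h1 : ∑ i ∈ C, f i * g i ≤ rss C f * rss C g := by
    refine le_trans (le_abs_self _) (abs_le_of_sq_le_sq ?_
      (mul_nonneg (rss_nonneg _ _) (rss_nonneg _ _)))
    rw [mul_pow, rss_sq, rss_sq]
    exact Finset.sum_mul_sq_le_sq_mul_sq C f g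
  have h2 : ∑ i ∈ C, (f i + g i) ^ 2 =
      ∑ i ∈ C, f i ^ 2 + 2 * ∑ i ∈ C, f i * g i + ∑ i ∈ C, g i ^ 2 := by
    rw [Finset.mul_sum, ← Finset.sum_add_distrib, ← Finset.sum_add_distrib]
    exact Finset.sum_congr rfl fun i _ => by ring
  rw [h2, ← rss_sq, ← rss_sq]
  nlinarith

end RootSum

/-! ### Tilting a subspace towards a vector -/

section Tilt

variable {d n : ℕ}

lemma norm_proj_sub_proj_le {W S : Submodule ℝ (Vec d)} (h : W ≤ S) (x : Vec d) :
    ‖S.starProjection x - W.starProjection x‖ ≤ ‖x‖ := by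
  have h1 := norm_res_sq_of_le h x
  have h2 := norm_res_le_norm W x
  refine (sq_le_sq₀ (norm_nonneg _) (norm_nonneg _)).1 ?_
  nlinarith [sq_nonneg ‖res S x‖, norm_nonneg (res W x)]

/-- A subspace `S` containing `W` can be tilted so that it contains a further vector `g`. -/
lemma exists_tilt {W S : Submodule ℝ (Vec d)} (hWS : W ≤ S) {g : Vec d}
    (hg : S.starProjection g - W.starProjection g ≠ 0) :
    ∃ S' : Submodule ℝ (Vec d), W ⊔ Submodule.span ℝ {g} ≤ S' ∧
      (∀ V : Submodule ℝ (Vec d), S ≤ V → g ∈ V → S' ≤ V) ∧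
      (∀ h, Module.finrank ℝ S ≤ Module.finrank ℝ W + (h + 1) →
        Module.finrank ℝ S' ≤ Module.finrank ℝ ↥(W ⊔ Submodule.span ℝ {g}) + h) ∧
      ∀ x, ‖res S' x‖ ≤ ‖res S x‖ + ‖S.starProjection x - W.starProjection x‖ *
        (‖res S g‖ / ‖S.starProjection g - W.starProjection g‖) := by
  set t := S.starProjection g - W.starProjection g with ht
  have htS : t ∈ S := S.sub_mem (proj_mem S g) (hWS (proj_mem W g))
  have htW : ∀ w ∈ W, inner ℝ w t = 0 := by
    intro w hw
    have h1 := inner_res_right W g hw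
    have h2 := inner_res_right S g (hWS hw)
    have : t = res W g - res S g := by rw [ht, res_apply, res_apply]; abel
    rw [this, inner_sub_right, h1, h2, sub_zero]
  have htn : 0 < ‖t‖ := norm_pos_iff.2 hg
  have hgt : g = W.starProjection g + t + res S g := by rw [ht, res_apply]; abel
  -- The shear `Φ` acts on the component along `t` only. It fixes `W`, which is orthogonal to `t`,
  -- and takes `t` to `t + res S g`, so that `g` is the image of an element of `S`.
  let Φ : Vec d →ₗ[ℝ] Vec d :=
    LinearMap.id + ((‖t‖ ^ 2)⁻¹ • (innerₛₗ ℝ t)).smulRight (res S g)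
  have hΦ : ∀ x, Φ x = x + ((‖t‖ ^ 2)⁻¹ * inner ℝ t x) • res S g := fun x => rfl
  have hΦW : ∀ w ∈ W, Φ w = w := by
    intro w hw
    rw [hΦ, real_inner_comm, htW w hw]; simp
  have hΦt : Φ t = t + res S g := by
    rw [hΦ, real_inner_self_eq_norm_sq, inv_mul_cancel₀ (by positivity), one_smul]
  have hW' : W ≤ S.map Φ := fun w hw => ⟨w, hWS hw, hΦW w hw⟩
  have hg' : g ∈ S.map Φ := by
    have : g = Φ (W.starProjection g + t) := by
      rw [map_add, hΦW _ (proj_mem W g), hΦt, ← add_assoc]; exact hgt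
    rw [this]
    exact ⟨_, S.add_mem (hWS (proj_mem W g)) htS, rfl⟩
  refine ⟨S.map Φ, sup_le hW' ((Submodule.span_singleton_le_iff_mem _ _).2 hg'), ?_, ?_, ?_⟩
  · rintro V hSV hgV _ ⟨x, hx, rfl⟩
    rw [hΦ]
    refine V.add_mem (hSV hx) (V.smul_mem _ ?_)
    rw [res_apply]
    exact V.sub_mem hgV (hSV (proj_mem S g))
  · intro h hdim
    -- The image is not larger than `S`, while adjoining `g` enlarges `W`, since `g ∈ W` would give
    -- `t = 0`. So one missing dimension is used up.
    have h1 : Module.finrank ℝ ↥(S.map Φ) ≤ Module.finrank ℝ S := Submodule.finrank_map_le Φ S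
    have hlt : W < W ⊔ Submodule.span ℝ {g} := by
      refine lt_of_le_of_ne le_sup_left fun heq => hg ?_
      have hgW : g ∈ W := by
        rw [heq]; exact Submodule.mem_sup_right (Submodule.mem_span_singleton_self g)
      rw [ht, W.starProjection_eq_self_iff.2 hgW, S.starProjection_eq_self_iff.2 (hWS hgW), sub_self]
    have := Submodule.finrank_lt_finrank_of_lt hlt
    omega
  · intro x
    -- The distance of `x` to the tilted subspace is bounded by its distance to the sheared foot
    -- point.
    have hmem : Φ (S.starProjection x) ∈ S.map Φ := ⟨_, proj_mem S x, rfl⟩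
    refine (norm_res_le _ x hmem).trans ?_
    have h1 : x - Φ (S.starProjection x) =
        res S x - ((‖t‖ ^ 2)⁻¹ * inner ℝ t (S.starProjection x)) • res S g := by
      rw [hΦ, res_apply S x]; abel
    have h2 : inner ℝ t (S.starProjection x) =
        inner ℝ t (S.starProjection x - W.starProjection x) := by
      rw [inner_sub_right, real_inner_comm (W.starProjection x) t, htW _ (proj_mem W x), sub_zero]
    rw [h1, h2]
    refine (norm_sub_le _ _).trans (add_le_add le_rfl ?_)
    rw [norm_smul, Real.norm_eq_abs, abs_mul, abs_of_pos (by positivity)]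
    have h3 := abs_real_inner_le_norm t (S.starProjection x - W.starProjection x)
    calc _ ≤ (‖t‖ ^ 2)⁻¹ * (‖t‖ * ‖S.starProjection x - W.starProjection x‖) * ‖res S g‖ := by
          gcongr
      _ = _ := by field_simp

/-- The root of the sum of the squared distances of points to a subspace. -/
def dev {ι : Type*} (C : Finset ι) (q : ι → Vec d) (U : Submodule ℝ (Vec d)) : ℝ :=
  rss C fun i => ‖res U (q i)‖

/-- The root of the sum of the squared lengths of the components of points in `S` that are
orthogonal to `W`. -/
def spread {ι : Type*} (C : Finset ι) (q : ι → Vec d) (W S : Submodule ℝ (Vec d)) : ℝ :=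
  rss C fun i => ‖S.starProjection (q i) - W.starProjection (q i)‖

lemma dev_nonneg {ι : Type*} (C : Finset ι) (q : ι → Vec d) (U : Submodule ℝ (Vec d)) :
    0 ≤ dev C q U := rss_nonneg _ _

lemma spread_nonneg {ι : Type*} (C : Finset ι) (q : ι → Vec d) (W S : Submodule ℝ (Vec d)) :
    0 ≤ spread C q W S := rss_nonneg _ _

lemma dev_sq {ι : Type*} (C : Finset ι) (q : ι → Vec d) (U : Submodule ℝ (Vec d)) :
    dev C q U ^ 2 = ∑ i ∈ C, ‖res U (q i)‖ ^ 2 := rss_sq _ _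

lemma spread_sq {ι : Type*} (C : Finset ι) (q : ι → Vec d) (W S : Submodule ℝ (Vec d)) :
    spread C q W S ^ 2 = ∑ i ∈ C, ‖S.starProjection (q i) - W.starProjection (q i)‖ ^ 2 :=
  rss_sq _ _

lemma dev_anti {ι : Type*} (C : Finset ι) (q : ι → Vec d) {U U' : Submodule ℝ (Vec d)}
    (h : U ≤ U') : dev C q U' ≤ dev C q U :=
  rss_mono (fun _ _ => norm_nonneg _) fun _ _ => norm_res_mono h _

lemma dev_sq_of_le {ι : Type*} (C : Finset ι) (q : ι → Vec d) {W S : Submodule ℝ (Vec d)}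
    (h : W ≤ S) : dev C q W ^ 2 = dev C q S ^ 2 + spread C q W S ^ 2 := by
  rw [dev_sq, dev_sq, spread_sq, ← Finset.sum_add_distrib]
  exact Finset.sum_congr rfl fun i _ => norm_res_sq_of_le h _

lemma dev_le_of_le {ι : Type*} (C : Finset ι) (q : ι → Vec d) {W S : Submodule ℝ (Vec d)}
    (h : W ≤ S) : dev C q W ≤ dev C q S + spread C q W S := by
  have h1 := dev_sq_of_le C q h
  have h2 := dev_nonneg C q S
  have h3 := spread_nonneg C q W S
  refine (sq_le_sq₀ (dev_nonneg _ _ _) (by positivity)).1 ?_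
  nlinarith

/-- Minkowski's inequality carries the pointwise bound over to the root of the sum of squares. -/
lemma exists_tilt_dev {ι : Type*} (C : Finset ι) (q : ι → Vec d) {W S : Submodule ℝ (Vec d)}
    (hWS : W ≤ S) {g : Vec d} (hg : S.starProjection g - W.starProjection g ≠ 0) :
    ∃ S' : Submodule ℝ (Vec d), W ⊔ Submodule.span ℝ {g} ≤ S' ∧
      (∀ V : Submodule ℝ (Vec d), S ≤ V → g ∈ V → S' ≤ V) ∧
      (∀ h, Module.finrank ℝ S ≤ Module.finrank ℝ W + (h + 1) →
        Module.finrank ℝ S' ≤ Module.finrank ℝ ↥(W ⊔ Submodule.span ℝ {g}) + h) ∧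
      dev C q S' ≤ dev C q S + spread C q W S *
        (‖res S g‖ / ‖S.starProjection g - W.starProjection g‖) := by
  obtain ⟨S', h1, h2, h3, h4⟩ := exists_tilt hWS hg
  refine ⟨S', h1, h2, h3, ?_⟩
  rw [spread, ← rss_mul_const _ (by positivity)]
  exact (rss_mono (fun _ _ => norm_nonneg _) fun i _ => h4 (q i)).trans (rss_add_le _ _ _)

/-- An index whose point has a large component in `S` orthogonal to `W` and is close to `S`. -/
def IsGood {ι : Type*} (C : Finset ι) (q : ι → Vec d) (a b : ℝ) (W S : Submodule ℝ (Vec d))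
    (i : ι) : Prop :=
  spread C q W S ≤ a * ‖S.starProjection (q i) - W.starProjection (q i)‖ ∧
    ‖res S (q i)‖ ≤ b * dev C q S

/-- Adjoining a good point multiplies the deviation by a bounded factor. -/
lemma exists_tilt_of_isGood {ι : Type*} {C : Finset ι} {q : ι → Vec d} {a b : ℝ} (ha : 0 ≤ a)
    (hb : 0 ≤ b) {W S V : Submodule ℝ (Vec d)} (hWS : W ≤ S) (hSV : S ≤ V) {h : ℕ}
    (hdim : Module.finrank ℝ S ≤ Module.finrank ℝ W + (h + 1)) {i : ι} (hi : IsGood C q a b W S i)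
    (hqV : q i ∈ V) :
    ∃ S' : Submodule ℝ (Vec d), W ⊔ Submodule.span ℝ {res W (q i)} ≤ S' ∧ S' ≤ V ∧
      Module.finrank ℝ S' ≤ Module.finrank ℝ ↥(W ⊔ Submodule.span ℝ {res W (q i)}) + h ∧
      dev C q S' ≤ (1 + a * b) * dev C q S := by
  have hxV : res W (q i) ∈ V := by
    rw [res_apply]; exact V.sub_mem hqV (hSV (hWS (proj_mem W _)))
  -- The tree adjoins the component orthogonal to `W` instead of the point; since `W ≤ S`, neither
  -- the part of the point in `S` orthogonal to `W` nor its residual changes.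
  have hx : S.starProjection (res W (q i)) - W.starProjection (res W (q i)) =
      S.starProjection (q i) - W.starProjection (q i) := by
    have h1 : S.starProjection (W.starProjection (q i)) = W.starProjection (q i) :=
      S.starProjection_eq_self_iff.2 (hWS (proj_mem W _))
    have h2 : W.starProjection (W.starProjection (q i)) = W.starProjection (q i) :=
      W.starProjection_eq_self_iff.2 (proj_mem W _)
    rw [res_apply, map_sub, map_sub, h1, h2]; abel
  have hr : res S (res W (q i)) = res S (q i) := by
    rw [res_apply W, map_sub, res_of_mem (hWS (proj_mem W _)), sub_zero]
  have hR := dev_nonneg C q S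
  -- If the spread vanishes, `W` is already as close to the points as `S` and no tilt is needed.
  rcases (spread_nonneg C q W S).eq_or_lt with h0 | hpos
  · refine ⟨W ⊔ Submodule.span ℝ {res W (q i)}, le_rfl,
      sup_le (hWS.trans hSV) ((Submodule.span_singleton_le_iff_mem _ _).2 hxV), by omega, ?_⟩
    refine (dev_anti C q le_sup_left).trans ((dev_le_of_le C q hWS).trans ?_)
    rw [← h0]
    nlinarith [mul_nonneg (mul_nonneg ha hb) hR]
  · have hT : 0 < ‖S.starProjection (q i) - W.starProjection (q i)‖ := by
      rcases (norm_nonneg (S.starProjection (q i) - W.starProjection (q i))).eq_or_lt with h0 | h0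
      · have := hi.1
        rw [← h0] at this; linarith
      · exact h0
    obtain ⟨S', h1, h2, h3, h4⟩ := exists_tilt_dev C q hWS (g := res W (q i))
      (by rw [hx]; exact norm_pos_iff.1 hT)
    refine ⟨S', h1, h2 V hSV hxV, h3 h hdim, h4.trans ?_⟩
    rw [hx, hr]
    have : spread C q W S * (‖res S (q i)‖ / ‖S.starProjection (q i) - W.starProjection (q i)‖)
        ≤ a * (b * dev C q S) := by
      rw [← mul_div_assoc, div_le_iff₀ hT]
      calc _ ≤ (a * ‖S.starProjection (q i) - W.starProjection (q i)‖) * (b * dev C q S) := by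
            gcongr
            · exact hi.1
            · exact hi.2
        _ = _ := by ring
    nlinarith

/-- Adjoining a point close to the projection of a good point to `S` increases the deviation
by a small amount. -/
lemma exists_tilt_of_near {ι : Type*} {C : Finset ι} {q : ι → Vec d} {a θ η : ℝ} (ha : 0 ≤ a)
    (hη : 0 ≤ η) (hθ : 2 * a * η ≤ θ)
    {W S V : Submodule ℝ (Vec d)} (hWS : W ≤ S) (hSV : S ≤ V) {h : ℕ}
    (hdim : Module.finrank ℝ S ≤ Module.finrank ℝ W + (h + 1)) {i : ι}
    (hi : spread C q W S ≤ a * ‖S.starProjection (q i) - W.starProjection (q i)‖)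
    (hqV : q i ∈ V) {g : Vec d} (hgV : g ∈ V) (hg : ‖g - (- res S (q i))‖ ≤ η) :
    ∃ S' : Submodule ℝ (Vec d), W ⊔ Submodule.span ℝ {res W (q i) + g} ≤ S' ∧ S' ≤ V ∧
      Module.finrank ℝ S' ≤ Module.finrank ℝ ↥(W ⊔ Submodule.span ℝ {res W (q i) + g}) + h ∧
      dev C q S' ≤ dev C q S + θ := by
  set x := res W (q i) + g with hxdef
  set t := S.starProjection (q i) - W.starProjection (q i) with ht
  set e := g - (- res S (q i)) with he
  have hxV : x ∈ V := by
    refine V.add_mem ?_ hgV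
    rw [res_apply]; exact V.sub_mem hqV (hSV (hWS (proj_mem W _)))
  -- The correction `g` nearly cancels the residual, leaving the vector `t` of `S` up to the small
  -- error `e`.
  have hxe : x = t + e := by rw [hxdef, ht, he, res_apply, res_apply]; abel
  have htS : t ∈ S := S.sub_mem (proj_mem S _) (hWS (proj_mem W _))
  have hWt : W.starProjection t = 0 := by
    rw [Submodule.starProjection_apply_eq_zero_iff]
    intro w hw
    have : t = res W (q i) - res S (q i) := by rw [ht, res_apply, res_apply]; abel
    rw [this, inner_sub_right, inner_res_right W _ hw, inner_res_right S _ (hWS hw), sub_zero]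
  have hx : S.starProjection x - W.starProjection x =
      t + (S.starProjection e - W.starProjection e) := by
    rw [hxe, map_add, map_add, S.starProjection_eq_self_iff.2 htS, hWt]; abel
  have hr : ‖res S x‖ ≤ η := by
    rw [hxe, map_add, res_of_mem htS, zero_add]
    exact (norm_res_le_norm S e).trans hg
  -- A spread of at most `θ` may be given up: `W` itself has deviation at most `θ` more than `S`.
  -- Otherwise `2aη ≤ θ < spread ≤ a‖t‖` forces `‖t‖ ≥ 2η`, so `e` destroys at most half of `t`, and
  -- the tilt costs at most `a‖t‖ · η / (‖t‖/2) = 2aη`.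
  by_cases hD : spread C q W S ≤ θ
  · refine ⟨W ⊔ Submodule.span ℝ {x}, le_rfl,
      sup_le (hWS.trans hSV) ((Submodule.span_singleton_le_iff_mem _ _).2 hxV), by omega, ?_⟩
    refine (dev_anti C q le_sup_left).trans ((dev_le_of_le C q hWS).trans ?_)
    gcongr
  · push Not at hD
    have hs : 0 < spread C q W S := by
      refine lt_of_le_of_lt ?_ hD
      exact le_trans (by positivity) hθ
    have hapos : 0 < a := by
      rcases ha.eq_or_lt with rfl | h
      · rw [zero_mul] at hi; linarith
      · exact h
    have h2 : 2 * η ≤ ‖t‖ := by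
      by_contra hcon
      push Not at hcon
      have := mul_lt_mul_of_pos_left hcon hapos
      nlinarith
    have h3 : ‖t‖ / 2 ≤ ‖S.starProjection x - W.starProjection x‖ := by
      rw [hx]
      have h4 := norm_proj_sub_proj_le hWS e
      have h5 : ‖t‖ ≤ ‖t + (S.starProjection e - W.starProjection e)‖ +
          ‖S.starProjection e - W.starProjection e‖ := by
        have := norm_sub_le (t + (S.starProjection e - W.starProjection e))
          (S.starProjection e - W.starProjection e)
        simpa using this
      linarith
    have htpos : 0 < ‖t‖ := by
      by_contra hcon
      have : ‖t‖ = 0 := le_antisymm (not_lt.1 hcon) (norm_nonneg _)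
      rw [this, mul_zero] at hi; linarith
    have hxpos : 0 < ‖S.starProjection x - W.starProjection x‖ := by linarith
    obtain ⟨S', h1, h2, h3', h4⟩ := exists_tilt_dev C q hWS (norm_pos_iff.1 hxpos)
    refine ⟨S', h1, h2 V hSV hxV, h3' h hdim, h4.trans ?_⟩
    gcongr
    rw [← mul_div_assoc, div_le_iff₀ hxpos]
    calc spread C q W S * ‖res S x‖ ≤ (a * ‖t‖) * η := by gcongr
      _ = (2 * a * η) * (‖t‖ / 2) := by ring
      _ ≤ θ * ‖S.starProjection x - W.starProjection x‖ := by
          have : 0 ≤ 2 * a * η := by positivity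
          gcongr
          linarith

end Tilt

/-! ### Regular clusters -/

section Regular

variable {d n : ℕ}

/-- Many numbers of a family are at least half as large as the mean if the second moment is
bounded by the square of the mean. -/
lemma card_large_ge {ι : Type*} {C : Finset ι} {x : ι → ℝ} {β m : ℝ} (hmC : (C.card : ℝ) = m)
    (h : m * ∑ i ∈ C, x i ^ 2 ≤ β * (∑ i ∈ C, |x i|) ^ 2)
    (hpos : 0 < ∑ i ∈ C, x i ^ 2) :
    m ≤ 4 * β * (C.filter fun i => ∑ l ∈ C, |x l| ≤ 2 * m * |x i|).card := by
  have hm : 0 < m := by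
    have : C.Nonempty := by
      by_contra hcon
      rw [Finset.not_nonempty_iff_eq_empty] at hcon
      simp [hcon] at hpos
    rw [← hmC]
    exact Nat.cast_pos.2 this.card_pos
  obtain ⟨Y, hY⟩ : ∃ Y, ∑ i ∈ C, |x i| = Y := ⟨_, rfl⟩
  obtain ⟨s, hs⟩ : ∃ s, ∑ i ∈ C, x i ^ 2 = s := ⟨_, rfl⟩
  have hY0 : 0 ≤ Y := hY ▸ Finset.sum_nonneg fun _ _ => abs_nonneg _
  rw [hY, hs] at h
  rw [hs] at hpos
  rw [hY]
  have hβY : 0 < β * Y ^ 2 := lt_of_lt_of_le (mul_pos hm hpos) h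
  have hYpos : 0 < Y := by
    rcases hY0.eq_or_lt with h0 | h0
    · rw [← h0] at hβY; simp at hβY
    · exact h0
  -- The argument of Paley and Zygmund: numbers below half of the mean contribute at most half of
  -- the sum, so the large ones carry the other half, and by Cauchy–Schwarz there must be many of
  -- them.
  have hsmall : ∑ i ∈ C.filter (fun i => ¬ Y ≤ 2 * m * |x i|), |x i| ≤ Y / 2 := by
    calc _ ≤ ∑ i ∈ C.filter (fun i => ¬ Y ≤ 2 * m * |x i|), Y / (2 * m) := by
          refine Finset.sum_le_sum fun i hi => ?_
          rw [Finset.mem_filter, not_le] at hi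
          rw [le_div_iff₀ (by positivity)]
          linarith [hi.2]
      _ ≤ ∑ i ∈ C, Y / (2 * m) :=
          Finset.sum_le_sum_of_subset_of_nonneg (Finset.filter_subset _ _)
            fun _ _ _ => by positivity
      _ = Y / 2 := by rw [Finset.sum_const, nsmul_eq_mul, hmC]; field_simp
  have hsplit := Finset.sum_filter_add_sum_filter_not C (fun i => Y ≤ 2 * m * |x i|) fun i => |x i|
  have hcs : (∑ i ∈ C.filter (fun i => Y ≤ 2 * m * |x i|), |x i|) ^ 2 ≤
      (C.filter fun i => Y ≤ 2 * m * |x i|).card * s := by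
    refine (sq_sum_le_card_mul_sum_sq (s := C.filter fun i => Y ≤ 2 * m * |x i|)
      (f := fun i => |x i|)).trans (mul_le_mul_of_nonneg_left ?_ (Nat.cast_nonneg _))
    simp_rw [sq_abs]
    rw [← hs]
    exact Finset.sum_le_sum_of_subset_of_nonneg (Finset.filter_subset _ _)
      fun _ _ _ => sq_nonneg _
  have hb0 : (0 : ℝ) ≤ (C.filter fun i => Y ≤ 2 * m * |x i|).card := Nat.cast_nonneg _
  generalize ((C.filter fun i => Y ≤ 2 * m * |x i|).card : ℝ) = b at hcs hb0 ⊢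
  have hlarge : Y / 2 ≤ ∑ i ∈ C.filter (fun i => Y ≤ 2 * m * |x i|), |x i| := by linarith
  have h1 : (Y / 2) ^ 2 ≤ b * s := (pow_le_pow_left₀ (by linarith) hlarge 2).trans hcs
  have h2 : m * (Y / 2) ^ 2 ≤ b * (β * Y ^ 2) := by
    calc _ ≤ m * (b * s) := mul_le_mul_of_nonneg_left h1 hm.le
      _ = b * (m * s) := by ring
      _ ≤ _ := mul_le_mul_of_nonneg_left h hb0
  have hY2 : 0 < Y ^ 2 := by positivity
  refine le_of_mul_le_mul_right ?_ hY2
  linarith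

/-- Pigeonhole over an orthonormal basis of `Wᗮ ⊓ S`, which has at most `j` elements: one of them
carries a share `1/j` of the squared spread. This reduces the spread to a single direction, where
regularity applies. -/
lemma exists_direction {C : Finset (Fin n)} {q : Fin n → Vec d} {W S : Submodule ℝ (Vec d)}
    (hWS : W ≤ S) {j : ℕ} (hdim : Module.finrank ℝ S ≤ Module.finrank ℝ W + j)
    (hpos : 0 < spread C q W S) :
    ∃ v : Vec d, spread C q W S ^ 2 ≤ j * ∑ i ∈ C, inner ℝ (q i) v ^ 2 ∧
      ∀ i, |inner ℝ (q i) v| ≤ ‖S.starProjection (q i) - W.starProjection (q i)‖ := by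
  set T := Wᗮ ⊓ S with hT
  have hTd : Module.finrank ℝ T ≤ j := by
    have := Submodule.finrank_add_inf_finrank_orthogonal hWS
    rw [← hT] at this; omega
  let e := stdOrthonormalBasis ℝ T
  have hin : ∀ i (v : T), inner ℝ (S.starProjection (q i) - W.starProjection (q i)) (v : Vec d) =
      inner ℝ (q i) (v : Vec d) := by
    intro i v
    have h1 : inner ℝ (res S (q i)) (v : Vec d) = 0 := inner_res_left S _ v.2.2
    have h2 : inner ℝ (W.starProjection (q i)) (v : Vec d) = 0 := v.2.1 _ (proj_mem W _)
    rw [res_apply, inner_sub_left] at h1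
    rw [inner_sub_left, h2]; linarith
  have hmem : ∀ i, S.starProjection (q i) - W.starProjection (q i) ∈ T := by
    intro i
    refine ⟨fun w hw => ?_, S.sub_mem (proj_mem S _) (hWS (proj_mem W _))⟩
    have : S.starProjection (q i) - W.starProjection (q i) = res W (q i) - res S (q i) := by
      rw [res_apply, res_apply]; abel
    rw [this, inner_sub_right, inner_res_right W _ hw, inner_res_right S _ (hWS hw), sub_zero]
  have hsum : ∀ i, ∑ a, inner ℝ (q i) (e a : Vec d) ^ 2 =
      ‖S.starProjection (q i) - W.starProjection (q i)‖ ^ 2 := by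
    intro i
    have := e.sum_sq_norm_inner_right (⟨_, hmem i⟩ : T)
    simp only [Submodule.coe_inner, Real.norm_eq_abs, sq_abs, Submodule.coe_norm] at this
    rw [← this]
    refine Finset.sum_congr rfl fun a _ => ?_
    rw [← hin i (e a), real_inner_comm]
  have htot : spread C q W S ^ 2 = ∑ a, ∑ i ∈ C, inner ℝ (q i) (e a : Vec d) ^ 2 := by
    rw [spread_sq, Finset.sum_comm]
    exact Finset.sum_congr rfl fun i _ => (hsum i).symm
  have hne : (Finset.univ : Finset (Fin (Module.finrank ℝ T))).Nonempty := by
    by_contra hcon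
    rw [Finset.not_nonempty_iff_eq_empty] at hcon
    rw [hcon, Finset.sum_empty] at htot
    have : 0 < spread C q W S ^ 2 := by positivity
    linarith
  obtain ⟨a, -, ha⟩ := Finset.exists_max_image Finset.univ
    (fun a => ∑ i ∈ C, inner ℝ (q i) (e a : Vec d) ^ 2) hne
  refine ⟨e a, ?_, fun i => ?_⟩
  · rw [htot]
    refine (Finset.sum_le_card_nsmul _ _ _ fun b hb => ha b hb).trans ?_
    rw [nsmul_eq_mul, Finset.card_univ, Fintype.card_fin]
    gcongr
  · refine abs_le_of_sq_le_sq ?_ (norm_nonneg _)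
    rw [← hsum i]
    exact Finset.single_le_sum (f := fun a => inner ℝ (q i) (e a : Vec d) ^ 2)
      (fun _ _ => sq_nonneg _) (Finset.mem_univ a)

open Classical in
/-- A positive fraction of the points of a regular cluster is good. -/
lemma card_isGood_ge {C : Finset (Fin n)} {q : Fin n → Vec d} {β : ℝ} (hβ : 1 ≤ β)
    (hC : C.Nonempty)
    (hreg : ∀ v : Vec d, C.card * ∑ i ∈ C, inner ℝ (q i) v ^ 2 ≤
      β * (∑ i ∈ C, |inner ℝ (q i) v|) ^ 2)
    {W S : Submodule ℝ (Vec d)} (hWS : W ≤ S) {j : ℕ}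
    (hdim : Module.finrank ℝ S ≤ Module.finrank ℝ W + j) :
    (C.card : ℝ) ≤ 8 * β * (C.filter fun i =>
      IsGood C q √(4 * β * j * C.card) √(8 * β / C.card) W S i).card := by
  have hm : (0 : ℝ) < C.card := Nat.cast_pos.2 hC.card_pos
  have hβ0 : 0 < β := by linarith
  set A := C.filter fun i => spread C q W S ≤
    √(4 * β * j * C.card) * ‖S.starProjection (q i) - W.starProjection (q i)‖ with hA
  set B := C.filter fun i => ¬ ‖res S (q i)‖ ≤ √(8 * β / C.card) * dev C q S with hB
  have h1 : (C.card : ℝ) ≤ 4 * β * A.card := by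
    rcases (spread_nonneg C q W S).eq_or_lt with h0 | hpos
    · have : A = C := by
        rw [hA, ← h0]
        exact Finset.filter_true_of_mem fun i _ => by positivity
      rw [this]; nlinarith
    · obtain ⟨v, hv1, hv2⟩ := exists_direction hWS hdim hpos
      have hs : 0 < ∑ i ∈ C, inner ℝ (q i) v ^ 2 := by
        have : 0 < spread C q W S ^ 2 := by positivity
        by_contra hcon
        have : (j : ℝ) * ∑ i ∈ C, inner ℝ (q i) v ^ 2 ≤ 0 :=
          mul_nonpos_of_nonneg_of_nonpos (by positivity) (not_lt.1 hcon)
        linarith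
      refine (card_large_ge rfl (hreg v) hs).trans ?_
      gcongr
      intro i hi
      rw [Finset.mem_filter] at hi ⊢
      refine ⟨hi.1, ?_⟩
      set t := ‖S.starProjection (q i) - W.starProjection (q i)‖ with ht
      refine (sq_le_sq₀ (spread_nonneg _ _ _ _) (by positivity)).1 ?_
      rw [mul_pow, Real.sq_sqrt (by positivity)]
      refine hv1.trans ?_
      have h3 : ∑ l ∈ C, |inner ℝ (q l) v| ≤ 2 * C.card * t :=
        hi.2.trans (by gcongr; exact hv2 i)
      have h4 : C.card * ∑ i ∈ C, inner ℝ (q i) v ^ 2 ≤ β * (2 * C.card * t) ^ 2 := by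
        refine (hreg v).trans ?_
        have : 0 ≤ ∑ l ∈ C, |inner ℝ (q l) v| := Finset.sum_nonneg fun _ _ => abs_nonneg _
        gcongr
      have h5 : ∑ i ∈ C, inner ℝ (q i) v ^ 2 ≤ 4 * β * C.card * t ^ 2 := by
        refine le_of_mul_le_mul_left (h4.trans (le_of_eq ?_)) hm
        ring
      calc _ ≤ (j : ℝ) * (4 * β * C.card * t ^ 2) := by gcongr
        _ = _ := by ring
  -- Chebyshev's inequality; the threshold is set such that the far points are at most half of the
  -- number guaranteed for `A`.
  have h2 : 8 * β * B.card ≤ C.card := by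
    rcases (dev_nonneg C q S).eq_or_lt with h0 | hpos
    · have hz : ∑ i ∈ C, ‖res S (q i)‖ ^ 2 = 0 := by rw [← dev_sq, ← h0]; ring
      have : B = ∅ := by
        refine Finset.filter_false_of_mem fun i hi hcon => hcon ?_
        have := (Finset.sum_eq_zero_iff_of_nonneg fun i _ => sq_nonneg ‖res S (q i)‖).1 hz i hi
        rw [pow_eq_zero_iff two_ne_zero] at this
        rw [this]
        exact mul_nonneg (Real.sqrt_nonneg _) (dev_nonneg _ _ _)
      rw [this]; simp
    · have h3 : B.card * (8 * β / C.card * dev C q S ^ 2) ≤ dev C q S ^ 2 := by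
        calc _ = ∑ i ∈ B, (8 * β / C.card * dev C q S ^ 2) := by simp
          _ ≤ ∑ i ∈ B, ‖res S (q i)‖ ^ 2 := by
              refine Finset.sum_le_sum fun i hi => ?_
              rw [hB, Finset.mem_filter, not_le] at hi
              have := pow_le_pow_left₀ (mul_nonneg (Real.sqrt_nonneg _) (dev_nonneg _ _ _))
                hi.2.le 2
              rwa [mul_pow, Real.sq_sqrt (by positivity)] at this
          _ ≤ ∑ i ∈ C, ‖res S (q i)‖ ^ 2 :=
              Finset.sum_le_sum_of_subset_of_nonneg (Finset.filter_subset _ _)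
                fun _ _ _ => by positivity
          _ = _ := (dev_sq _ _ _).symm
      have hp2 : 0 < dev C q S ^ 2 := by positivity
      have h4 : (B.card * (8 * β / C.card)) * dev C q S ^ 2 ≤ 1 * dev C q S ^ 2 := by linarith
      have h5 := le_of_mul_le_mul_right h4 hp2
      rw [← mul_div_assoc, div_le_one hm] at h5
      linarith
  have h3 : (A.card : ℝ) ≤ (C.filter fun i =>
      IsGood C q √(4 * β * j * C.card) √(8 * β / C.card) W S i).card + B.card := by
    rw [← Nat.cast_add]
    refine Nat.cast_le.2 ((Finset.card_le_card ?_).trans (Finset.card_union_le _ _))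
    intro i hi
    rw [hA, Finset.mem_filter] at hi
    rw [Finset.mem_union, Finset.mem_filter, hB, Finset.mem_filter]
    by_cases h : ‖res S (q i)‖ ≤ √(8 * β / C.card) * dev C q S
    · exact Or.inl ⟨hi.1, hi.2, h⟩
    · exact Or.inr ⟨hi.1, h⟩
  nlinarith

lemma sum_sub_centroid {C : Finset (Fin n)} (hC : C.Nonempty) (P : Fin n → Vec d) :
    ∑ i ∈ C, (P i - centroid C P) = 0 := by
  have hm : (C.card : ℝ) ≠ 0 := Nat.cast_ne_zero.2 hC.card_pos.ne'
  rw [Finset.sum_sub_distrib, Finset.sum_const, centroid, ← Nat.cast_smul_eq_nsmul ℝ,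
    smul_inv_smul₀ hm, sub_self]

/-- Free of roots and quotients the condition is homogeneous in `v`, so it extends from unit vectors
to all vectors. It also covers constant families, where both sides vanish. -/
lemma IsRegular.sum_sq_le {ω : ℝ} (hω : 1 ≤ ω) {C : Finset (Fin n)} (hC : C.Nonempty)
    {P : Fin n → Vec d} (h : IsRegular ω C P) (v : Vec d) :
    C.card * ∑ i ∈ C, inner ℝ (P i - centroid C P) v ^ 2 ≤
      ω ^ 2 * (∑ i ∈ C, |inner ℝ (P i - centroid C P) v|) ^ 2 := by
  have hm : (0 : ℝ) < C.card := Nat.cast_pos.2 hC.card_pos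
  have unit : ∀ v : Vec d, ‖v‖ = 1 → C.card * ∑ i ∈ C, inner ℝ (P i - centroid C P) v ^ 2 ≤
      ω ^ 2 * (∑ i ∈ C, |inner ℝ (P i - centroid C P) v|) ^ 2 := by
    intro v hv
    have h1 := h v hv
    have hmean : avg C (fun i => inner ℝ (P i - centroid C P) v) = 0 := by
      rw [avg, ← sum_inner, sum_sub_centroid hC]; simp
    simp only [coefVar, hmean, sub_zero] at h1
    set Y := ∑ i ∈ C, |inner ℝ (P i - centroid C P) v| with hY
    have hY0 : 0 ≤ Y := Finset.sum_nonneg fun _ _ => abs_nonneg _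
    rcases hY0.eq_or_lt with h0 | hpos
    · have : ∑ i ∈ C, inner ℝ (P i - centroid C P) v ^ 2 = 0 := by
        refine Finset.sum_eq_zero fun i hi => ?_
        have := (Finset.sum_eq_zero_iff_of_nonneg fun i _ =>
          abs_nonneg (inner ℝ (P i - centroid C P) v)).1 (hY.symm.trans h0.symm) i hi
        rw [abs_eq_zero] at this
        rw [this]; ring
      rw [this, mul_zero]; positivity
    · have havg : 0 < avg C (fun i => |inner ℝ (P i - centroid C P) v|) := by
        rw [avg]; positivity
      rw [div_le_iff₀ havg] at h1
      have h2 := (Real.sqrt_le_iff.1 h1).2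
      rw [avg, avg, ← hY, mul_pow, div_pow, div_le_iff₀ hm] at h2
      calc _ ≤ C.card * (ω ^ 2 * (Y ^ 2 / C.card ^ 2) * C.card) := by gcongr
        _ = _ := by field_simp
  by_cases hv : v = 0
  · simp [hv]
  · have hn : 0 < ‖v‖ := norm_pos_iff.2 hv
    have h1 := unit (‖v‖⁻¹ • v) (by rw [norm_smul, norm_inv, norm_norm, inv_mul_cancel₀ hn.ne'])
    simp only [inner_smul_right, abs_mul, mul_pow, ← Finset.mul_sum, abs_of_pos (inv_pos.2 hn)]
      at h1
    have h2 : 0 < (‖v‖⁻¹) ^ 2 := by positivity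
    refine le_of_mul_le_mul_left ?_ h2
    linarith

/-- Regularity about an arbitrary center. -/
lemma sum_sq_add_const_le {ω : ℝ} (hω : 1 ≤ ω) {C : Finset (Fin n)} (hC : C.Nonempty)
    {x : Fin n → ℝ} (hx : ∑ i ∈ C, x i = 0)
    (h : C.card * ∑ i ∈ C, x i ^ 2 ≤ ω ^ 2 * (∑ i ∈ C, |x i|) ^ 2) (b : ℝ) :
    C.card * ∑ i ∈ C, (x i + b) ^ 2 ≤ 5 * ω ^ 2 * (∑ i ∈ C, |x i + b|) ^ 2 := by
  have hm : (0 : ℝ) < C.card := Nat.cast_pos.2 hC.card_pos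
  set Y := ∑ i ∈ C, |x i + b| with hY
  -- The sum `Y` of the shifted absolute values dominates both `m|b|` and half of `∑|x i|`, where
  -- `m` is the number of points. This gives `4ω²Y² + Y²`, whence the factor 5.
  have h1 : ∑ i ∈ C, (x i + b) ^ 2 = ∑ i ∈ C, x i ^ 2 + C.card * b ^ 2 := by
    have : ∀ i, (x i + b) ^ 2 = x i ^ 2 + 2 * b * x i + b ^ 2 := fun i => by ring
    simp_rw [this, Finset.sum_add_distrib, ← Finset.mul_sum, hx, Finset.sum_const, nsmul_eq_mul]
    ring
  have h2 : C.card * |b| ≤ Y := by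
    have := Finset.abs_sum_le_sum_abs (fun i => x i + b) C
    rw [Finset.sum_add_distrib, hx, Finset.sum_const, nsmul_eq_mul, zero_add, abs_mul,
      abs_of_pos hm] at this
    exact this
  have h3 : ∑ i ∈ C, |x i| ≤ 2 * Y := by
    have : ∑ i ∈ C, |x i| ≤ ∑ i ∈ C, (|x i + b| + |b|) := by
      refine Finset.sum_le_sum fun i _ => ?_
      have := abs_sub (x i + b) b
      simpa using this
    rw [Finset.sum_add_distrib, Finset.sum_const, nsmul_eq_mul] at this
    linarith
  have h4 : 0 ≤ ∑ i ∈ C, |x i| := Finset.sum_nonneg fun _ _ => abs_nonneg _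
  have h5 : (C.card * |b|) ^ 2 ≤ Y ^ 2 := by gcongr
  have h6 : (∑ i ∈ C, |x i|) ^ 2 ≤ (2 * Y) ^ 2 := by gcongr
  have h7 : ω ^ 2 * (∑ i ∈ C, |x i|) ^ 2 ≤ ω ^ 2 * (2 * Y) ^ 2 := by gcongr
  have h8 : 1 * Y ^ 2 ≤ ω ^ 2 * Y ^ 2 := by gcongr; nlinarith
  rw [mul_pow, sq_abs] at h5
  rw [h1]
  nlinarith

/-- The projection is self-adjoint, so the new family along `v` is the centered family along
`V.starProjection v` plus a constant. The trees see only projected points and an approximate center,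
hence the arbitrary `V` and `o`. -/
lemma IsRegular.sum_sq_proj_le {ω : ℝ} (hω : 1 ≤ ω) {C : Finset (Fin n)} (hC : C.Nonempty)
    {P : Fin n → Vec d} (h : IsRegular ω C P) (V : Submodule ℝ (Vec d)) (o v : Vec d) :
    C.card * ∑ i ∈ C, inner ℝ (V.starProjection (P i) - o) v ^ 2 ≤
      5 * ω ^ 2 * (∑ i ∈ C, |inner ℝ (V.starProjection (P i) - o) v|) ^ 2 := by
  have key : ∀ i, inner ℝ (V.starProjection (P i) - o) v =
      inner ℝ (P i - centroid C P) (V.starProjection v) +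
        (inner ℝ (centroid C P) (V.starProjection v) - inner ℝ o v) := by
    intro i
    rw [inner_sub_left, inner_sub_left, V.inner_starProjection_left_eq_right]; ring
  simp_rw [key]
  refine sum_sq_add_const_le hω hC ?_ (h.sum_sq_le hω hC _) _
  rw [← sum_inner, sum_sub_centroid hC]; simp

end Regular

/-! ### Dimension reduction: adaptive sampling yields a subspace containing near-optimal flats. -/

section DimensionReduction

variable {d n k : ℕ}

/-! ### One round of adaptive sampling -/

lemma foldSteps_extend {P : Fin n → Vec d} {g : List (Vec d) → Option (Fin n) → Timed (List (Vec d))}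
    (h₀ : ∀ W, (g W none).val = W) (h₁ : ∀ W i, (g W (some i)).val = (extend W (P i)).val)
    (I : List (Option (Fin n))) {W : List (Vec d)} (hW : Orth W) :
    Orth (foldSteps g W I).val ∧ sp W ≤ sp (foldSteps g W I).val ∧
      ∀ i, some i ∈ I → P i ∈ sp (foldSteps g W I).val := by
  induction I generalizing W with
  | nil => exact ⟨hW, le_rfl, by simp⟩
  | cons o I ih =>
    rw [foldSteps_cons]
    cases o with
    | none =>
      rw [h₀]
      obtain ⟨h2, h3, h4⟩ := ih hW
      exact ⟨h2, h3, fun i hi => h4 i (by simpa using hi)⟩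
    | some i =>
      rw [h₁]
      have h5 := extend_val hW (P i)
      obtain ⟨h2, h3, h4⟩ := ih h5.1
      rw [h5.2] at h3
      refine ⟨h2, le_sup_left.trans h3, fun i' hi' => ?_⟩
      rcases List.mem_cons.1 hi' with h | h
      · cases h
        exact h3 (Submodule.mem_sup_right (Submodule.mem_span_singleton_self _))
      · exact h4 i' h

/-- The squared distances of the points to the span of `W`. -/
def weights (P : Fin n → Vec d) (W : List (Vec d)) (i : Fin n) : ℝ := ‖res (sp W) (P i)‖ ^ 2

lemma weights_nonneg (P : Fin n → Vec d) (W : List (Vec d)) (i : Fin n) : 0 ≤ weights P W i :=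
  sq_nonneg _

/-- Reduces a round to its sampled indices. About the new list it is only used that it is orthogonal
and that its span contains the old span and the sampled points. -/
lemma adaptiveRound_except {P : Fin n → Vec d} {s : ℕ} {W : List (Vec d)} (hW : Orth W) {δ : ℝ}
    {G : List (Vec d) → Prop} {H : List (Option (Fin n)) → Prop}
    (h : (repeatRand s (weightedIndex (weights P W))).Except δ H)
    (hG : ∀ I W', H I → Orth W' → sp W ≤ sp W' → (∀ i, some i ∈ I → P i ∈ sp W') → G W') :
    (adaptiveRound P s W).Except δ G := by
  have hw : (fun i => (sqDist W (P i)).val) = weights P W :=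
    funext fun i => sqDist_val hW (P i)
  unfold adaptiveRound
  refine Rand.Except.det_bind ?_
  rw [table_val, hw]
  refine (h.bind le_rfl fun I hI => Rand.except_det ?_).mono (by simp) fun _ h => h
  obtain ⟨h2, h3, h4⟩ := foldSteps_extend (P := P) (g := fun W o =>
    match o with
    | none => pure W
    | some i => extend W (P i)) (fun _ => rfl) (fun _ _ => rfl) I hW
  exact hG I _ hI h2 h3 h4

lemma length_repeatRand {α : Type} (s : ℕ) (f : Rand α) :
    (repeatRand s f).Except 0 fun L => L.length = s := by
  refine ⟨le_rfl, ?_⟩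
  rw [ENNReal.ofReal_zero, nonpos_iff_eq_zero]
  have key : ∀ t, (repeatRand s f).mean (failure fun L => L.length + t = s + t) = 0 := by
    induction s with
    | zero => intro t; rw [mean_repeatRand_zero]; exact failure_of (by simp)
    | succ s ih =>
      intro t
      rw [mean_repeatRand_succ]
      refine le_antisymm (le_trans (Rand.mean_mono _ (h := fun _ => 0) fun b => ?_)
        (Rand.mean_const _ _).le) zero_le
      refine le_trans (Rand.mean_mono _ fun L => failure_mono fun h => ?_) (ih t).le
      rw [List.length_cons]; omega
  simpa using key 0

/-- The expected value of a real function of a weighted random index. -/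
lemma except_weightedIndex {P : Fin n → Vec d} {W : List (Vec d)} {G : Fin n → Prop}
    [DecidablePred G] {δ : ℝ} (hδ : 0 ≤ δ) (hE : 0 < ∑ i, weights P W i)
    (h : ∑ i ∈ Finset.univ.filter (fun i => ¬ G i), weights P W i ≤ δ * ∑ i, weights P W i) :
    (weightedIndex (weights P W)).Except δ fun o => ∃ i, o = some i ∧ G i := by
  refine ⟨hδ, ?_⟩
  have h1 : (weightedIndex (weights P W)).mean (failure fun o => ∃ i, o = some i ∧ G i) ≤
      (weightedIndex (weights P W)).mean (fun o => ENNReal.ofReal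
        (Option.elim o 1 fun i => if G i then 0 else 1)) := by
    refine Rand.mean_mono _ fun o => ?_
    cases o with
    | none => simpa using failure_le_one _ _
    | some i =>
      by_cases hi : G i
      · rw [failure_of ⟨i, rfl, hi⟩]; exact zero_le
      · simpa [hi] using failure_le_one _ _
  refine h1.trans ?_
  rw [mean_weightedIndex_ofReal (weights_nonneg P W) hE]
  · refine ENNReal.ofReal_le_ofReal ?_
    have h2 : ∀ i, weights P W i / (∑ l, weights P W l) *
        (Option.elim (some i) 1 fun i => if G i then (0 : ℝ) else 1) =
        if ¬ G i then weights P W i / (∑ l, weights P W l) else 0 := by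
      intro i; by_cases hi : G i <;> simp [hi]
    simp_rw [h2]
    rw [← Finset.sum_filter, ← Finset.sum_div, div_le_iff₀ hE]
    exact h
  · intro o
    cases o with
    | none => simp
    | some i => by_cases hi : G i <;> simp [hi]

/-- A round of adaptive sampling finds a new direction close to an unknown subspace. -/
lemma adaptiveRound_tilt {P : Fin n → Vec d} {s : ℕ} (hs : 0 < s) {W : List (Vec d)} (hW : Orth W)
    {S : Submodule ℝ (Vec d)} (hWS : sp W ≤ S) {h : ℕ}
    (hdim : Module.finrank ℝ S ≤ Module.finrank ℝ (sp W) + (h + 1)) {B Γ : ℝ} (hΓ : 1 ≤ Γ)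
    (hB : dev Finset.univ P S ^ 2 ≤ B) :
    (adaptiveRound P s W).Except (2 / Γ) fun W' => Orth W' ∧ ∃ S', sp W' ≤ S' ∧
      Module.finrank ℝ S' ≤ Module.finrank ℝ (sp W') + h ∧
      dev Finset.univ P S' ^ 2 ≤ 4 * Γ * B := by
  classical
  have hB0 : 0 ≤ B := (sq_nonneg _).trans hB
  have hΓ0 : 0 < Γ := by linarith
  -- If the error of the span itself is already within the target, `S'` is taken to be the new span.
  -- Otherwise its error exceeds `4ΓB`, which makes bad points unlikely below.
  by_cases hsmall : dev Finset.univ P (sp W) ^ 2 ≤ 4 * Γ * B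
  · refine (adaptiveRound_except hW (length_repeatRand _ _) ?_).mono (by positivity) fun _ h => h
    intro I W' _ hW' hle _
    refine ⟨hW', sp W', le_rfl, by omega, le_trans ?_ hsmall⟩
    exact pow_le_pow_left₀ (dev_nonneg _ _ _) (dev_anti _ _ hle) 2
  · push Not at hsmall
    have hE : ∑ i, weights P W i = dev Finset.univ P (sp W) ^ 2 := (dev_sq _ _ _).symm
    have hEpos : 0 < ∑ i, weights P W i := by
      rw [hE]; exact lt_of_le_of_lt (by positivity) hsmall
    set t : Fin n → ℝ := fun i => ‖S.starProjection (P i) - (sp W).starProjection (P i)‖ ^ 2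
      with ht
    set r : Fin n → ℝ := fun i => ‖res S (P i)‖ ^ 2 with hr
    set D2 := spread Finset.univ P (sp W) S ^ 2 with hD2
    have hD2t : D2 = ∑ i, t i := spread_sq _ _ _ _
    have hrB : ∑ i, r i ≤ B := by rw [hr, ← dev_sq]; exact hB
    have hr0 : ∀ i, 0 ≤ r i := fun i => sq_nonneg _
    have ht0 : ∀ i, 0 ≤ t i := fun i => sq_nonneg _
    have hw : ∀ i, weights P W i = r i + t i := fun i => norm_res_sq_of_le hWS (P i)
    have hED : D2 ≤ ∑ i, weights P W i := by
      rw [hE, dev_sq_of_le _ _ hWS]; nlinarith [sq_nonneg (dev Finset.univ P S)]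
    -- Tilting towards a good index adds at most `√(ΓB)` to the deviation. A bad index has `t i` at
    -- most about `D2 r i / (ΓB)`, which sums to `D2/Γ`. With `∑ r ≤ B` the bad weight is at most `B
    -- + D2/Γ`, hence at most a fraction `2/Γ` of the total.
    let G : Fin n → Prop := fun i => 0 < t i ∧ D2 * r i ≤ Γ * B * t i
    have hbad : ∑ i ∈ Finset.univ.filter (fun i => ¬ G i), t i ≤ D2 / Γ := by
      rcases hB0.eq_or_lt with h0 | hBpos
      · have hrz : ∀ i, r i = 0 := by
          intro i
          have : ∑ i, r i = 0 := le_antisymm (by linarith) (Finset.sum_nonneg fun i _ => hr0 i)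
          exact (Finset.sum_eq_zero_iff_of_nonneg fun i _ => hr0 i).1 this i (Finset.mem_univ i)
        refine le_trans (le_of_eq (Finset.sum_eq_zero fun i hi => ?_)) (by positivity)
        rw [Finset.mem_filter] at hi
        by_contra hcon
        refine hi.2 ⟨lt_of_le_of_ne (ht0 i) (Ne.symm hcon), ?_⟩
        rw [hrz i, ← h0]; simp
      · rw [le_div_iff₀ hΓ0]
        refine le_of_mul_le_mul_right ?_ hBpos
        calc (∑ i ∈ Finset.univ.filter (fun i => ¬ G i), t i) * Γ * B
            = ∑ i ∈ Finset.univ.filter (fun i => ¬ G i), Γ * B * t i := by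
              rw [← Finset.mul_sum]; ring
          _ ≤ ∑ i ∈ Finset.univ.filter (fun i => ¬ G i), D2 * r i := by
              refine Finset.sum_le_sum fun i hi => ?_
              rw [Finset.mem_filter] at hi
              by_contra hcon
              push Not at hcon
              refine hi.2 ⟨?_, hcon.le⟩
              refine lt_of_le_of_ne (ht0 i) fun h0 => ?_
              rw [← h0, mul_zero] at hcon
              exact absurd hcon (not_lt.2 (mul_nonneg (sq_nonneg _) (hr0 i)))
          _ ≤ ∑ i, D2 * r i :=
              Finset.sum_le_sum_of_subset_of_nonneg (Finset.filter_subset _ _)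
                fun i _ _ => mul_nonneg (sq_nonneg _) (hr0 i)
          _ = D2 * ∑ i, r i := by rw [Finset.mul_sum]
          _ ≤ D2 * B := mul_le_mul_of_nonneg_left hrB (sq_nonneg _)
    have hprob : ∑ i ∈ Finset.univ.filter (fun i => ¬ G i), weights P W i ≤
        2 / Γ * ∑ i, weights P W i := by
      simp_rw [hw] at hEpos hED ⊢
      rw [Finset.sum_add_distrib]
      have h1 : ∑ i ∈ Finset.univ.filter (fun i => ¬ G i), r i ≤ B :=
        (Finset.sum_le_sum_of_subset_of_nonneg (Finset.filter_subset _ _)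
          fun i _ _ => hr0 i).trans hrB
      have h2 : B ≤ (∑ i, (r i + t i)) / Γ := by
        rw [le_div_iff₀ hΓ0]
        rw [← hE] at hsmall
        simp_rw [hw] at hsmall
        nlinarith
      have h3 : D2 / Γ ≤ (∑ i, (r i + t i)) / Γ := by gcongr
      have h4 : 2 / Γ * ∑ i, (r i + t i) = (∑ i, (r i + t i)) / Γ + (∑ i, (r i + t i)) / Γ := by
        ring
      linarith
    refine adaptiveRound_except hW (except_repeatRand_exists hs
      (except_weightedIndex (by positivity) hEpos hprob)) ?_
    rintro I W' ⟨_, hoI, i, rfl, hti, hi⟩ hW' hle hmem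
    have hpi : P i ∈ sp W' := hmem i hoI
    have hne : S.starProjection (P i) - (sp W).starProjection (P i) ≠ 0 := by
      intro h0
      rw [ht] at hti
      simp [h0] at hti
    obtain ⟨S₁, h1, -, h3, h4⟩ := exists_tilt_dev Finset.univ P hWS hne
    -- The other points of the batch are joined to the tilted subspace. This does not raise its
    -- codimension over the new span, since both contain `sp W` and the good point.
    refine ⟨hW', S₁ ⊔ sp W', le_sup_right, ?_, ?_⟩
    · have h5 := Submodule.finrank_sup_add_finrank_inf_eq S₁ (sp W')
      have h6 : sp W ⊔ Submodule.span ℝ {P i} ≤ S₁ ⊓ sp W' :=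
        le_inf h1 (sup_le hle ((Submodule.span_singleton_le_iff_mem _ _).2 hpi))
      have h7 := Submodule.finrank_mono h6
      have h8 := h3 h hdim
      omega
    · have h5 : dev Finset.univ P (S₁ ⊔ sp W') ≤ dev Finset.univ P S₁ := dev_anti _ _ le_sup_left
      -- With `y² ≤ ΓB` the new squared error is at most `2(B + ΓB) ≤ 4ΓB`.
      set y := spread Finset.univ P (sp W) S *
        (‖res S (P i)‖ / ‖S.starProjection (P i) - (sp W).starProjection (P i)‖) with hy
      have hy2 : y ^ 2 ≤ Γ * B := by
        rw [hy, mul_pow, div_pow, ← mul_div_assoc, div_le_iff₀ hti]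
        exact hi
      have h6 := h5.trans h4
      have h7 := pow_le_pow_left₀ (dev_nonneg _ _ _) h6 2
      nlinarith [sq_nonneg (dev Finset.univ P S - y)]

/-! ### Approximating the flats of the clusters -/

/-- The sum of the squared distances of the points to the flats of their clusters. -/
def flatCost (P : Fin n → Vec d) (cl : Fin n → Fin k) (c : Fin k → Vec d)
    (D : Fin k → Submodule ℝ (Vec d)) : ℝ := ∑ i, ‖res (D (cl i)) (P i - c (cl i))‖ ^ 2

lemma sum_cluster (cl : Fin n → Fin k) (f : Fin k → Fin n → ℝ) :
    ∑ l, ∑ i ∈ cluster cl l, f l i = ∑ i, f (cl i) i := by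
  rw [← Finset.sum_fiberwise Finset.univ cl fun i => f (cl i) i]
  refine Finset.sum_congr rfl fun l _ => Finset.sum_congr rfl fun i hi => ?_
  rw [(Finset.mem_filter.1 hi).2]

/-- The normal equations of least squares: as the coefficient families are orthonormal, completing
the square shows that `∑ u a i • p i` is the best choice of `w a` and that any other choice costs
exactly the squared distance from it. -/
lemma sum_norm_sub_sum_smul_sq {ι : Type*} [Fintype ι] [DecidableEq ι] {C : Finset (Fin n)}
    {u : ι → Fin n → ℝ} (hu : ∀ a b, ∑ i ∈ C, u a i * u b i = if a = b then 1 else 0)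
    (p : Fin n → Vec d) (w : ι → Vec d) :
    ∑ i ∈ C, ‖p i - ∑ a, u a i • w a‖ ^ 2 =
      ∑ i ∈ C, ‖p i‖ ^ 2 - ∑ a, ‖∑ i ∈ C, u a i • p i‖ ^ 2 +
        ∑ a, ‖∑ i ∈ C, u a i • p i - w a‖ ^ 2 := by
  have h1 : ∀ i, ‖p i - ∑ a, u a i • w a‖ ^ 2 = ‖p i‖ ^ 2 - 2 * ∑ a, u a i * inner ℝ (p i) (w a) +
      ∑ a, ∑ b, u a i * u b i * inner ℝ (w a) (w b) := by
    intro i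
    rw [norm_sub_sq_real, ← real_inner_self_eq_norm_sq (∑ a, u a i • w a), inner_sum, sum_inner]
    simp_rw [inner_sum, inner_smul_left, inner_smul_right]
    simp [mul_assoc]
  have h2 : ∀ a, ‖∑ i ∈ C, u a i • p i - w a‖ ^ 2 = ‖∑ i ∈ C, u a i • p i‖ ^ 2 -
      2 * ∑ i ∈ C, u a i * inner ℝ (p i) (w a) + ‖w a‖ ^ 2 := by
    intro a
    rw [norm_sub_sq_real, sum_inner]
    simp_rw [inner_smul_left]; simp
  have h3 : ∑ i ∈ C, ∑ a, ∑ b, u a i * u b i * inner ℝ (w a) (w b) = ∑ a, ‖w a‖ ^ 2 := by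
    rw [Finset.sum_comm]
    refine Finset.sum_congr rfl fun a _ => ?_
    rw [Finset.sum_comm]
    simp_rw [← Finset.sum_mul, hu]
    simp
  simp_rw [h1, h2, Finset.sum_add_distrib, Finset.sum_sub_distrib, h3, ← Finset.mul_sum]
  rw [Finset.sum_comm]
  ring

lemma inner_eq_sum_mul (x y : Vec n) : inner ℝ x y = ∑ i, x i * y i := by
  rw [PiLp.inner_apply]
  exact Finset.sum_congr rfl fun i _ => mul_comm _ _

lemma sum_inner_smul_orthonormalBasis {D : Submodule ℝ (Vec d)} {m : ℕ}
    (b : OrthonormalBasis (Fin m) ℝ D) (x : Vec d) :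
    ∑ c, (inner ℝ x (b c : Vec d)) • (b c : Vec d) = D.starProjection x := by
  have h5 := b.sum_repr' (D.orthogonalProjectionOnto x)
  have h6 := congrArg (fun x : D => (x : Vec d)) h5
  simp only [Submodule.coe_inner, AddSubmonoidClass.coe_finsetSum, Submodule.coe_smul] at h6
  have h7 : ((D.orthogonalProjectionOnto x : D) : Vec d) = D.starProjection x := rfl
  rw [h7] at h6
  refine Eq.trans (Finset.sum_congr rfl fun c _ => ?_) h6
  have := inner_res_right D x (b c).2
  rw [res_apply, inner_sub_right, sub_eq_zero] at this
  rw [real_inner_comm, this]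

/-- The coordinates along `D` of the centered points of a cluster are linear combinations of few
orthonormal families of numbers. -/
lemma exists_centered_coeffs {C : Finset (Fin n)} (hC : C.Nonempty) (P : Fin n → Vec d)
    (D : Submodule ℝ (Vec d)) :
    ∃ j' ≤ Module.finrank ℝ D, ∃ e : Fin j' → Fin n → ℝ, (∀ a, ∀ i, i ∉ C → e a i = 0) ∧
      (∀ a, ∑ i ∈ C, e a i = 0) ∧ (∀ a b, ∑ i, e a i * e b i = if a = b then 1 else 0) ∧
      ∃ z : Fin j' → Vec d, ∀ i ∈ C,
        ∑ a, e a i • z a = D.starProjection (P i - centroid C P) := by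
  classical
  set o := centroid C P with ho
  -- A direction is sent to the coordinates of the centered points along it. The image of `D` has at
  -- most the dimension of `D`, and an orthonormal basis of it is the required family; vanishing off
  -- `C` and vanishing sums hold for every element of the image.
  let Λ₀ : Vec d →ₗ[ℝ] Vec n :=
    { toFun := fun h => WithLp.toLp 2 fun i => if i ∈ C then inner ℝ (P i - o) h else 0
      map_add' := by
        intro x y; ext i
        by_cases hi : i ∈ C <;> simp [hi, inner_add_right]
      map_smul' := by
        intro a x; ext i
        by_cases hi : i ∈ C <;> simp [hi, inner_smul_right] }
  have hΛ : ∀ h i, Λ₀ h i = if i ∈ C then inner ℝ (P i - o) h else 0 := fun _ _ => rfl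
  clear_value Λ₀
  set R := D.map Λ₀ with hR
  obtain ⟨m, hm⟩ : ∃ m, m = Module.finrank ℝ R := ⟨_, rfl⟩
  have e : OrthonormalBasis (Fin m) ℝ R := hm ▸ stdOrthonormalBasis ℝ R
  refine ⟨m, hm.le.trans (Submodule.finrank_map_le Λ₀ D), fun a i => (e a : Vec n) i,
    ?_, ?_, ?_, ?_⟩
  · intro a i hi
    obtain ⟨h, -, hh⟩ := (e a).2
    change (e a : Vec n) i = 0
    rw [← hh, hΛ, if_neg hi]
  · intro a
    obtain ⟨h, -, hh⟩ := (e a).2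
    have h1 : ∀ i ∈ C, (e a : Vec n) i = inner ℝ (P i - o) h := by
      intro i hi
      rw [← hh, hΛ, if_pos hi]
    rw [Finset.sum_congr rfl h1, ← sum_inner, sum_sub_centroid hC]; simp
  · intro a b
    rw [← (orthonormal_iff_ite.1 e.orthonormal) a b, Submodule.coe_inner, inner_eq_sum_mul]
  · let b := stdOrthonormalBasis ℝ D
    refine ⟨fun a => ∑ c, (inner ℝ (e a : Vec n) (Λ₀ (b c))) • (b c : Vec d), fun i hi => ?_⟩
    rw [← sum_inner_smul_orthonormalBasis b]
    simp_rw [Finset.smul_sum, smul_smul]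
    rw [Finset.sum_comm]
    refine Finset.sum_congr rfl fun c _ => ?_
    rw [← Finset.sum_smul]
    congr 1
    have h3 := e.sum_repr' (⟨Λ₀ (b c), Submodule.mem_map_of_mem (b c).2⟩ : R)
    have h4 := congrArg (fun x : R => (x : Vec n) i) h3
    simp only [Submodule.coe_inner, AddSubmonoidClass.coe_finsetSum, Submodule.coe_smul,
      WithLp.ofLp_sum, Finset.sum_apply, PiLp.smul_apply, smul_eq_mul] at h4
    rw [hΛ, if_pos hi] at h4
    rw [← h4]
    exact Finset.sum_congr rfl fun a _ => mul_comm _ _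

/-- The points of a cluster are approximated by few linear combinations of themselves. -/
lemma exists_coeffs {C : Finset (Fin n)} (hC : C.Nonempty) (P : Fin n → Vec d)
    (D : Submodule ℝ (Vec d)) :
    ∃ j' ≤ Module.finrank ℝ D, ∃ u : Option (Fin j') → Fin n → ℝ, (∀ a, ∑ i, u a i ^ 2 ≤ 1) ∧
      (∀ i ∈ C, u none i = (√C.card)⁻¹) ∧ ∀ w : Option (Fin j') → Vec d,
      ∑ i ∈ C, ‖P i - ∑ a, u a i • w a‖ ^ 2 ≤
        ∑ i ∈ C, ‖res D (P i - centroid C P)‖ ^ 2 + ∑ a, ‖∑ i, u a i • P i - w a‖ ^ 2 := by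
  classical
  have hm : (0 : ℝ) < C.card := Nat.cast_pos.2 hC.card_pos
  obtain ⟨j', hj', e, heC, hesum, heorth, z, hz⟩ := exists_centered_coeffs hC P D
  set o := centroid C P with ho
  -- The additional family `none` is constant on `C`. It is orthogonal to the others because they
  -- sum to zero, and it accounts for the centroid.
  let u : Option (Fin j') → Fin n → ℝ := fun a i =>
    Option.elim a (if i ∈ C then (√C.card)⁻¹ else 0) fun a => e a i
  have huC : ∀ a i, i ∉ C → u a i = 0 := by
    intro a i hi
    cases a with
    | none => simp [u, hi]
    | some a => exact heC a i hi
  have hu0 : ∀ i ∈ C, u none i = (√C.card)⁻¹ := fun i hi => by simp [u, hi]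
  have huniv : ∀ f : Fin n → ℝ, (∀ i, i ∉ C → f i = 0) → ∑ i ∈ C, f i = ∑ i, f i := fun f hf =>
    Finset.sum_subset (Finset.subset_univ C) fun i _ hi => hf i hi
  have hsq : (√(C.card : ℝ))⁻¹ * (√(C.card : ℝ))⁻¹ = (C.card : ℝ)⁻¹ := by
    rw [← mul_inv, Real.mul_self_sqrt hm.le]
  have horth : ∀ a b, ∑ i ∈ C, u a i * u b i = if a = b then 1 else 0 := by
    have hns : ∀ b, ∑ i ∈ C, u none i * u (some b) i = 0 := by
      intro b
      rw [Finset.sum_congr rfl fun i hi => by rw [hu0 i hi], ← Finset.mul_sum]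
      change _ * ∑ i ∈ C, e b i = 0
      rw [hesum, mul_zero]
    intro a b
    cases a with
    | none =>
      cases b with
      | none =>
        rw [Finset.sum_congr rfl fun i hi => by rw [hu0 i hi, hsq], Finset.sum_const,
          nsmul_eq_mul, mul_inv_cancel₀ hm.ne', if_pos rfl]
      | some b => rw [hns, if_neg (by simp)]
    | some a =>
      cases b with
      | none =>
        rw [if_neg (by simp), ← hns a]
        exact Finset.sum_congr rfl fun i _ => mul_comm _ _
      | some b =>
        rw [huniv _ fun i hi => by rw [huC _ i hi, zero_mul]]
        simp only [Option.some.injEq]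
        exact heorth a b
  let z' : Option (Fin j') → Vec d := fun a => Option.elim a (√(C.card : ℝ) • o) z
  have hz' : ∀ i ∈ C, P i - ∑ a, u a i • z' a = res D (P i - o) := by
    intro i hi
    have h0 : u none i • z' none = o := by
      rw [hu0 i hi]
      change (√(C.card : ℝ))⁻¹ • √(C.card : ℝ) • o = o
      rw [inv_smul_smul₀ (Real.sqrt_ne_zero'.2 hm)]
    have h1 : ∑ a, u (some a) i • z' (some a) = D.starProjection (P i - o) := hz i hi
    rw [Fintype.sum_option, h0, h1, res_apply]; abel
  refine ⟨j', hj', u, fun a => ?_, hu0, fun w => ?_⟩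
  · have := horth a a
    rw [if_pos rfl, huniv _ fun i hi => by rw [huC _ i hi, zero_mul]] at this
    simp_rw [sq]; exact this.le
  · have hb : ∀ a, ∑ i, u a i • P i = ∑ i ∈ C, u a i • P i := fun a =>
      (Finset.sum_subset (Finset.subset_univ C) fun i _ hi => by
        rw [huC a i hi, zero_smul]).symm
    simp_rw [hb]
    have h1 : ∑ i ∈ C, ‖res D (P i - o)‖ ^ 2 = ∑ i ∈ C, ‖P i - ∑ a, u a i • z' a‖ ^ 2 :=
      Finset.sum_congr rfl fun i hi => by rw [hz' i hi]
    -- Both `w` and the exact vectors `z'` are compared with the least squares optimum, and the cost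
    -- of `z'` is the cost of the flat.
    rw [sum_norm_sub_sum_smul_sq horth P w, h1, sum_norm_sub_sum_smul_sq horth P z']
    have : 0 ≤ ∑ a, ‖∑ i ∈ C, u a i • P i - z' a‖ ^ 2 :=
      Finset.sum_nonneg fun _ _ => sq_nonneg _
    linarith

/-- The centered estimator of a linear combination of the residuals from one sampled index. -/
def estimator (P : Fin n → Vec d) (W : List (Vec d)) (u : Fin n → ℝ) (o : Option (Fin n)) : Vec d :=
  (Option.elim o 0 fun i => (u i * (∑ l, weights P W l) / weights P W i) • res (sp W) (P i)) -
    ∑ i, u i • res (sp W) (P i)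

/-- Importance weighting: an index drawn with probability `w i / E` is weighted by `E / w i`, so the
estimator is centered and its second moment is at most `E ∑ u i² ≤ E`. If all weights vanish, so do
the residuals, and the outcome `none` contributes zero. -/
lemma mean_estimator_le (P : Fin n → Vec d) (W : List (Vec d)) {u : Fin n → ℝ}
    (hu : ∑ i, u i ^ 2 ≤ 1) (y : Vec d) :
    (weightedIndex (weights P W)).mean
      (fun o => ENNReal.ofReal (‖y + estimator P W u o‖ ^ 2)) ≤
      ENNReal.ofReal (‖y‖ ^ 2 + ∑ i, weights P W i) := by
  have hw0 := weights_nonneg P W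
  rcases (Finset.sum_nonneg fun i (_ : i ∈ Finset.univ) => hw0 i).eq_or_lt with h0 | hE
  · have hz : ∀ i, weights P W i = 0 := fun i =>
      (Finset.sum_eq_zero_iff_of_nonneg fun i _ => hw0 i).1 h0.symm i (Finset.mem_univ i)
    have hr : ∀ i, res (sp W) (P i) = 0 := fun i => by
      have := hz i
      rwa [weights, pow_eq_zero_iff two_ne_zero, norm_eq_zero] at this
    rw [mean_weightedIndex_of_sum_eq_zero hz, ← h0]
    simp [estimator, hr]
  · rw [mean_weightedIndex_ofReal hw0 hE fun _ => sq_nonneg _]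
    refine ENNReal.ofReal_le_ofReal ?_
    set E := ∑ i, weights P W i with hEdef
    set ξ : Fin n → Vec d := fun i => (u i * E / weights P W i) • res (sp W) (P i) with hξ
    have hμ : ∑ i, (weights P W i / E) • ξ i = ∑ i, u i • res (sp W) (P i) := by
      refine Finset.sum_congr rfl fun i _ => ?_
      rw [hξ, smul_smul]
      by_cases hi : weights P W i = 0
      · have : res (sp W) (P i) = 0 := by
          rwa [weights, pow_eq_zero_iff two_ne_zero, norm_eq_zero] at hi
        simp [this]
      · congr 1; field_simp
    have h1 : ∑ i, weights P W i / E = 1 := by rw [← Finset.sum_div, div_self hE.ne']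
    have h2 := sum_mul_norm_add_sub_sq_le h1 ξ y
    rw [hμ] at h2
    refine h2.trans (add_le_add le_rfl ?_)
    have hkey : ∀ x v : ℝ, x / E * ((v * E / x) ^ 2 * x) ≤ E * v ^ 2 := by
      intro x v
      by_cases hx : x = 0
      · rw [hx, zero_div, zero_mul]; positivity
      · refine le_of_eq ?_; field_simp
    calc ∑ i, weights P W i / E * ‖ξ i‖ ^ 2 ≤ ∑ i, E * u i ^ 2 := by
          refine Finset.sum_le_sum fun i _ => ?_
          rw [hξ, norm_smul, mul_pow, Real.norm_eq_abs, sq_abs]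
          exact hkey (weights P W i) (u i)
      _ = E * ∑ i, u i ^ 2 := by rw [Finset.mul_sum]
      _ ≤ E * 1 := by gcongr
      _ = E := mul_one E

/-- The part of the combination inside `sp W` is known, and the averaged samples estimate the
residual part. So the new span contains a vector that differs from the exact combination by the
averaged noise only. -/
lemma sum_map_estimator_mem {P : Fin n → Vec d} {W W' : List (Vec d)} (u : Fin n → ℝ)
    {I : List (Option (Fin n))} {s : ℕ} (hs : 0 < s) (hI : I.length = s) (hle : sp W ≤ sp W')
    (hmem : ∀ i, some i ∈ I → P i ∈ sp W') :
    ∑ i, u i • P i + (s : ℝ)⁻¹ • (I.map (estimator P W u)).sum ∈ sp W' := by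
  have hs' : (s : ℝ) ≠ 0 := Nat.cast_ne_zero.2 hs.ne'
  set μ := ∑ i, u i • res (sp W) (P i) with hμ
  have h1 : ∀ J : List (Option (Fin n)), (∀ i, some i ∈ J → P i ∈ sp W') →
      (J.map (estimator P W u)).sum + (J.length : ℝ) • μ ∈ sp W' := by
    intro J hJ
    induction J with
    | nil => simp
    | cons o J ih =>
      have h2 := ih fun i hi => hJ i (by simp [hi])
      have h3 : ((o :: J).map (estimator P W u)).sum + ((o :: J).length : ℝ) • μ =
          (estimator P W u o + μ) + ((J.map (estimator P W u)).sum + (J.length : ℝ) • μ) := by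
        rw [List.map_cons, List.sum_cons, List.length_cons]
        push_cast
        rw [add_smul, one_smul]; abel
      rw [h3]
      refine Submodule.add_mem _ ?_ h2
      rw [estimator, ← hμ, sub_add_cancel]
      cases o with
      | none => simp
      | some i =>
        refine Submodule.smul_mem _ _ ?_
        rw [res_apply]
        exact Submodule.sub_mem _ (hJ i (by simp)) (hle (proj_mem _ _))
  have h2 := Submodule.smul_mem _ (s : ℝ)⁻¹ (h1 I hmem)
  rw [hI, smul_add, inv_smul_smul₀ hs'] at h2
  have h3 : ∑ i, u i • P i + (s : ℝ)⁻¹ • (I.map (estimator P W u)).sum =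
      ∑ i, u i • (sp W).starProjection (P i) +
        ((s : ℝ)⁻¹ • (I.map (estimator P W u)).sum + μ) := by
    have : ∑ i, u i • P i = ∑ i, u i • (sp W).starProjection (P i) + μ := by
      rw [hμ, ← Finset.sum_add_distrib]
      refine Finset.sum_congr rfl fun i _ => ?_
      rw [res_apply, ← smul_add]; congr 1; abel
    rw [this]; abel
  rw [h3]
  exact Submodule.add_mem _ (Submodule.sum_mem _ fun i _ => Submodule.smul_mem _ _
    (hle (proj_mem _ _))) h2

/-- The span of `W` contains flats of total cost at most `Z` for the clusters. -/
def Captures (P : Fin n → Vec d) (cl : Fin n → Fin k) (j : ℕ) (Z : ℝ) (W : List (Vec d)) : Prop :=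
  Orth W ∧ ∃ (c : Fin k → Vec d) (D : Fin k → Submodule ℝ (Vec d)),
    (∀ l, c l ∈ sp W ∧ D l ≤ sp W ∧ Module.finrank ℝ (D l) ≤ j) ∧ flatCost P cl c D ≤ Z

lemma Captures.mono {P : Fin n → Vec d} {cl : Fin n → Fin k} {j : ℕ} {Z Z' : ℝ} {W : List (Vec d)}
    (h : Captures P cl j Z W) (hZ : Z ≤ Z') : Captures P cl j Z' W := by
  obtain ⟨h0, c, D, h1, h2⟩ := h
  exact ⟨h0, c, D, h1, h2.trans hZ⟩

/-- The captured flats lie in the span, so the distances to the span are no larger. This feeds the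
result of one round into the next. -/
lemma Captures.dev_sq_le {P : Fin n → Vec d} {cl : Fin n → Fin k} {j : ℕ} {Z : ℝ}
    {W : List (Vec d)} (h : Captures P cl j Z W) : dev Finset.univ P (sp W) ^ 2 ≤ Z := by
  obtain ⟨-, c, D, h1, h2⟩ := h
  rw [dev_sq]
  refine (Finset.sum_le_sum fun i _ => ?_).trans h2
  rw [norm_res_sub_sq (h1 (cl i)).2.1 (P i) (h1 (cl i)).1]
  nlinarith [sq_nonneg ‖res (D (cl i)) ((sp W).starProjection (P i) - c (cl i))‖]

/-- A round of adaptive sampling captures flats up to an additive error. -/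
lemma adaptiveRound_captures {P : Fin n → Vec d} {cl : Fin n → Fin k} {j s : ℕ} (hs : 0 < s)
    (hcl : ∀ l, (cluster cl l).Nonempty) {D : Fin k → Submodule ℝ (Vec d)}
    (hD : ∀ l, Module.finrank ℝ (D l) ≤ j) {Z : ℝ}
    (hZ : flatCost P cl (fun l => centroid (cluster cl l) P) D ≤ Z)
    {W : List (Vec d)} (hW : Orth W) {δ : ℝ} (hδ : 0 < δ) :
    (adaptiveRound P s W).Except δ (Captures P cl j
      (Z + k * (j + 1) / (s * δ) * dev Finset.univ P (sp W) ^ 2)) := by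
  have hs' : (0 : ℝ) < s := Nat.cast_pos.2 hs
  choose j' hj' u hu1 hu0 huw using fun l => exists_coeffs (hcl l) P (D l)
  set E := dev Finset.univ P (sp W) ^ 2 with hE
  have hEw : ∑ i, weights P W i = E := (dev_sq _ _ _).symm
  have hE0 : 0 ≤ E := sq_nonneg _
  let err : ∀ l, Option (Fin (j' l)) → List (Option (Fin n)) → ℝ := fun l a I =>
    ‖(I.map (estimator P W (u l a))).sum‖ ^ 2 / s ^ 2
  have hmean : ∀ l a, (repeatRand s (weightedIndex (weights P W))).mean
      (fun I => ENNReal.ofReal (err l a I)) ≤ ENNReal.ofReal (E / s) := by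
    intro l a
    have h1 := mean_repeatRand_norm_sq_le (Finset.sum_nonneg fun i _ => weights_nonneg P W i)
      (mean_estimator_le P W (hu1 l a)) s 0
    simp only [zero_add, norm_zero, ne_eq, OfNat.ofNat_ne_zero, not_false_eq_true, zero_pow,
      hEw] at h1
    have h2 : ∀ I, ENNReal.ofReal (err l a I) =
        ENNReal.ofReal (‖(I.map (estimator P W (u l a))).sum‖ ^ 2) *
          ENNReal.ofReal ((s : ℝ) ^ 2)⁻¹ := by
      intro I
      rw [← ENNReal.ofReal_mul (sq_nonneg _)]; rfl
    simp_rw [h2]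
    rw [Rand.mean_mul_const]
    refine (mul_le_mul_left h1 _).trans ?_
    rw [← ENNReal.ofReal_mul (by positivity)]
    refine ENNReal.ofReal_le_ofReal (le_of_eq ?_)
    field_simp
  -- At most `k(j+1)` combinations are estimated, each with mean squared error at most `E / s`.
  have htotal : (repeatRand s (weightedIndex (weights P W))).mean
      (fun I => ENNReal.ofReal (∑ l, ∑ a, err l a I)) ≤
      ENNReal.ofReal (k * (j + 1) * (E / s)) := by
    have h1 : ∀ I, ENNReal.ofReal (∑ l, ∑ a, err l a I) =
        ∑ l, ∑ a, ENNReal.ofReal (err l a I) := by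
      intro I
      rw [ENNReal.ofReal_sum_of_nonneg fun l _ => Finset.sum_nonneg fun a _ => by positivity]
      exact Finset.sum_congr rfl fun l _ =>
        ENNReal.ofReal_sum_of_nonneg fun a _ => by positivity
    simp_rw [h1]
    rw [Rand.mean_sum]
    simp_rw [Rand.mean_sum]
    calc _ ≤ ∑ l, ∑ a : Option (Fin (j' l)), ENNReal.ofReal (E / s) :=
          Finset.sum_le_sum fun l _ => Finset.sum_le_sum fun a _ => hmean l a
      _ ≤ ∑ l : Fin k, ((j : ℝ≥0∞) + 1) * ENNReal.ofReal (E / s) := by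
          refine Finset.sum_le_sum fun l _ => ?_
          rw [Finset.sum_const, Finset.card_univ, Fintype.card_option, Fintype.card_fin,
            nsmul_eq_mul]
          gcongr
          push_cast
          gcongr
          exact (hj' l).trans (hD l)
      _ = _ := by
          rw [Finset.sum_const, Finset.card_univ, Fintype.card_fin, nsmul_eq_mul,
            ENNReal.ofReal_mul (by positivity), ENNReal.ofReal_mul (by positivity),
            ENNReal.ofReal_natCast, ENNReal.ofReal_add (by positivity) (by positivity),
            ENNReal.ofReal_natCast, ENNReal.ofReal_one, mul_assoc]
  have hmarkov := Rand.except_of_mean_le hδ (by positivity) htotal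
  refine (adaptiveRound_except hW (hmarkov.and (length_repeatRand _ _)) ?_).mono (by simp)
    fun _ h => h
  rintro I W' ⟨hI, hlen⟩ hW' hle hmem
  -- The estimates of the combinations: `none` gives the new center after division by the root of
  -- the cluster size, the others span the new direction.
  let w : ∀ l, Option (Fin (j' l)) → Vec d := fun l a =>
    ∑ i, u l a i • P i + (s : ℝ)⁻¹ • (I.map (estimator P W (u l a))).sum
  have hw : ∀ l a, w l a ∈ sp W' := fun l a => sum_map_estimator_mem (u l a) hs hlen hle hmem
  refine ⟨hW', fun l => (√((cluster cl l).card : ℝ))⁻¹ • w l none,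
    fun l => Submodule.span ℝ (Set.range fun a => w l (some a)), fun l => ⟨?_, ?_, ?_⟩, ?_⟩
  · exact Submodule.smul_mem _ _ (hw l none)
  · exact Submodule.span_le.2 (by rintro _ ⟨a, rfl⟩; exact hw l (some a))
  · refine (finrank_range_le_card _).trans ?_
    rw [Fintype.card_fin]
    exact (hj' l).trans (hD l)
  · rw [flatCost, ← sum_cluster cl fun l i =>
      ‖res (Submodule.span ℝ (Set.range fun a => w l (some a)))
        (P i - (√((cluster cl l).card : ℝ))⁻¹ • w l none)‖ ^ 2]
    have h1 : ∀ l, ∑ i ∈ cluster cl l,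
        ‖res (Submodule.span ℝ (Set.range fun a => w l (some a)))
        (P i - (√((cluster cl l).card : ℝ))⁻¹ • w l none)‖ ^ 2 ≤
        ∑ i ∈ cluster cl l, ‖res (D l) (P i - centroid (cluster cl l) P)‖ ^ 2 +
          ∑ a, err l a I := by
      intro l
      refine (Finset.sum_le_sum fun i hi => ?_).trans ((huw l (w l)).trans (le_of_eq ?_))
      · refine pow_le_pow_left₀ (norm_nonneg _) ?_ 2
        have h2 : ∑ a, u l (some a) i • w l (some a) ∈
            Submodule.span ℝ (Set.range fun a => w l (some a)) :=
          Submodule.sum_mem _ fun a _ => Submodule.smul_mem _ _ (Submodule.subset_span ⟨a, rfl⟩)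
        refine (norm_res_le _ _ h2).trans (le_of_eq ?_)
        rw [Fintype.sum_option, hu0 l i hi]
        congr 1; abel
      · congr 1
        refine Finset.sum_congr rfl fun a _ => ?_
        change ‖_ - (_ + _)‖ ^ 2 = _ / _
        rw [sub_add_cancel_left, norm_neg, norm_smul, mul_pow, norm_inv, Real.norm_natCast, inv_pow]
        ring
    refine (Finset.sum_le_sum fun l _ => h1 l).trans ?_
    rw [Finset.sum_add_distrib, sum_cluster cl fun l i =>
      ‖res (D l) (P i - centroid (cluster cl l) P)‖ ^ 2]
    refine add_le_add hZ (hI.trans (le_of_eq ?_))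
    field_simp

/-! ### All rounds -/

/-- From error `2Z + y` a round leads to `Z + γ(2Z + y) ≤ 2Z + y/2`, so the excess `y` is halved
every time. -/
lemma adaptiveRounds_captures {P : Fin n → Vec d} {cl : Fin n → Fin k} {j s : ℕ} (hs : 0 < s)
    (hcl : ∀ l, (cluster cl l).Nonempty) {D : Fin k → Submodule ℝ (Vec d)}
    (hD : ∀ l, Module.finrank ℝ (D l) ≤ j) {Z : ℝ} (hZ0 : 0 ≤ Z)
    (hZ : flatCost P cl (fun l => centroid (cluster cl l) P) D ≤ Z) {δ γ : ℝ} (hδ : 0 < δ)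
    (hγ : k * (j + 1) / (s * δ) ≤ γ) (hγ2 : γ ≤ 1 / 2) (t : ℕ) :
    ∀ (W : List (Vec d)) (y : ℝ), Orth W → 0 ≤ y → dev Finset.univ P (sp W) ^ 2 ≤ 2 * Z + y →
    (adaptiveRounds P s (t + 1) W).Except ((t + 1) * δ)
      (Captures P cl j (Z + γ * (2 * Z + y / 2 ^ t))) := by
  have hγ0 : 0 ≤ γ := le_trans (by positivity) hγ
  have round : ∀ (W : List (Vec d)) (y : ℝ), Orth W → 0 ≤ y →
      dev Finset.univ P (sp W) ^ 2 ≤ 2 * Z + y →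
      (adaptiveRound P s W).Except δ (Captures P cl j (Z + γ * (2 * Z + y))) := by
    intro W y hW hy hE
    refine (adaptiveRound_captures hs hcl hD hZ hW hδ).mono le_rfl fun W' h => h.mono ?_
    gcongr
  induction t with
  | zero =>
    intro W y hW hy hE
    refine ((round W y hW hy hE).bind (f := fun W' => adaptiveRounds P s 0 W') le_rfl
      fun W' hW' => Rand.except_pure hW').mono (by simp) fun W' h => by simpa using h
  | succ t ih =>
    intro W y hW hy hE
    refine ((round W y hW hy hE).bind (f := fun W' => adaptiveRounds P s (t + 1) W')
      (by positivity) fun W' hW' => ih W' (y / 2) hW'.1 (by positivity) ?_).mono ?_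
        fun W' h => h.mono (le_of_eq ?_)
    · refine hW'.dev_sq_le.trans ?_
      nlinarith
    · push_cast; linarith
    · rw [pow_succ']; ring

/-- Each round trades one missing dimension for a factor `4Γ` in the squared error. When none is
missing, the auxiliary subspace is the span itself. -/
lemma adaptiveRounds_start {P : Fin n → Vec d} {s : ℕ} (hs : 0 < s) {Γ : ℝ} (hΓ : 1 ≤ Γ) {t : ℕ}
    {δ : ℝ} (hδ : 0 ≤ δ) {G : List (Vec d) → Prop} (h : ℕ) :
    ∀ (W : List (Vec d)) (B : ℝ), Orth W →
    (∃ S, sp W ≤ S ∧ Module.finrank ℝ S ≤ Module.finrank ℝ (sp W) + h ∧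
      dev Finset.univ P S ^ 2 ≤ B) →
    (∀ W', Orth W' → dev Finset.univ P (sp W') ^ 2 ≤ (4 * Γ) ^ h * B →
      (adaptiveRounds P s t W').Except δ G) →
    (adaptiveRounds P s (h + t) W).Except (h * (2 / Γ) + δ) G := by
  induction h with
  | zero =>
    rintro W B hW ⟨S, hWS, hdim, hB⟩ hnext
    have : sp W = S := Submodule.eq_of_le_of_finrank_le hWS (by simpa using hdim)
    rw [Nat.zero_add]
    refine (hnext W hW (by simpa [this] using hB)).mono (by simp) fun _ h => h
  | succ h ih =>
    rintro W B hW ⟨S, hWS, hdim, hB⟩ hnext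
    rw [show h + 1 + t = (h + t) + 1 by omega]
    refine ((adaptiveRound_tilt hs hW hWS hdim hΓ hB).bind
      (f := fun W' => adaptiveRounds P s (h + t) W') (by positivity) fun W' hW' =>
        ih W' (4 * Γ * B) hW'.1 hW'.2 fun W'' h1 h2 => hnext W'' h1 (h2.trans (le_of_eq ?_))).mono
        ?_ fun _ h => h
    · rw [pow_succ]; ring
    · push_cast; linarith

/-- The dimension reduction captures near-optimal flats. -/
lemma dimensionReduction_captures {P : Fin n → Vec d} {cl : Fin n → Fin k} {j s : ℕ} (hs : 0 < s)
    (hcl : ∀ l, (cluster cl l).Nonempty) {D : Fin k → Submodule ℝ (Vec d)}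
    (hD : ∀ l, Module.finrank ℝ (D l) ≤ j) {Z : ℝ}
    (hZ : flatCost P cl (fun l => centroid (cluster cl l) P) D ≤ Z) {δ γ Γ : ℝ} (hδ : 0 < δ)
    (hγ : k * (j + 1) / (s * δ) ≤ γ) (hγ2 : γ ≤ 1 / 2) (hΓ : 1 ≤ Γ) {h t : ℕ}
    (hh : k * (j + 1) ≤ h) (ht : (4 * Γ) ^ h ≤ 2 ^ t) :
    (dimensionReduction P (h + (t + 1)) s).Except (h * (2 / Γ) + (t + 1) * δ)
      fun B => Captures P cl j ((1 + 3 * γ) * Z) B ∧ ∀ b ∈ B, ‖b‖ = 1 := by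
  have hZ0 : 0 ≤ Z := le_trans (Finset.sum_nonneg fun _ _ => sq_nonneg _) hZ
  have hγ0 : 0 ≤ γ := le_trans (by positivity) hγ
  set o : Fin k → Vec d := fun l => centroid (cluster cl l) P with ho
  have hstart : ∃ S : Submodule ℝ (Vec d), sp [] ≤ S ∧
      Module.finrank ℝ S ≤ Module.finrank ℝ (sp ([] : List (Vec d))) + h ∧
      dev Finset.univ P S ^ 2 ≤ Z := by
    -- The centers and bases of all the flats: at most `k(j+1)` vectors, spanning a subspace that
    -- contains every flat.
    let v : (Σ l : Fin k, Option (Fin (Module.finrank ℝ (D l)))) → Vec d := fun x =>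
      Option.elim x.2 (o x.1) fun a => (stdOrthonormalBasis ℝ (D x.1) a : Vec d)
    refine ⟨Submodule.span ℝ (Set.range v), by simp, ?_, ?_⟩
    · refine (finrank_range_le_card v).trans ?_
      rw [Fintype.card_sigma]
      simp only [Fintype.card_option, Fintype.card_fin]
      calc _ ≤ ∑ l : Fin k, (j + 1) :=
            Finset.sum_le_sum fun l _ => Nat.add_le_add_right (hD l) 1
        _ = k * (j + 1) := by simp
        _ ≤ _ := by omega
    · rw [dev_sq]
      refine le_trans (Finset.sum_le_sum fun i _ => ?_) hZ
      refine pow_le_pow_left₀ (norm_nonneg _) ?_ 2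
      have ho' : o (cl i) ∈ Submodule.span ℝ (Set.range v) :=
        Submodule.subset_span ⟨⟨cl i, none⟩, rfl⟩
      have hD' : D (cl i) ≤ Submodule.span ℝ (Set.range v) := by
        intro x hx
        have h1 := (stdOrthonormalBasis ℝ (D (cl i))).sum_repr (⟨x, hx⟩ : D (cl i))
        have h2 := congrArg (fun x : D (cl i) => (x : Vec d)) h1
        simp only [AddSubmonoidClass.coe_finsetSum, Submodule.coe_smul] at h2
        rw [← h2]
        exact Submodule.sum_mem _ fun a _ => Submodule.smul_mem _ _
          (Submodule.subset_span ⟨⟨cl i, some a⟩, rfl⟩)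
      refine (norm_res_le _ (P i) (Submodule.add_mem _ ho'
        (hD' (proj_mem (D (cl i)) (P i - o (cl i)))))).trans (le_of_eq ?_)
      rw [res_apply]; congr 1; abel
  unfold dimensionReduction
  refine ((adaptiveRounds_start (G := Captures P cl j ((1 + 3 * γ) * Z)) hs hΓ
    (by positivity : 0 ≤ ((t : ℝ) + 1) * δ) h [] Z orth_nil hstart
    fun W' hW' hE => ?_).bind le_rfl fun W hW => Rand.except_det ?_).mono (by simp) fun _ h => h
  -- The initial excess `2^t Z` is what `t` halvings reduce to `Z`, leaving the total error term
  -- `3γZ`.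
  · refine (adaptiveRounds_captures hs hcl hD hZ0 hZ hδ hγ hγ2 t W' (2 ^ t * Z) hW'
      (by positivity) (hE.trans ?_)).mono le_rfl fun W hW => hW.mono (le_of_eq ?_)
    · nlinarith [mul_le_mul_of_nonneg_right ht hZ0]
    · field_simp; ring
  · rw [normalizeAll_val]
    obtain ⟨h0, c, D', h1, h2⟩ := hW
    obtain ⟨h3, h4, h5⟩ := h0.normalize
    exact ⟨⟨h3, c, D', by rw [h4]; exact h1, h2⟩, h5⟩

end DimensionReduction

/-! ### A good leaf of the recursion tree for one cluster. -/

section RecursiveProjection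

variable {d n : ℕ}

/-! ### Growing a tree -/

/-- The analysis needs only the singleton subsets, that is, the sampled points themselves. -/
lemma mem_symmetricSampling {Q : List (Vec d)} {q : Vec d} (hq : q ∈ Q) (o : Vec d) :
    q ∈ (symmetricSampling Q o).val := by
  simp only [symmetricSampling, Timed.val_bind]
  have h1 : [q].Sublist (Q ++ (mapSteps (fun s => do
      let q ← vadd o o
      vsub q s) Q).val) :=
    List.singleton_sublist.2 (List.mem_append_left _ hq)
  have h2 := mem_subsetMeans h1 (by simp)
  simpa using h2

lemma except_uniformIndex [NeZero n] {A : Finset (Fin n)} {p : ℝ} (hp1 : p ≤ 1)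
    (hA : p * n ≤ A.card) : (uniformIndex n).Except (1 - p) (· ∈ A) := by
  classical
  have hn : (0 : ℝ) < n := Nat.cast_pos.2 (NeZero.pos n)
  refine ⟨by linarith, ?_⟩
  have h1 : ∀ i : Fin n, failure (· ∈ A) i = ENNReal.ofReal (if i ∈ A then 0 else 1) := by
    intro i
    by_cases hi : i ∈ A
    · rw [failure_of (G := (· ∈ A)) hi]; simp [hi]
    · rw [failure_of_not (G := (· ∈ A)) hi]; simp [hi]
  have h2 : (uniformIndex n).mean (failure (· ∈ A)) =
      (uniformIndex n).mean fun i => ENNReal.ofReal (if i ∈ A then 0 else 1) := by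
    congr 1; exact funext h1
  rw [h2, mean_uniformIndex_ofReal fun i => by split_ifs <;> simp]
  refine ENNReal.ofReal_le_ofReal ?_
  have h3 : ∑ i : Fin n, (if i ∈ A then (0 : ℝ) else 1) = n - A.card := by
    have : ∀ i : Fin n, (if i ∈ A then (0 : ℝ) else 1) = 1 - if i ∈ A then 1 else 0 := by
      intro i; split_ifs <;> simp
    simp_rw [this, Finset.sum_sub_distrib]
    simp
  rw [← Finset.mul_sum, h3, inv_mul_le_iff₀ hn]
  linarith

/-- A path is followed along which the unseen subspace `S` contains the collected directions and has
deviation at most `b h` at height `h`. One sampled index of `A` makes the next step possible, and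
each level misses `A` with probability at most `1/(r p)`. At height zero the dimensions agree and
`S` is the span of the leaf. -/
lemma growTree_except [NeZero n] {P : Fin n → Vec d} {o : Vec d} {r : ℕ} (hr : 0 < r)
    {G : List (Vec d)} {V : Submodule ℝ (Vec d)} {C : Finset (Fin n)} {b : ℕ → ℝ} {p : ℝ}
    (hp : 0 < p) (hp1 : p ≤ 1) {j : ℕ}
    (step : ∀ h < j, ∀ W S : Submodule ℝ (Vec d), W ≤ S → S ≤ V →
      Module.finrank ℝ S ≤ Module.finrank ℝ W + (h + 1) →
      dev C (fun i => P i - o) S ≤ b (h + 1) →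
      ∃ A : Finset (Fin n), p * n ≤ A.card ∧ ∀ i ∈ A, ∃ g ∈ G, ∃ S' : Submodule ℝ (Vec d),
        W ⊔ Submodule.span ℝ {res W (P i - o) + g} ≤ S' ∧ S' ≤ V ∧
        Module.finrank ℝ S' ≤
          Module.finrank ℝ ↥(W ⊔ Submodule.span ℝ {res W (P i - o) + g}) + h ∧
        dev C (fun i => P i - o) S' ≤ b h) :
    ∀ h ≤ j, ∀ W : List (Vec d), Orth W →
      (∃ S, sp W ≤ S ∧ S ≤ V ∧ Module.finrank ℝ S ≤ Module.finrank ℝ (sp W) + h ∧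
        dev C (fun i => P i - o) S ≤ b h) →
      (growTree P o r G h W).Except (h * (1 / (r * p))) fun L => ∃ W' ∈ L, Orth W' ∧
        W'.length ≤ W.length + h ∧ sp W' ≤ V ∧ dev C (fun i => P i - o) (sp W') ≤ b 0 := by
  intro h
  induction h with
  | zero =>
    rintro - W hW ⟨S, hWS, hSV, hdim, hdev⟩
    have : sp W = S := Submodule.eq_of_le_of_finrank_le hWS (by simpa using hdim)
    rw [← this] at hSV hdev
    rw [growTree]
    exact (Rand.except_pure ⟨W, by simp, hW, by simp, hSV, hdev⟩).mono (by simp) fun _ h => h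
  | succ h ih =>
    rintro hj W hW ⟨S, hWS, hSV, hdim, hdev⟩
    obtain ⟨A, hA, hstep⟩ := step h hj (sp W) S hWS hSV hdim hdev
    rw [growTree]
    refine Rand.Except.det_bind ?_
    have hP : (table fun i => do
        let x ← vsub (P i) o
        let y ← orthPart W x
        vadd o y).val = fun i => o + res (sp W) (P i - o) := by
      funext i; simp [orthPart_val hW]
    rw [hP]
    have hsample : (drawSample r fun i => o + res (sp W) (P i - o)).Except (1 / (r * p))
        fun Q => ∃ i ∈ A, o + res (sp W) (P i - o) ∈ Q := by
      refine except_drawSample ((except_repeatRand_exists_of_prob hp hp1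
        (except_uniformIndex hp1 hA) hr).mono le_rfl ?_)
      rintro I ⟨i, hi, hiA⟩
      exact ⟨i, hiA, List.mem_map.2 ⟨i, hi, rfl⟩⟩
    refine (hsample.bind (δ₂ := h * (1 / (r * p))) (by positivity) ?_).mono
      (by push_cast; linarith) fun _ h => h
    rintro Q ⟨i, hiA, hiQ⟩
    obtain ⟨g, hg, S', h1, h2, h3, h4⟩ := hstep i hiA
    refine Rand.Except.det_bind (Rand.Except.det_bind (Rand.Except.det_bind ?_))
    set x := res (sp W) (P i - o) + g with hx
    have hmem : o + res (sp W) (P i - o) + g ∈ (concat (mapSteps (fun s =>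
        mapSteps (fun g => vadd s g) G) (symmetricSampling Q o).val).val).val := by
      simp only [concat_val, mapSteps_val, List.mem_flatten, List.mem_map]
      exact ⟨_, ⟨_, mem_symmetricSampling hiQ o, rfl⟩, by simpa using hg⟩
    have hsub : (vsub (o + res (sp W) (P i - o) + g) o).val = x := by
      rw [vsub_val, hx]; abel
    have hext := extend_val hW x
    have hlen := (extend_length W x).1
    have hrec := ih (by omega) (extend W x).val hext.1
      ⟨S', by rw [hext.2]; exact h1, h2, by rw [hext.2]; exact h3, h4⟩
    refine (Rand.Except.bind (δ₁ := h * (1 / (r * p))) (δ₂ := 0)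
      (except_forEach_exists hmem (H := fun L => ∃ W' ∈ L, Orth W' ∧
        W'.length ≤ W.length + (h + 1) ∧ sp W' ≤ V ∧ dev C (fun i => P i - o) (sp W') ≤ b 0)
      (Rand.Except.det_bind ?_)) le_rfl
      fun L hL => Rand.except_det ?_).mono (by simp) fun _ h => h
    · rw [hsub]
      refine Rand.Except.det_bind (hrec.mono le_rfl ?_)
      rintro L ⟨W', hW', h5, h6, h7⟩
      exact ⟨W', hW', h5, by omega, h7⟩
    · obtain ⟨L', hL', W', hW', h5⟩ := hL
      exact ⟨W', List.mem_flatten.2 ⟨L', hL', hW'⟩, h5⟩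

/-! ### The center -/

/-- The mean of the sampled points of a cluster is close to the mean of the cluster in the
directions orthogonal to a subspace. -/
lemma exists_center_except [NeZero n] {P : Fin n → Vec d} {V D : Submodule ℝ (Vec d)}
    (hPV : ∀ i, P i ∈ V) {C : Finset (Fin n)} (hC : C.Nonempty) {r : ℕ} (hr : 0 < r) {μ δ : ℝ}
    (hμ : 0 < μ) (hCμ : μ * n ≤ C.card) (hδ : 0 < δ) :
    (drawSample r P).Except (δ + 4 / (r * μ)) fun Q => ∃ o ∈ (subsetMeans Q).val, o ∈ V ∧
      C.card * ‖res D (o - centroid C P)‖ ^ 2 ≤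
        4 / (r * μ * δ) * ∑ i ∈ C, ‖res D (P i - centroid C P)‖ ^ 2 := by
  classical
  have hn : (0 : ℝ) < n := Nat.cast_pos.2 (NeZero.pos n)
  have hm : (0 : ℝ) < C.card := Nat.cast_pos.2 hC.card_pos
  have hr' : (0 : ℝ) < r := Nat.cast_pos.2 hr
  set o' := centroid C P with ho'
  set K := ∑ i ∈ C, ‖res D (P i - o')‖ ^ 2 with hK
  have hK0 : 0 ≤ K := Finset.sum_nonneg fun _ _ => sq_nonneg _
  obtain ⟨ν, hν⟩ : ∃ ν : ℝ, ν = C.card / n := ⟨_, rfl⟩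
  have hμν : μ ≤ ν := by rw [hν, le_div_iff₀ hn]; exact hCμ
  have hν0 : 0 < ν := by linarith
  have huni : ∑ i : Fin n, (n : ℝ)⁻¹ = 1 := by
    rw [Finset.sum_const, Finset.card_univ, Fintype.card_fin, nsmul_eq_mul, mul_inv_cancel₀ hn.ne']
  -- `φ` sums the deviations of the sampled points of `C` from their centroid, and `ψ` counts those
  -- points, centered. Both have mean zero over all indices.
  let φ : Fin n → Vec d := fun i => if i ∈ C then res D (P i - o') else 0
  let ψ : Fin n → ℝ := fun i => (if i ∈ C then 1 else 0) - ν
  have hφ : ∀ y : Vec d, (uniformIndex n).mean (fun i => ENNReal.ofReal (‖y + φ i‖ ^ 2)) ≤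
      ENNReal.ofReal (‖y‖ ^ 2 + K / n) := by
    intro y
    rw [mean_uniformIndex_ofReal fun _ => sq_nonneg _]
    refine ENNReal.ofReal_le_ofReal ?_
    have h1 := sum_mul_norm_add_sub_sq_le huni φ y
    have h2 : ∑ i, (n : ℝ)⁻¹ • φ i = 0 := by
      rw [← Finset.smul_sum]
      have : ∑ i, φ i = 0 := by
        simp only [φ, Finset.sum_ite_mem, Finset.univ_inter]
        rw [← map_sum, sum_sub_centroid hC, map_zero]
      rw [this, smul_zero]
    rw [h2] at h1
    simp only [sub_zero] at h1
    refine h1.trans (le_of_eq ?_)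
    rw [← Finset.mul_sum]
    have h3 : ∀ i, ‖φ i‖ ^ 2 = if i ∈ C then ‖res D (P i - o')‖ ^ 2 else 0 := by
      intro i; by_cases hi : i ∈ C <;> simp [φ, hi]
    simp_rw [h3]
    rw [Finset.sum_ite_mem, Finset.univ_inter, ← hK]; ring
  have hψ : ∀ y : ℝ, (uniformIndex n).mean (fun i => ENNReal.ofReal (‖y + ψ i‖ ^ 2)) ≤
      ENNReal.ofReal (‖y‖ ^ 2 + ν) := by
    intro y
    rw [mean_uniformIndex_ofReal fun _ => sq_nonneg _]
    refine ENNReal.ofReal_le_ofReal ?_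
    have h1 := sum_mul_norm_add_sub_sq_le huni (fun i => if i ∈ C then (1 : ℝ) else 0) y
    have h2 : ∑ i : Fin n, (n : ℝ)⁻¹ • (if i ∈ C then (1 : ℝ) else 0) = ν := by
      rw [← Finset.smul_sum, Finset.sum_ite_mem, Finset.univ_inter, Finset.sum_const, nsmul_eq_mul,
        smul_eq_mul, hν]
      ring
    rw [h2] at h1
    refine h1.trans (le_of_eq ?_)
    congr 1
    rw [← h2]
    refine Finset.sum_congr rfl fun i _ => ?_
    by_cases hi : i ∈ C <;> simp [hi]
  have e1 : (repeatRand r (uniformIndex n)).Except δ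
      fun I => ‖(I.map φ).sum‖ ^ 2 ≤ r * (K / n) / δ := by
    have := mean_repeatRand_norm_sq_le (by positivity) hφ r 0
    simp only [zero_add, norm_zero, ne_eq, OfNat.ofNat_ne_zero, not_false_eq_true,
      zero_pow] at this
    exact Rand.except_of_mean_le hδ (by positivity) this
  -- The level is chosen such that the bound equals `(rν/2)²`: at least half of the expected number
  -- of points of `C` is sampled.
  have e2 : (repeatRand r (uniformIndex n)).Except (4 / (r * ν))
      fun I => ‖(I.map ψ).sum‖ ^ 2 ≤ r * ν / (4 / (r * ν)) := by
    have := mean_repeatRand_norm_sq_le hν0.le hψ r 0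
    simp only [zero_add, norm_zero, ne_eq, OfNat.ofNat_ne_zero, not_false_eq_true,
      zero_pow] at this
    exact Rand.except_of_mean_le (by positivity) (by positivity) this
  refine except_drawSample (((e1.and e2).and (length_repeatRand r _)).mono ?_ ?_)
  · rw [add_zero]
    gcongr
  rintro I ⟨⟨hI1, hI2⟩, hlen⟩
  have hcount : ∀ J : List (Fin n), (J.map ψ).sum =
      ((J.filter (· ∈ C)).length : ℝ) - J.length * ν := by
    intro J
    induction J with
    | nil => simp
    | cons i J ih =>
      rw [List.map_cons, List.sum_cons, ih, List.filter_cons]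
      by_cases hi : i ∈ C
      · simp only [ψ, hi, decide_true, if_true, List.length_cons]; push_cast; ring
      · simp only [ψ, hi, decide_false, if_false, List.length_cons, Bool.false_eq_true]
        push_cast; ring
  have hsum : ∀ J : List (Fin n), (J.map φ).sum =
      res D (((J.filter (· ∈ C)).map P).sum - ((J.filter (· ∈ C)).length : ℝ) • o') := by
    intro J
    induction J with
    | nil => simp
    | cons i J ih =>
      rw [List.map_cons, List.sum_cons, ih, List.filter_cons]
      by_cases hi : i ∈ C
      · simp only [φ, hi, decide_true, if_true, List.length_cons, List.map_cons, List.sum_cons]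
        rw [← map_add]
        congr 1
        push_cast
        rw [add_smul, one_smul]; abel
      · simp [φ, hi]
  -- The subset of the sample to be guessed consists of its points in `C`; its mean is one of the
  -- candidate centers.
  set J := I.filter (· ∈ C) with hJ
  set N : ℝ := (J.length : ℝ) with hN
  have hNge : r * ν / 2 ≤ N := by
    rw [hcount I, hlen, Real.norm_eq_abs, sq_abs] at hI2
    by_contra hcon
    push Not at hcon
    have h1 : r * ν / (4 / (r * ν)) = (r * ν / 2) ^ 2 := by field_simp; ring
    rw [h1] at hI2
    have h2 : r * ν / 2 < r * ν - N := by linarith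
    have h3 : 0 < r * ν / 2 := by positivity
    nlinarith
  have hNpos : 0 < N := lt_of_lt_of_le (by positivity) hNge
  have hJne : J.map P ≠ [] := by
    intro h0
    rw [List.map_eq_nil_iff] at h0
    rw [hN, h0] at hNpos
    simp at hNpos
  have hsub : (J.map P).Sublist (I.map P) := List.filter_sublist.map P
  refine ⟨_, mem_subsetMeans hsub hJne, ?_, ?_⟩
  · refine V.smul_mem _ (list_sum_mem ?_)
    intro x hx
    obtain ⟨i, -, rfl⟩ := List.mem_map.1 hx
    exact hPV i
  · rw [List.length_map, ← hN]
    have h1 : res D (N⁻¹ • (J.map P).sum - o') = N⁻¹ • (I.map φ).sum := by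
      rw [hsum I, ← map_smul]
      congr 1
      rw [smul_sub, inv_smul_smul₀ hNpos.ne']
    rw [h1, norm_smul, mul_pow, norm_inv, Real.norm_eq_abs, abs_of_pos hNpos, inv_pow]
    have h2 : (N ^ 2)⁻¹ ≤ ((r * ν / 2) ^ 2)⁻¹ := by gcongr
    calc C.card * ((N ^ 2)⁻¹ * ‖(I.map φ).sum‖ ^ 2)
        ≤ C.card * (((r * ν / 2) ^ 2)⁻¹ * (r * (K / n) / δ)) := by gcongr
      _ = 4 / (r * ν * δ) * K := by
          have : (C.card : ℝ) = ν * n := by rw [hν]; field_simp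
          rw [this]; field_simp; ring
      _ ≤ 4 / (r * μ * δ) * K := by gcongr

/-- The parallel axis identity; the cross terms vanish because deviations from the centroid sum to
zero. -/
lemma sum_norm_res_sub_sq {P : Fin n → Vec d} {C : Finset (Fin n)} (hC : C.Nonempty)
    (D : Submodule ℝ (Vec d)) (o : Vec d) :
    ∑ i ∈ C, ‖res D (P i - o)‖ ^ 2 = ∑ i ∈ C, ‖res D (P i - centroid C P)‖ ^ 2 +
      C.card * ‖res D (o - centroid C P)‖ ^ 2 := by
  have h1 : ∀ i, ‖res D (P i - o)‖ ^ 2 = ‖res D (P i - centroid C P)‖ ^ 2 -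
      2 * inner ℝ (res D (P i - centroid C P)) (res D (o - centroid C P)) +
      ‖res D (o - centroid C P)‖ ^ 2 := by
    intro i
    rw [← norm_sub_sq_real, ← map_sub]
    congr 3; abel
  simp_rw [h1, Finset.sum_add_distrib, Finset.sum_sub_distrib, ← Finset.mul_sum, ← sum_inner,
    ← map_sum, sum_sub_centroid hC]
  simp

/-! ### The whole tree -/

/-- One run of the recursive projection finds a good flat for a given cluster. -/
lemma recursiveProjection_except [NeZero n] {P : Fin n → Vec d} {V D : Submodule ℝ (Vec d)}
    (hPV : ∀ i, P i ∈ V) (hDV : D ≤ V) {j : ℕ} (hjd : j ≤ d) (hDj : Module.finrank ℝ D ≤ j)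
    {C : Finset (Fin n)} (hC : C.Nonempty) {r : ℕ} (hr : 0 < r) {μ δ : ℝ}
    (hμ : 0 < μ) (hCμ : μ * n ≤ C.card) (hδ : 0 < δ)
    {G : List (Vec d)} {b : ℕ → ℝ} {p : ℝ} (hp : 0 < p) (hp1 : p ≤ 1) (hb0 : 0 ≤ b j)
    (hb : (1 + 4 / (r * μ * δ)) * ∑ i ∈ C, ‖res D (P i - centroid C P)‖ ^ 2 ≤ b j ^ 2)
    (step : ∀ o ∈ V, ∀ h < j, ∀ W S : Submodule ℝ (Vec d), W ≤ S → S ≤ V →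
      Module.finrank ℝ S ≤ Module.finrank ℝ W + (h + 1) →
      dev C (fun i => P i - o) S ≤ b (h + 1) →
      ∃ A : Finset (Fin n), p * n ≤ A.card ∧ ∀ i ∈ A, ∃ g ∈ G, ∃ S' : Submodule ℝ (Vec d),
        W ⊔ Submodule.span ℝ {res W (P i - o) + g} ≤ S' ∧ S' ≤ V ∧
        Module.finrank ℝ S' ≤
          Module.finrank ℝ ↥(W ⊔ Submodule.span ℝ {res W (P i - o) + g}) + h ∧
        dev C (fun i => P i - o) S' ≤ b h) :
    (recursiveProjection P j r G).Except (δ + 4 / (r * μ) + j * (1 / (r * p))) fun L =>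
      ∃ F ∈ L, F.1 ∈ V ∧ ∃ U ≤ V, U ≤ sp F.2 ∧ dev C (fun i => P i - F.1) U ≤ b 0 := by
  unfold recursiveProjection
  refine ((exists_center_except (D := D) hPV hC hr hμ hCμ hδ).bind
    (δ₂ := j * (1 / (r * p))) (by positivity) ?_).mono le_rfl fun _ h => h
  rintro Q ⟨o, hoQ, hoV, ho⟩
  refine Rand.Except.det_bind ?_
  have hdev : dev C (fun i => P i - o) D ≤ b j := by
    refine (sq_le_sq₀ (dev_nonneg _ _ _) hb0).1 (le_trans ?_ hb)
    rw [dev_sq, sum_norm_res_sub_sq hC D o]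
    linarith
  have htree := growTree_except (P := P) (o := o) (G := G) (V := V) (C := C) hr hp hp1
    (step o hoV) j le_rfl [] orth_nil ⟨D, by simp, hDV, hDj.trans (Nat.le_add_left _ _), hdev⟩
  refine (Rand.Except.bind (except_forEach_exists hoQ
    (H := fun L => ∃ F ∈ L, F.1 ∈ V ∧ ∃ U ≤ V, U ≤ sp F.2 ∧ dev C (fun i => P i - F.1) U ≤ b 0)
    (htree.bind (δ₂ := 0) le_rfl fun Ws hWs => Rand.except_det ?_)) le_rfl
      fun L hL => Rand.except_det ?_).mono (by simp) fun _ h => h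
  · obtain ⟨W, hW, h1, h2, h3, h4⟩ := hWs
    have h5 := complete_val hjd h1 (by simpa using h2)
    -- The span before completion is recorded as `U`, because the coordinate directions added by
    -- `complete` need not lie in `V`.
    exact ⟨(o, (complete j W).val), by simpa using ⟨W, hW, rfl⟩, hoV, sp W, h3, h5.2.2, h4⟩
  · obtain ⟨L', hL', F, hF, h5⟩ := hL
    exact ⟨F, List.mem_flatten.2 ⟨L', hL', hF⟩, h5⟩

end RecursiveProjection

section Steps

variable {d n : ℕ}

/-! ### Step counts -/

lemma always_drawSample [NeZero n] (r : ℕ) (P : Fin n → Vec d) :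
    (drawSample r P).Always (2 * r) fun Q => Q.length = r := by
  have h := always_forEach (l := List.range r) (f := fun _ => (do
    let i ← uniformIndex n
    pure (P i) : Rand (Vec d))) (c := 1 + 0) (G := fun _ => True) fun _ _ =>
      (always_uniformIndex n).bind fun _ _ => Rand.always_pure trivial
  exact h.mono (by simp; omega) fun L hL => by simpa using hL.1

lemma always_adaptiveRound (P : Fin n → Vec d) (s b : ℕ) {W : List (Vec d)}
    (hW : W.length + s ≤ b) (hO : Orth W) :
    (adaptiveRound P s W).Always (n * (b * (10 * d + 2) + 3 * d + 1) + (s * (2 * n + 1 + 1) +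
      s * (b * (10 * d + 2) + 3 * d + 1 + 1))) fun W' => W'.length ≤ W.length + s ∧ Orth W' := by
  unfold adaptiveRound
  refine Rand.Always.bind (G := fun _ => True) (Rand.always_det ⟨trivial, ?_⟩) fun w _ => ?_
  · refine table_steps_le fun i => (sqDist_steps W _).trans ?_
    gcongr; omega
  have h := always_forEach (l := List.range s) (f := fun _ => weightedIndex w)
    (fun _ _ => always_weightedIndex w)
  refine Rand.Always.bind (h.mono (by simp) fun _ h => h) fun I hI => Rand.always_det ?_
  have hIs : I.length = s := by simpa using hI.1
  have h2 := always_foldSteps (c := b * (10 * d + 2) + 3 * d + 1)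
    (f := fun (W : List (Vec d)) (o : Option (Fin n)) => match o with
      | none => pure W
      | some i => extend W (P i))
    (fun m W' => W'.length ≤ W.length + m ∧ Orth W') I s ?_ 0 W (by omega) ⟨by simp, hO⟩
  · rw [hIs, zero_add] at h2; exact h2
  · rintro m hm W' ⟨hW', hO'⟩ a -
    cases a with
    | none => exact ⟨⟨by simpa using by omega, hO'⟩, by simp⟩
    | some i =>
      refine ⟨⟨(extend_length W' (P i)).1.trans (by omega), (extend_val hO' _).1⟩,
        (extend_steps W' (P i)).trans ?_⟩
      gcongr; omega

lemma always_adaptiveRounds (P : Fin n → Vec d) (s b : ℕ) : ∀ (t : ℕ) {W : List (Vec d)},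
    W.length + t * s ≤ b → Orth W →
    (adaptiveRounds P s t W).Always (t * (n * (b * (10 * d + 2) + 3 * d + 1) +
      (s * (2 * n + 1 + 1) + s * (b * (10 * d + 2) + 3 * d + 1 + 1))))
      fun W' => W'.length ≤ W.length + t * s ∧ Orth W'
  | 0, W, _, hO => (Rand.always_pure ⟨by simp, hO⟩).mono (by simp) fun _ h => h
  | t + 1, W, hW, hO => by
    rw [add_mul] at hW
    rw [adaptiveRounds]
    refine Rand.Always.mono ((always_adaptiveRound P s b (by omega) hO).bind fun W' hW' =>
      (always_adaptiveRounds P s b t (by omega) hW'.2).mono le_rfl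
        (G' := fun W' => W'.length ≤ W.length + (t + 1) * s ∧ Orth W') ?_) ?_ fun _ h => h
    · rintro L ⟨hL, h⟩
      exact ⟨by rw [add_mul]; omega, h⟩
    · rw [add_mul t 1]; omega

lemma always_dimensionReduction (P : Fin n → Vec d) (t s : ℕ) :
    (dimensionReduction P t s).Always (t * (n * (t * s * (10 * d + 2) + 3 * d + 1) +
      (s * (2 * n + 1 + 1) + s * (t * s * (10 * d + 2) + 3 * d + 1 + 1))) + t * s * (5 * d + 3))
      fun B => B.length ≤ t * s ∧ Orth B ∧ ∀ b ∈ B, ‖b‖ = 1 := by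
  unfold dimensionReduction
  refine (always_adaptiveRounds P s (t * s) t (by simp) orth_nil).bind fun W hW =>
    Rand.always_det ⟨?_, ?_⟩
  · rw [normalizeAll_val]
    have := hW.2.normalize
    exact ⟨by simpa using hW.1, this.1, this.2.2⟩
  · refine (normalizeAll_steps W).trans ?_
    gcongr
    simpa using hW.1

lemma always_symmetricSampling {Q : List (Vec d)} {r : ℕ} (hQ : Q.length = r) (o : Vec d) :
    (symmetricSampling Q o).Always (r * (4 * d + 1) +
      2 ^ (2 * r) * (2 * r * (2 * d + 1) + 3 * d + 2)) fun S => S.length ≤ 2 ^ (2 * r) := by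
  unfold symmetricSampling
  refine Timed.Always.bind (G := fun L => L.length = r) ⟨by simp [hQ], ?_⟩ fun L hL => ?_
  · refine (mapSteps_steps_le (c := 4 * d) fun s _ => ?_).trans (by rw [hQ])
    simp; omega
  · have hl : (Q ++ L).length = 2 * r := by simp [hQ, hL]; omega
    have h1 := subsetMeans_length_le (Q ++ L)
    have h2 := subsetMeans_steps (Q ++ L)
    rw [hl] at h1 h2
    exact ⟨h1, h2⟩

lemma length_flatten_le {α : Type} {L : List (List α)} {N : ℕ} (h : ∀ l ∈ L, l.length ≤ N) :
    L.flatten.length ≤ L.length * N := by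
  induction L with
  | nil => simp
  | cons a L ih =>
    have h1 := ih fun l hl => h l (by simp [hl])
    have h2 := h a (by simp)
    simp only [List.flatten_cons, List.length_append, List.length_cons, add_mul]
    omega

lemma always_concat {α : Type} {L : List (List α)} {m N : ℕ} {G : α → Prop} (hm : L.length ≤ m)
    (h : ∀ l ∈ L, l.length ≤ N ∧ ∀ a ∈ l, G a) :
    (concat L).Always (m * N + m) fun l => l.length ≤ m * N ∧ ∀ a ∈ l, G a := by
  have h1 : L.flatten.length ≤ m * N :=
    (length_flatten_le fun l hl => (h l hl).1).trans (Nat.mul_le_mul_right _ hm)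
  refine ⟨⟨h1, fun a ha => ?_⟩, by rw [concat_steps]; omega⟩
  obtain ⟨l, hl, hal⟩ := List.mem_flatten.1 ha
  exact (h l hl).2 a hal

/-- A node has at most `2^(2r) g` children, so there are at most `(2^(2r) g)^h` leaves; the work per
level is bounded by this number times `nd` and a linear term in `j` and `r`. -/
lemma always_growTree [NeZero n] (hd : 1 ≤ d) (P : Fin n → Vec d) (o : Vec d) (r : ℕ)
    {G : List (Vec d)} {g : ℕ} (hG : G.length ≤ g) (hg : 1 ≤ g) (j : ℕ) :
    ∀ (h : ℕ) {W : List (Vec d)}, W.length + h ≤ j → Orth W →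
    (growTree P o r G h W).Always
      ((2 ^ (2 * r) * g) ^ h * (h * (n * d * (24 * j + 17 * r + 40))))
      fun L => L.length ≤ (2 ^ (2 * r) * g) ^ h ∧ ∀ W' ∈ L, W'.length ≤ j ∧ Orth W'
  | 0, W, hW, hO => by
    rw [growTree]
    exact (Rand.always_pure ⟨by simp, by simpa using ⟨by omega, hO⟩⟩).mono (by simp) fun _ h => h
  | h + 1, W, hW, hO => by
    have hn : 1 ≤ n := NeZero.one_le
    obtain ⟨N, hN⟩ : ∃ N, N = 2 ^ (2 * r) * g := ⟨_, rfl⟩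
    have hN1 : 1 ≤ N := by rw [hN]; exact Nat.one_le_iff_ne_zero.2 (by positivity)
    have hWj : W.length ≤ j := by omega
    rw [growTree, ← hN]
    refine Rand.Always.mono (Rand.Always.bind (G := fun _ => True)
      (c₁ := n * (12 * j * d + 4 * d + 1)) (Rand.always_det ⟨trivial, ?_⟩) fun P' _ =>
      Rand.Always.bind (always_drawSample r P') fun Q hQ =>
      Rand.Always.bind (Rand.always_det (always_symmetricSampling hQ o)) fun S hS =>
      Rand.Always.bind (c₁ := 2 ^ (2 * r) * (g * (2 * d + 1) + 1))
        (G := fun C => C.length ≤ 2 ^ (2 * r) ∧ ∀ l ∈ C, l.length ≤ g ∧ ∀ a ∈ l, True)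
        (Rand.always_det ⟨?_, ?_⟩) fun C hC =>
      Rand.Always.bind (Rand.always_det (always_concat hC.1 hC.2)) fun C' hC' =>
      Rand.Always.bind
        (c₁ := N * (2 * d + (j * (12 * d) + 3 * d + 1 +
          N ^ h * (h * (n * d * (24 * j + 17 * r + 40)))) + 1))
        (G := fun L => L.length ≤ N ∧
          ∀ l ∈ L, l.length ≤ N ^ h ∧ ∀ W' ∈ l, W'.length ≤ j ∧ Orth W') ?_ fun L hL =>
      Rand.always_det (always_concat hL.1 hL.2)) ?_ ?_
    · refine table_steps_le fun i => ?_
      have h1 := orthPart_steps W ((P i) - o)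
      have h2 : W.length * (10 * d + 2) ≤ j * (12 * d) :=
        Nat.mul_le_mul hWj (by omega)
      simp only [Timed.steps_bind, vsub_steps, vadd_steps, vsub_val]
      have h3 : j * (12 * d) = 12 * j * d := by ring
      omega
    · simp only [mapSteps_val, List.length_map, List.mem_map, implies_true, and_true]
      refine ⟨hS, ?_⟩
      rintro l ⟨x, -, rfl⟩
      simpa using hG
    · refine (mapSteps_steps_le (c := g * (2 * d + 1)) fun x _ => ?_).trans
        (Nat.mul_le_mul_right _ hS)
      refine (mapSteps_steps_le (c := 2 * d) fun x _ => by simp).trans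
        (Nat.mul_le_mul_right _ hG)
    · rw [← hN] at hC'
      refine Rand.Always.mono (always_forEach (l := C') fun x _ => ?_)
        (Nat.mul_le_mul_right _ hC'.1) fun L hL => ⟨hL.1.trans_le hC'.1, hL.2⟩
      refine Rand.Always.bind (G := fun _ => True) (Rand.always_det ⟨trivial, by simp⟩)
        fun y _ => ?_
      refine Rand.Always.bind (G := fun W' => W'.length ≤ W.length + 1 ∧ Orth W')
        (Rand.always_det ⟨⟨(extend_length W y).1, (extend_val hO y).1⟩, ?_⟩) fun W' hW' => ?_
      · have h2 : W.length * (10 * d + 2) ≤ j * (12 * d) :=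
          Nat.mul_le_mul hWj (by omega)
        have := extend_steps W y
        omega
      · have := always_growTree hd P o r hG hg j h (W := W') (by omega) hW'.2
        rw [← hN] at this
        exact this
    · have h2 : 2 ^ (2 * r) ≤ N := by rw [hN]; exact Nat.le_mul_of_pos_right _ hg
      have h3 : 2 ^ (2 * r) * (g * (2 * d + 1) + 1) ≤ N * (2 * d + 2) := by
        rw [hN, mul_assoc]; gcongr; nlinarith
      have h4 : 2 ^ (2 * r) * (2 * r * (2 * d + 1) + 3 * d + 2) ≤
        N * (2 * r * (2 * d + 1) + 3 * d + 2) := Nat.mul_le_mul_right _ h2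
      have h5 : 1 ≤ N ^ h := Nat.one_le_pow _ _ hN1
      rw [← hN]
      have h6 : n * (12 * j * d + 4 * d + 1) + (2 * r + (r * (4 * d + 1) +
          N * (2 * r * (2 * d + 1) + 3 * d + 2) + (N * (2 * d + 2) + (N + N +
          (N * (2 * d + (j * (12 * d) + 3 * d + 1) + 1) + N))))) ≤
          N * (n * d * (24 * j + 17 * r + 39)) := by
        -- After writing the variables as one plus a natural number, the difference of the two sides
        -- is a polynomial with nonnegative coefficients. The same device settles the later
        -- comparisons of step counts.
        obtain ⟨n, rfl⟩ := Nat.exists_eq_add_of_le hn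
        obtain ⟨d, rfl⟩ := Nat.exists_eq_add_of_le hd
        obtain ⟨N, rfl⟩ := Nat.exists_eq_add_of_le hN1
        zify
        rw [← sub_nonneg]
        ring_nf
        positivity
      have h7 : N * (n * d * (24 * j + 17 * r + 39)) + N ^ (h + 1) ≤
          N ^ (h + 1) * (n * d * (24 * j + 17 * r + 40)) := by
        have e1 : 1 ≤ n * d := Nat.mul_pos hn hd
        have : N * (n * d * (24 * j + 17 * r + 39)) ≤ N ^ (h + 1) * (n * d * (24 * j + 17 * r + 39)) := by
          gcongr; rw [pow_succ]; exact Nat.le_mul_of_pos_left _ h5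
        nlinarith [Nat.mul_le_mul_left (N ^ (h + 1)) e1]
      have h8 : N ^ (h + 1) * ((h + 1) * (n * d * (24 * j + 17 * r + 40))) =
          N * (N ^ h * (h * (n * d * (24 * j + 17 * r + 40)))) +
          N ^ (h + 1) * (n * d * (24 * j + 17 * r + 40)) := by ring
      have h9 : N * (2 * d + (j * (12 * d) + 3 * d + 1 +
          N ^ h * (h * (n * d * (24 * j + 17 * r + 40)))) + 1) =
          N * (2 * d + (j * (12 * d) + 3 * d + 1) + 1) +
          N * (N ^ h * (h * (n * d * (24 * j + 17 * r + 40)))) := by ring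
      have h10 : N * N ^ h = N ^ (h + 1) := by ring
      rw [h8, h9, h10]
      omega
    · intro L hL
      exact ⟨by rw [pow_succ']; exact hL.1, hL.2⟩

lemma always_recursiveProjection [NeZero n] {j : ℕ} (hd : 1 ≤ d) (hjd : j ≤ d) (P : Fin n → Vec d)
    (r : ℕ) {G : List (Vec d)} {g : ℕ} (hG : G.length ≤ g) (hg : 1 ≤ g) :
    (recursiveProjection P j r G).Always (2 ^ r * (2 ^ (2 * r) * g) ^ j *
      (n * d * (j * (24 * j + 17 * r + 40) + 12 * j * j + 7 * j + 5 * r + 20)))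
      fun L => L.length ≤ 2 ^ r * (2 ^ (2 * r) * g) ^ j ∧ ∀ F ∈ L, F.2.length = j ∧ Orth F.2 := by
  have hn : 1 ≤ n := NeZero.one_le
  obtain ⟨N, hN⟩ : ∃ N, N = (2 ^ (2 * r) * g) ^ j := ⟨_, rfl⟩
  have hN1 : 1 ≤ N := by rw [hN]; exact Nat.one_le_iff_ne_zero.2 (by positivity)
  unfold recursiveProjection
  rw [← hN]
  refine Rand.Always.mono (Rand.Always.bind (always_drawSample r P) fun Q hQ =>
    Rand.Always.bind (c₁ := 2 ^ r * (r * (2 * d + 1) + 3 * d + 2)) (G := fun O => O.length ≤ 2 ^ r)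
      (Rand.always_det ⟨?_, ?_⟩) fun O hO =>
    Rand.Always.bind
      (c₁ := 2 ^ r * (N * (j * (n * d * (24 * j + 17 * r + 40))) +
        N * (j * (j * (10 * d + 2) + 4 * d + 3) + 1) + 1))
      (G := fun L => L.length ≤ 2 ^ r ∧ ∀ l ∈ L, l.length ≤ N ∧
        ∀ F ∈ l, F.2.length = j ∧ Orth F.2) ?_ fun L hL =>
    Rand.always_det (always_concat hL.1 hL.2)) ?_ fun _ h => h
  · simpa [hQ] using subsetMeans_length_le Q
  · simpa [hQ] using subsetMeans_steps Q
  · refine Rand.Always.mono (always_forEach (l := O) fun o _ => ?_)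
      (Nat.mul_le_mul_right _ hO) fun L hL => ⟨hL.1.trans_le hO, hL.2⟩
    have h1 := always_growTree hd P o r hG hg j j (W := []) (by simp) orth_nil
    rw [← hN] at h1
    refine h1.bind fun Ws hWs => Rand.always_det ⟨?_, ?_⟩
    · simp only [mapSteps_val, List.length_map, List.mem_map]
      refine ⟨hWs.1, ?_⟩
      rintro F ⟨W, hW, rfl⟩
      have := complete_val hjd (hWs.2 W hW).2 (hWs.2 W hW).1
      exact ⟨this.2.1, this.1⟩
    · refine (mapSteps_steps_le fun W hW => ?_).trans (Nat.mul_le_mul_right _ hWs.1)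
      simpa using complete_steps (hWs.2 W hW).1
  · generalize hR : 2 ^ r = R
    have hR1 : 1 ≤ R := by rw [← hR]; exact Nat.one_le_two_pow
    clear hN
    obtain ⟨n, rfl⟩ := Nat.exists_eq_add_of_le hn
    obtain ⟨d, rfl⟩ := Nat.exists_eq_add_of_le hd
    obtain ⟨N, rfl⟩ := Nat.exists_eq_add_of_le hN1
    obtain ⟨R, rfl⟩ := Nat.exists_eq_add_of_le hR1
    zify
    rw [← sub_nonneg]
    ring_nf
    positivity

lemma always_repeatRand {α : Type} {f : Rand α} {c : ℕ} {G : α → Prop} (m : ℕ)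
    (h : f.Always c G) :
    (repeatRand m f).Always (m * (c + 1)) fun L => L.length = m ∧ ∀ b ∈ L, G b := by
  have := always_forEach (l := List.range m) (f := fun _ => f) fun _ _ => h
  rw [List.length_range] at this
  exact this

/-- The number of steps of the whole algorithm. -/
lemma always_projectiveClustering [NeZero n] {j k : ℕ} (hk : 1 ≤ k) (hj : 1 ≤ j) (hjd : j ≤ d)
    (P : Fin n → Vec d) (prm : Params) {y m : ℕ} (hky : k ≤ y) (hjy : j ≤ y)
    (ht : prm.rounds ≤ y) (hs : prm.batch ≤ y) (hts : prm.rounds * prm.batch ≤ y)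
    (hr : prm.sampleSize ≤ y) (hM : 2 * prm.cells + 1 ≤ 2 ^ m) :
    (projectiveClustering prm k j P).Always
      (n * d * 2 ^ (9 + 3 * y + y * (y + y * (2 * y + m * y)))) fun _ => True := by
  have hn : 1 ≤ n := NeZero.one_le
  have hd : 1 ≤ d := hj.trans hjd
  have hy : 1 ≤ y := hk.trans hky
  obtain ⟨t, s, r, ρ, M⟩ := prm
  simp only at ht hs hts hr hM
  obtain ⟨g, hg⟩ : ∃ g, g = (2 * M + 1) ^ (t * s) := ⟨_, rfl⟩
  obtain ⟨N, hN⟩ : ∃ N, N = 2 ^ r * (2 ^ (2 * r) * g) ^ j := ⟨_, rfl⟩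
  have hg1 : 1 ≤ g := by rw [hg]; exact Nat.one_le_pow _ _ (by omega)
  have hgN : g ≤ N := by
    rw [hN]
    calc g ≤ 2 ^ (2 * r) * g := Nat.le_mul_of_pos_left _ (by positivity)
      _ ≤ (2 ^ (2 * r) * g) ^ j := Nat.le_self_pow (by omega) _
      _ ≤ _ := Nat.le_mul_of_pos_left _ (by positivity)
  have hN1 : 1 ≤ N := hg1.trans hgN
  have hNk : N ≤ N ^ k := Nat.le_self_pow (by omega) _
  have hN0 : 2 ^ r * (2 ^ (2 * r) * 1) ^ j ≤ N := by rw [hN]; gcongr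
  have hrec : ∀ (P' : Fin n → Vec d) (G : List (Vec d)), G.length ≤ g →
      (repeatRand k (recursiveProjection P' j r G)).Always (N ^ k * (126 * (n * d * y ^ 3)))
        fun T => T.length = k ∧ ∀ L ∈ T, L.length ≤ N ∧ ∀ F ∈ L, F.2.length ≤ j := by
    intro P' G hG
    have h1 := always_repeatRand k (always_recursiveProjection (j := j) hd hjd P' r hG hg1)
    rw [← hN] at h1
    refine h1.mono ?_ fun T hT => ⟨hT.1, fun L hL => ⟨(hT.2 L hL).1, fun F hF =>
      ((hT.2 L hL).2 F hF).1.le⟩⟩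
    calc _ ≤ y * (N ^ k * (n * d * (y * (24 * y + 17 * y + 40) + 12 * y * y + 7 * y + 5 * y + 20))
          + 1) := by gcongr
      _ ≤ _ := by
        generalize hU : N ^ k = U
        have hU1 : 1 ≤ U := by rw [← hU]; omega
        obtain ⟨n, rfl⟩ := Nat.exists_eq_add_of_le hn
        obtain ⟨d, rfl⟩ := Nat.exists_eq_add_of_le hd
        obtain ⟨U, rfl⟩ := Nat.exists_eq_add_of_le hU1
        obtain ⟨y, rfl⟩ := Nat.exists_eq_add_of_le hy
        zify
        rw [← sub_nonneg]
        ring_nf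
        positivity
  have hbest : ∀ T : List (List (FlatRep d)), (T.length = k ∧ ∀ L ∈ T, L.length ≤ N ∧
      ∀ F ∈ L, F.2.length ≤ j) →
      (bestCombination P T).Always (N ^ k * (26 * (n * d * y ^ 3))) fun _ => True := by
    rintro T ⟨hT, hT'⟩
    refine ⟨trivial, (bestCombination_steps P hT').trans ?_⟩
    rw [hT]
    gcongr
    calc _ ≤ y + (n * (y * (y * (10 * d + 2) + 5 * d + 2) + 2) + 1) + 1 + 1 := by gcongr
      _ ≤ _ := by
        obtain ⟨n, rfl⟩ := Nat.exists_eq_add_of_le hn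
        obtain ⟨d, rfl⟩ := Nat.exists_eq_add_of_le hd
        obtain ⟨y, rfl⟩ := Nat.exists_eq_add_of_le hy
        zify
        rw [← sub_nonneg]
        ring_nf
        positivity
  unfold projectiveClustering
  refine Rand.Always.mono (Rand.Always.bind (c₁ := 45 * (n * d * y ^ 3))
    ((always_dimensionReduction P t s).mono ?_ fun _ h => h) fun B hB =>
    Rand.Always.bind (G := fun _ => True) (c₁ := 15 * (n * d * y ^ 3))
      (Rand.always_det ⟨trivial, ?_⟩) fun P' _ =>
    Rand.Always.bind (G := fun _ => True) (c₁ := d) (Rand.always_det ⟨trivial, by simp⟩) fun z _ =>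
    Rand.Always.bind (hrec P' [z] hg1) fun T hT =>
    Rand.Always.bind (Rand.always_det (hbest T hT)) fun best _ =>
    Rand.Always.bind (G := fun _ => True) (c₁ := 1) (Rand.always_det ⟨trivial, by simp⟩) fun q _ =>
    Rand.Always.bind (G := fun _ => True) (c₁ := 1) (Rand.always_det ⟨trivial, by simp⟩) fun R _ =>
    Rand.Always.bind (G := fun _ => True) (c₁ := 1) (Rand.always_det ⟨trivial, by simp⟩) fun a _ =>
    Rand.Always.bind (G := fun G => G.length ≤ g) (c₁ := N ^ k * (32 * (n * d * y ^ 3)))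
      (Rand.always_det ⟨?_, ?_⟩) fun G hG =>
    Rand.Always.bind (hrec P' G hG) fun T' hT' =>
    Rand.Always.bind (Rand.always_det (hbest T' hT')) fun best' _ =>
    Rand.always_pure trivial) ?_ fun _ h => h
  · calc _ ≤ y * (n * (y * (10 * d + 2) + 3 * d + 1) +
        (y * (2 * n + 1 + 1) + y * (y * (10 * d + 2) + 3 * d + 1 + 1))) + y * (5 * d + 3) := by
          gcongr
      _ ≤ _ := by
        obtain ⟨n, rfl⟩ := Nat.exists_eq_add_of_le hn
        obtain ⟨d, rfl⟩ := Nat.exists_eq_add_of_le hd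
        obtain ⟨y, rfl⟩ := Nat.exists_eq_add_of_le hy
        zify
        rw [← sub_nonneg]
        ring_nf
        positivity
  · calc _ ≤ n * (y * (10 * d + 2) + 2 * d + 1) := by
          refine table_steps_le fun i => (project_steps B _).trans ?_
          have := hB.1.trans hts
          gcongr
      _ ≤ _ := by
        obtain ⟨n, rfl⟩ := Nat.exists_eq_add_of_le hn
        obtain ⟨d, rfl⟩ := Nat.exists_eq_add_of_le hd
        obtain ⟨y, rfl⟩ := Nat.exists_eq_add_of_le hy
        zify
        rw [← sub_nonneg]
        ring_nf
        positivity
  · change (grid M a B).val.length ≤ g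
    rw [grid_length, hg]
    exact Nat.pow_le_pow_right (by omega) hB.1
  · have h1 : (2 * M + 1) ^ B.length ≤ N ^ k :=
      le_trans (by rw [hg]; exact Nat.pow_le_pow_right (by omega) hB.1) (hgN.trans hNk)
    have h2 : B.length ≤ y := hB.1.trans hts
    calc _ ≤ (y + 1) * (N ^ k * (8 * d + 8)) := (grid_steps _ _ _).trans (by gcongr)
      _ = N ^ k * ((y + 1) * (8 * d + 8)) := by ring
      _ ≤ _ := by
        refine Nat.mul_le_mul_left _ ?_
        obtain ⟨n, rfl⟩ := Nat.exists_eq_add_of_le hn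
        obtain ⟨d, rfl⟩ := Nat.exists_eq_add_of_le hd
        obtain ⟨y, rfl⟩ := Nat.exists_eq_add_of_le hy
        zify
        rw [← sub_nonneg]
        ring_nf
        positivity
  -- `N` bounds the flats of one run, so `N^k` bounds the combinations. The constants of all stages
  -- add up to at most `400 < 512 = 2^9`, and `y ≤ 2^y`.
  · have h1 : N ^ k * (512 * y ^ 3) ≤ 2 ^ (9 + 3 * y + y * (y + y * (2 * y + m * y))) := by
      have e1 : N ≤ 2 ^ (y + y * (2 * y + m * y)) := by
        have e2 : g ≤ 2 ^ (m * y) := by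
          rw [hg, pow_mul 2]
          exact (Nat.pow_le_pow_left hM _).trans (Nat.pow_le_pow_right (by positivity) hts)
        rw [hN, pow_add, mul_comm y (2 * y + m * y), pow_mul _ (2 * y + m * y), pow_add]
        have e3 : 1 ≤ 2 ^ (2 * y) * 2 ^ (m * y) := Nat.one_le_iff_ne_zero.2 (by positivity)
        calc _ ≤ 2 ^ y * (2 ^ (2 * y) * 2 ^ (m * y)) ^ j := by gcongr <;> norm_num
          _ ≤ _ := by gcongr
      have e2 : N ^ k ≤ 2 ^ (y * (y + y * (2 * y + m * y))) := by
        rw [mul_comm y, pow_mul]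
        exact (Nat.pow_le_pow_left e1 k).trans
          (Nat.pow_le_pow_right (by positivity) hky)
      have e3 : 512 * y ^ 3 ≤ 2 ^ (9 + 3 * y) := by
        rw [pow_add, mul_comm 3 y, pow_mul]
        exact Nat.mul_le_mul (by norm_num) (Nat.pow_le_pow_left Nat.lt_two_pow_self.le _)
      rw [pow_add, mul_comm (2 ^ (9 + 3 * y))]
      exact Nat.mul_le_mul e2 e3
    refine le_trans ?_ (Nat.mul_le_mul_left (n * d) h1)
    generalize hU : N ^ k = U
    have hU1 : 1 ≤ U := by rw [← hU]; omega
    clear hU h1 hN hrec hbest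
    obtain ⟨n, rfl⟩ := Nat.exists_eq_add_of_le hn
    obtain ⟨d, rfl⟩ := Nat.exists_eq_add_of_le hd
    obtain ⟨U, rfl⟩ := Nat.exists_eq_add_of_le hU1
    obtain ⟨y, rfl⟩ := Nat.exists_eq_add_of_le hy
    zify
    rw [← sub_nonneg]
    ring_nf
    positivity

end Steps

section Clusters

variable {d n k : ℕ}

/-! ### Sums over clusters -/

lemma mem_sp_of_mem_grid (M : ℕ) (a : ℝ) (B : List (Vec d)) {g : Vec d}
    (hg : g ∈ (grid M a B).val) : g ∈ sp B := by
  induction B generalizing g with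
  | nil =>
    have : g = 0 := by simpa [grid] using hg
    rw [this]; exact zero_mem _
  | cons b B ih =>
    simp only [grid, Timed.val_bind, concat_val, mapSteps_val, List.mem_flatten, List.mem_map] at hg
    obtain ⟨L, ⟨t, -, rfl⟩, hg⟩ := hg
    obtain ⟨g', hg', rfl⟩ := List.mem_map.1 hg
    simp only [vadd_val, vsmul_val]
    rw [sp_cons]
    exact Submodule.add_mem _ (Submodule.mem_sup_right (ih hg'))
      (Submodule.smul_mem _ _ (Submodule.mem_sup_left (Submodule.mem_span_singleton_self b)))

/-- Moving a flat parallel to itself through the centroid of its cluster does not increase the cost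
of the cluster, and assignment to nearest flats makes the minimum in the objective the distance to
the assigned flat. -/
lemma flatCost_centroid_le {P : Fin n → Vec d} [NeZero n] {F : Fin k → AffineSubspace ℝ (Vec d)}
    {cl : Fin n → Fin k} (hF : ∀ l, (F l : Set (Vec d)).Nonempty) (hcl : IsNearest P F cl)
    (hne : ∀ l, (cluster cl l).Nonempty) :
    flatCost P cl (fun l => centroid (cluster cl l) P) (fun l => (F l).direction) ≤
      n * objective P F := by
  have hn : (n : ℝ) ≠ 0 := Nat.cast_ne_zero.2 (NeZero.ne n)
  choose o ho using hF
  have hF' : ∀ l, F l = AffineSubspace.mk' (o l) (F l).direction := fun l =>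
    (AffineSubspace.mk'_eq (ho l)).symm
  rw [objective, mul_div_cancel₀ _ hn, flatCost, ← sum_cluster cl fun l i =>
    ‖res (F l).direction (P i - centroid (cluster cl l) P)‖ ^ 2]
  calc _ ≤ ∑ l, ∑ i ∈ cluster cl l, ‖res (F l).direction (P i - o l)‖ ^ 2 := by
        refine Finset.sum_le_sum fun l _ => ?_
        rw [sum_norm_res_sub_sq (hne l) _ (o l)]
        have : 0 ≤ ((cluster cl l).card : ℝ) *
          ‖res (F l).direction (o l - centroid (cluster cl l) P)‖ ^ 2 :=
          mul_nonneg (Nat.cast_nonneg _) (sq_nonneg _)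
        linarith
    _ = ∑ i, ‖res (F (cl i)).direction (P i - o (cl i))‖ ^ 2 :=
        sum_cluster cl fun l i => ‖res (F l).direction (P i - o l)‖ ^ 2
    _ ≤ _ := by
        refine Finset.sum_le_sum fun i _ => ?_
        have : Nonempty (Fin k) := ⟨cl i⟩
        refine le_ciInf fun l => ?_
        have h1 := hcl i l
        have h2 : Metric.infDist (P i) (F (cl i) : Set (Vec d)) =
            ‖res (F (cl i)).direction (P i - o (cl i))‖ := by
          conv_lhs => rw [hF' (cl i)]
          exact infDist_mk' _ _ _
        rw [← h2]
        exact pow_le_pow_left₀ Metric.infDist_nonneg h1 2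

lemma objective_le_sum (P : Fin n → Vec d) [NeZero n] (cl : Fin n → Fin k)
    (F : Fin k → FlatRep d) :
    n * objective P (fun l => (F l).toFlat) ≤ ∑ l, ∑ i ∈ cluster cl l, fsd (P i) (F l) := by
  have hn : (n : ℝ) ≠ 0 := Nat.cast_ne_zero.2 (NeZero.ne n)
  rw [objective, mul_div_cancel₀ _ hn, sum_cluster cl fun l i => fsd (P i) (F l)]
  refine Finset.sum_le_sum fun i _ => ?_
  refine (ciInf_le (Set.finite_range _).bddBelow (cl i)).trans (infDist_toFlat_sq _ _).le

/-- The best combination is at least as good as any combination, cluster by cluster. -/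
lemma bestCombination_spec [NeZero n] (P : Fin n → Vec d) (hk : 0 < k) (cl : Fin n → Fin k)
    {T : List (List (FlatRep d))} {j : ℕ} (hlen : T.length = k)
    (hT : ∀ L ∈ T, ∀ F ∈ L, F.2.length = j ∧ Orth F.2) {F : Fin k → FlatRep d}
    (hF : List.Forall₂ (· ∈ ·) (List.ofFn F) T) :
    ∃ Gs : Fin k → FlatRep d, (bestCombination P T).val =
        some (objective P fun l => (Gs l).toFlat, List.ofFn Gs) ∧
      (∀ l, IsFlat j (Gs l).toFlat) ∧
      n * objective P (fun l => (Gs l).toFlat) ≤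
        ∑ l, ∑ i ∈ cluster cl l, fsd (P i) (F l) := by
  have hmem : ∀ Hs : List (FlatRep d), List.Forall₂ (· ∈ ·) Hs T →
      ∀ H ∈ Hs, H.2.length = j ∧ Orth H.2 := by
    intro Hs hHs H hH
    obtain ⟨i, hi, rfl⟩ := List.mem_iff_getElem.1 hH
    have h1 := (List.forall₂_iff_get.1 hHs).2 i hi (by rw [← hHs.length_eq]; exact hi)
    exact hT _ (List.get_mem _ _) _ h1
  obtain ⟨Gs, h1, h2, h3⟩ := bestCombination_val P hF
  have hGk : Gs.length = k := h2.length_eq.trans hlen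
  subst hGk
  have e1 := evalObjective_val P hk rfl fun F hF => (hmem Gs h2 F hF).2
  have e2 := evalObjective_val P hk (List.length_ofFn (f := F))
    fun G hG => (hmem _ hF G hG).2
  refine ⟨fun l => Gs[l], ?_, fun l => ?_, ?_⟩
  · rw [h1, e1]
    simp
  · have := hmem Gs h2 Gs[l] (List.getElem_mem _)
    have h4 := isFlat_toFlat this.2
    rw [this.1] at h4
    exact h4
  · rw [e1, e2] at h3
    refine le_trans ?_ (objective_le_sum P cl F)
    refine mul_le_mul_of_nonneg_left (h3.trans (le_of_eq ?_)) (Nat.cast_nonneg _)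
    simp

/-- Run number `l` is required to succeed for cluster `l` only, so a union bound over the `k` runs
suffices. -/
lemma except_repeatRand_ofFn {γ : Type} {f : Rand (List γ)} {δ : ℝ} (hδ : 0 ≤ δ)
    {Q : Fin k → γ → Prop} (h : ∀ l, f.Except δ fun L => ∃ F ∈ L, Q l F) :
    (repeatRand k f).Except (k * δ) fun T => ∃ F : Fin k → γ,
      List.Forall₂ (· ∈ ·) (List.ofFn F) T ∧ ∀ l, Q l (F l) := by
  have h1 := except_forEach_forall₂ (f := fun _ => f) (l := List.range k) hδ
    (H := fun a L => ∀ ha : a < k, ∃ F ∈ L, Q ⟨a, ha⟩ F) (fun a ha => by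
      have hak := List.mem_range.1 ha
      exact (h ⟨a, hak⟩).mono le_rfl fun L hL _ => hL)
  rw [List.length_range] at h1
  refine Rand.Except.mono (m := repeatRand k f) h1 le_rfl fun T hT => ?_
  have hlen : T.length = k := by simpa using hT.length_eq.symm
  have h2 : ∀ l : Fin k, ∃ F ∈ T[l.1], Q l F := by
    intro l
    have := (List.forall₂_iff_get.1 hT).2 l (by simp) (by rw [hlen]; exact l.2)
    simpa using this
  choose F hF hQ using h2
  refine ⟨F, List.forall₂_iff_get.2 ⟨by simp [hlen], fun i h₁ h₂ => ?_⟩, hQ⟩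
  simpa using hF ⟨i, by simpa using h₁⟩

/-- Pythagoras: the part of a point orthogonal to `V` is lost once and for all, and the rest is the
distance of its projection within `V`. Enlarging `U` to the stored directions only helps. -/
lemma sum_fsd_le {P : Fin n → Vec d} {V U : Submodule ℝ (Vec d)} {C : Finset (Fin n)}
    {F : FlatRep d} (hFV : F.1 ∈ V) (hUV : U ≤ V) (hU : U ≤ sp F.2) :
    ∑ i ∈ C, fsd (P i) F ≤ ∑ i ∈ C, ‖res V (P i)‖ ^ 2 +
      dev C (fun i => V.starProjection (P i) - F.1) U ^ 2 := by
  rw [dev_sq, ← Finset.sum_add_distrib]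
  refine Finset.sum_le_sum fun i _ => ?_
  rw [← norm_res_sub_sq hUV (P i) hFV, fsd]
  exact pow_le_pow_left₀ (norm_nonneg _) (norm_res_mono hU _) 2

/-- The flats that are captured may be taken through the means of the projected clusters. -/
lemma Captures.exists_centered {P : Fin n → Vec d} {cl : Fin n → Fin k} {j : ℕ} {Z : ℝ}
    {B : List (Vec d)} (h : Captures P cl j Z B) (hne : ∀ l, (cluster cl l).Nonempty) :
    ∃ D : Fin k → Submodule ℝ (Vec d), (∀ l, D l ≤ sp B ∧ Module.finrank ℝ (D l) ≤ j) ∧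
      ∑ l, (∑ i ∈ cluster cl l, ‖res (sp B) (P i)‖ ^ 2 + ∑ i ∈ cluster cl l,
        ‖res (D l) ((sp B).starProjection (P i) -
          centroid (cluster cl l) fun i => (sp B).starProjection (P i))‖ ^ 2) ≤ Z := by
  obtain ⟨-, c, D, h1, h2⟩ := h
  refine ⟨D, fun l => (h1 l).2, le_trans ?_ h2⟩
  rw [flatCost, ← sum_cluster cl fun l i => ‖res (D l) (P i - c l)‖ ^ 2]
  refine Finset.sum_le_sum fun l _ => ?_
  have h3 : ∀ i, ‖res (D l) (P i - c l)‖ ^ 2 = ‖res (sp B) (P i)‖ ^ 2 +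
      ‖res (D l) ((sp B).starProjection (P i) - c l)‖ ^ 2 := fun i =>
    norm_res_sub_sq (h1 l).2.1 (P i) (h1 l).1
  simp_rw [h3, Finset.sum_add_distrib]
  refine add_le_add le_rfl ?_
  rw [sum_norm_res_sub_sq (P := fun i => (sp B).starProjection (P i)) (hne l) (D l) (c l)]
  exact le_add_of_nonneg_right (by positivity)

end Clusters

/-! ### The two phases -/

/-- `X` bounds the parameters of the problem. -/
structure IsScale (k j : ℕ) (ε α ω : ℝ) (X : ℕ) : Prop where
  one_le_k : 1 ≤ k
  one_le_j : 1 ≤ j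
  one_le_ω : 1 ≤ ω
  pos_α : 0 < α
  one_le : 1 ≤ X
  mul_le : k * j ≤ X
  one_le_ε : 1 ≤ ε * X
  one_le_α : 1 ≤ α * X
  sq_le : j * ω ^ 2 ≤ (X : ℝ) ^ 2
  sq_le_α : ω ^ 2 ≤ α * (X : ℝ) ^ 2

/-- As `ε ≤ 1` and `α ≤ 1/k ≤ 1`, the number `kjω` is at most `X`, `Xε` and `Xα`. The quadratic
conditions are products such as `ω · ω ≤ (Xα) X`. -/
lemma isScale_ceil {k j : ℕ} {ε α ω : ℝ} (hk : 1 ≤ k) (hj : 1 ≤ j) (hε : 0 < ε) (hε1 : ε ≤ 1)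
    (hα : 0 < α) (hαk : α ≤ 1 / (k : ℝ)) (hω : 1 ≤ ω) :
    IsScale k j ε α ω ⌈(k : ℝ) * j * ω / (ε * α)⌉₊ := by
  have hk' : (1 : ℝ) ≤ k := by exact_mod_cast hk
  have hj' : (1 : ℝ) ≤ j := by exact_mod_cast hj
  have hα1 : α ≤ 1 := hαk.trans (by rw [div_le_one (by linarith)]; exact hk')
  set X := ⌈(k : ℝ) * j * ω / (ε * α)⌉₊ with hX
  have hle : (k : ℝ) * j * ω ≤ X * (ε * α) := by
    rw [← div_le_iff₀ (by positivity)]; exact Nat.le_ceil _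
  have hkj : 1 ≤ (k : ℝ) * j := one_le_mul_of_one_le_of_one_le hk' hj'
  have hX0 : (0 : ℝ) ≤ X := Nat.cast_nonneg _
  have hXα : (k : ℝ) * j * ω ≤ X * α := by
    refine hle.trans ?_
    have : ε * α ≤ 1 * α := by gcongr
    nlinarith
  have hXε : (k : ℝ) * j * ω ≤ X * ε := by
    refine hle.trans ?_
    have : ε * α ≤ ε * 1 := by gcongr
    nlinarith
  have hXX : (k : ℝ) * j * ω ≤ X := by nlinarith
  have hωα : ω ≤ X * α := by nlinarith
  have hjω : j * ω ≤ (X : ℝ) := by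
    have : (j : ℝ) * ω ≤ k * (j * ω) := by
      have : 0 ≤ (j : ℝ) * ω := by positivity
      nlinarith
    linarith
  have hωX : ω ≤ (X : ℝ) := by nlinarith
  have hkjX : (k : ℝ) * j ≤ X := by nlinarith
  refine ⟨hk, hj, hω, hα, ?_, by exact_mod_cast hkjX, by nlinarith, by nlinarith, ?_, ?_⟩
  · have : (1 : ℝ) ≤ X := by linarith
    exact_mod_cast this
  · calc (j : ℝ) * ω ^ 2 = (j * ω) * ω := by ring
      _ ≤ X * X := by gcongr
      _ = _ := by ring
  · calc ω ^ 2 = ω * ω := by ring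
      _ ≤ (X * α) * X := by gcongr
      _ = _ := by ring

section Phases

variable {d n k j : ℕ} {ε α ω : ℝ} {X : ℕ}

lemma IsScale.one_le_cast (h : IsScale k j ε α ω X) : (1 : ℝ) ≤ X := by exact_mod_cast h.one_le

/-- A positive fraction of all the points is good. -/
lemma IsScale.exists_good (hX : IsScale k j ε α ω X) [NeZero n] {P : Fin n → Vec d}
    {C : Finset (Fin n)} (hC : C.Nonempty) (hreg : IsRegular ω C P) (hCα : α * n ≤ C.card)
    (V : Submodule ℝ (Vec d)) (o : Vec d) {W S : Submodule ℝ (Vec d)} (hWS : W ≤ S) {h : ℕ}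
    (hh : h < j) (hdim : Module.finrank ℝ S ≤ Module.finrank ℝ W + (h + 1)) :
    ∃ A : Finset (Fin n), 1 / (40 * (X : ℝ) ^ 2) * n ≤ A.card ∧ ∀ i ∈ A,
      IsGood C (fun i => V.starProjection (P i) - o) (5 * X * √C.card) (7 * X / √C.card) W S i := by
  classical
  have hX1 := hX.one_le_cast
  have hω := hX.one_le_ω
  have hm : (0 : ℝ) < C.card := Nat.cast_pos.2 hC.card_pos
  have hsm : 0 < √(C.card : ℝ) := Real.sqrt_pos.2 hm
  -- With `β = 5ω²` the fraction `α/(8β)` of all points is at least `1/(40X²)`, and the roots of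
  -- `20` and `40` are rounded up to 5 and 7.
  have h1 := card_isGood_ge (q := fun i => V.starProjection (P i) - o) (β := 5 * ω ^ 2)
    (by nlinarith) hC (fun v => hreg.sum_sq_proj_le hω hC V o v) hWS hdim
  have hhj : ((h + 1 : ℕ) : ℝ) ≤ j := by exact_mod_cast hh
  refine ⟨C.filter fun i => IsGood C (fun i => V.starProjection (P i) - o)
      √(4 * (5 * ω ^ 2) * (h + 1 : ℕ) * C.card) √(8 * (5 * ω ^ 2) / C.card) W S i,
      ?_, fun i hi => ?_⟩
  · set N : ℝ := ((C.filter fun i => IsGood C (fun i => V.starProjection (P i) - o)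
      √(4 * (5 * ω ^ 2) * (h + 1 : ℕ) * C.card) √(8 * (5 * ω ^ 2) / C.card) W S i).card : ℝ)
    have hN : 0 ≤ N := Nat.cast_nonneg _
    rw [div_mul_eq_mul_div, one_mul, div_le_iff₀ (by positivity)]
    have h2 : α * n ≤ α * (N * (40 * (X : ℝ) ^ 2)) := by
      calc α * n ≤ 8 * (5 * ω ^ 2) * N := hCα.trans h1
        _ = 40 * N * ω ^ 2 := by ring
        _ ≤ 40 * N * (α * (X : ℝ) ^ 2) := by gcongr; exact hX.sq_le_α
        _ = _ := by ring
    exact le_of_mul_le_mul_left h2 hX.pos_α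
  · obtain ⟨h3, h4⟩ := (Finset.mem_filter.1 hi).2
    refine ⟨h3.trans ?_, h4.trans ?_⟩
    · gcongr
      refine Real.sqrt_le_iff.2 ⟨by positivity, ?_⟩
      rw [mul_pow, Real.sq_sqrt hm.le]
      have : ((h + 1 : ℕ) : ℝ) * ω ^ 2 ≤ (X : ℝ) ^ 2 :=
        (mul_le_mul_of_nonneg_right hhj (sq_nonneg ω)).trans hX.sq_le
      calc 4 * (5 * ω ^ 2) * (h + 1 : ℕ) * C.card
          = 20 * C.card * (((h + 1 : ℕ) : ℝ) * ω ^ 2) := by ring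
        _ ≤ 20 * C.card * (X : ℝ) ^ 2 := by gcongr
        _ ≤ (5 * X) ^ 2 * C.card := by nlinarith [mul_nonneg hm.le (sq_nonneg (X : ℝ))]
    · refine mul_le_mul_of_nonneg_right ?_ (dev_nonneg _ _ _)
      refine Real.sqrt_le_iff.2 ⟨by positivity, ?_⟩
      rw [div_pow, Real.sq_sqrt hm.le]
      have hj1 : (1 : ℝ) ≤ j := by exact_mod_cast hX.one_le_j
      have : ω ^ 2 ≤ (X : ℝ) ^ 2 :=
        le_trans (le_mul_of_one_le_left (sq_nonneg ω) hj1) hX.sq_le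
      gcongr
      nlinarith

/-- The failure probability of one run of the recursive projection for one cluster. -/
def runFailure (X j : ℕ) : ℝ := 1 / (64 * X) + 1 / (512 * X) + j * (5 / (256 * X))

lemma runFailure_nonneg (X j : ℕ) : 0 ≤ runFailure X j := by unfold runFailure; positivity

lemma IsScale.mul_runFailure_le (hX : IsScale k j ε α ω X) : k * runFailure X j ≤ 1 / 24 := by
  have hX1 := hX.one_le_cast
  have hkj : (k : ℝ) * j ≤ X := by exact_mod_cast hX.mul_le
  have hj1 : (1 : ℝ) ≤ j := by exact_mod_cast hX.one_le_j
  have hk : (k : ℝ) ≤ X := le_trans (le_mul_of_one_le_right (Nat.cast_nonneg _) hj1) hkj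
  have h1 : (k : ℝ) * runFailure X j = (9 * k + 10 * (k * j)) / (512 * X) := by
    unfold runFailure; field_simp; ring
  rw [h1, div_le_iff₀ (by positivity)]
  linarith

/-- The common part of the two phases. -/
lemma IsScale.recursiveProjection_except (hX : IsScale k j ε α ω X) [NeZero n] (hjd : j ≤ d)
    {P : Fin n → Vec d} {C : Finset (Fin n)} (hC : C.Nonempty) (hreg : IsRegular ω C P)
    (hCα : α * n ≤ C.card) {V D : Submodule ℝ (Vec d)} (hDV : D ≤ V)
    (hDj : Module.finrank ℝ D ≤ j) {c : ℝ} (hc0 : 0 ≤ c)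
    (hc : ∑ i ∈ C, ‖res D (V.starProjection (P i) -
      centroid C fun i => V.starProjection (P i))‖ ^ 2 ≤ c)
    {G : List (Vec d)} {b : ℕ → ℝ} (hb : b j = √((1 + 1 / (8 * X)) * c))
    (step : ∀ o ∈ V, ∀ h < j, ∀ W S : Submodule ℝ (Vec d), W ≤ S → S ≤ V →
      Module.finrank ℝ S ≤ Module.finrank ℝ W + (h + 1) →
      dev C (fun i => V.starProjection (P i) - o) S ≤ b (h + 1) →
      ∀ i, IsGood C (fun i => V.starProjection (P i) - o) (5 * X * √C.card) (7 * X / √C.card)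
        W S i → ∃ g ∈ G, ∃ S' : Submodule ℝ (Vec d),
        W ⊔ Submodule.span ℝ {res W (V.starProjection (P i) - o) + g} ≤ S' ∧ S' ≤ V ∧
        Module.finrank ℝ S' ≤ Module.finrank ℝ
          ↥(W ⊔ Submodule.span ℝ {res W (V.starProjection (P i) - o) + g}) + h ∧
        dev C (fun i => V.starProjection (P i) - o) S' ≤ b h) :
    (recursiveProjection (fun i => V.starProjection (P i)) j (2048 * X ^ 3) G).Except
      (runFailure X j) fun L => ∃ F ∈ L,
        ∑ i ∈ C, fsd (P i) F ≤ ∑ i ∈ C, ‖res V (P i)‖ ^ 2 + b 0 ^ 2 := by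
  have hX1 := hX.one_le_cast
  have hX0 : (0 : ℝ) < X := by linarith
  have hαX := hX.one_le_α
  have hα := hX.pos_α
  refine (ProjClust.recursiveProjection_except (P := fun i => V.starProjection (P i))
    (fun i => proj_mem V _) hDV hjd hDj hC (r := 2048 * X ^ 3) (Nat.mul_pos (by norm_num)
      (Nat.pow_pos hX.one_le)) hα hCα (δ := 1 / (64 * X)) (by positivity)
    (G := G) (b := b) (p := 1 / (40 * (X : ℝ) ^ 2)) (by positivity) ?_ ?_ ?_ ?_).mono ?_ ?_
  · rw [div_le_one (by positivity)]; nlinarith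
  · rw [hb]; positivity
  · rw [hb, Real.sq_sqrt (by positivity)]
    refine mul_le_mul ?_ hc (Finset.sum_nonneg fun _ _ => sq_nonneg _) (by positivity)
    -- The sample size `2048 X³` makes the relative error of the center at most `1/(8X)`, because
    -- `αX ≥ 1`.
    have : 4 / (((2048 * X ^ 3 : ℕ) : ℝ) * α * (1 / (64 * X))) = 1 / (8 * X * (α * X)) := by
      push_cast; field_simp; ring
    rw [this]
    have h8 : 8 * (X : ℝ) ≤ 8 * X * (α * X) := le_mul_of_one_le_right (by positivity) hαX
    gcongr
  · intro o ho h hh W S hWS hSV hdim hdev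
    obtain ⟨A, hA, hgood⟩ := hX.exists_good hC hreg hCα V o hWS hh hdim
    exact ⟨A, hA, fun i hi => step o ho h hh W S hWS hSV hdim hdev i (hgood i hi)⟩
  -- The three terms: a bad mean of the sampled cluster points, too few of them, and a miss of the
  -- good points on one of the `j` levels.
  · unfold runFailure
    have e1 : 4 / (((2048 * X ^ 3 : ℕ) : ℝ) * α) ≤ 1 / (512 * X) := by
      push_cast
      rw [div_le_div_iff₀ (by positivity) (by positivity)]
      have : (X : ℝ) ^ 3 * α = X * (X * (α * X)) := by ring
      nlinarith [mul_le_mul_of_nonneg_left hαX hX0.le, mul_pos hX0 hX0]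
    have e2 : (j : ℝ) * (1 / (((2048 * X ^ 3 : ℕ) : ℝ) * (1 / (40 * (X : ℝ) ^ 2)))) =
        j * (5 / (256 * X)) := by
      push_cast; field_simp; ring
    rw [e2]
    gcongr
  · rintro L ⟨F, hF, hFV, U, hUV, hU, hdev⟩
    refine ⟨F, hF, (sum_fsd_le hFV hUV hU).trans ?_⟩
    gcongr
    exact dev_nonneg _ _ _

/-- Without a grid the cost of a cluster is within a factor that depends on `X` only. -/
lemma IsScale.coarse_except (hX : IsScale k j ε α ω X) [NeZero n] (hjd : j ≤ d)
    {P : Fin n → Vec d} {C : Finset (Fin n)} (hC : C.Nonempty) (hreg : IsRegular ω C P)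
    (hCα : α * n ≤ C.card) {V D : Submodule ℝ (Vec d)} (hDV : D ≤ V)
    (hDj : Module.finrank ℝ D ≤ j) {c : ℝ} (hc0 : 0 ≤ c)
    (hc : ∑ i ∈ C, ‖res D (V.starProjection (P i) -
      centroid C fun i => V.starProjection (P i))‖ ^ 2 ≤ c) :
    (recursiveProjection (fun i => V.starProjection (P i)) j (2048 * X ^ 3) [0]).Except
      (runFailure X j) fun L => ∃ F ∈ L, ∑ i ∈ C, fsd (P i) F ≤ ∑ i ∈ C, ‖res V (P i)‖ ^ 2 +
        ((36 * (X : ℝ) ^ 2) ^ j * √((1 + 1 / (8 * X)) * c)) ^ 2 := by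
  have hX1 := hX.one_le_cast
  have hsm : 0 < √(C.card : ℝ) := Real.sqrt_pos.2 (Nat.cast_pos.2 hC.card_pos)
  refine (hX.recursiveProjection_except hjd hC hreg hCα hDV hDj hc0 hc (G := [0])
    (b := fun h => (36 * (X : ℝ) ^ 2) ^ (j - h) * √((1 + 1 / (8 * X)) * c)) (by simp) ?_).mono
    le_rfl fun _ h => h
  intro o ho h hh W S hWS hSV hdim hdev i hi
  obtain ⟨S', h1, h2, h3, h4⟩ := exists_tilt_of_isGood (by positivity) (by positivity) hWS hSV
    hdim hi (V.sub_mem (proj_mem V _) ho)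
  refine ⟨0, by simp, S', by rwa [add_zero], h2, by rwa [add_zero], h4.trans ?_⟩
  have e : j - h = (j - (h + 1)) + 1 := by omega
  rw [e, pow_succ', mul_assoc (36 * (X : ℝ) ^ 2)]
  refine mul_le_mul ?_ hdev (dev_nonneg _ _ _) (by positivity)
  -- The factor of one level is `1 + ab = 1 + 35X² ≤ 36X²`; the cluster size cancels.
  have : 5 * X * √(C.card : ℝ) * (7 * X / √(C.card : ℝ)) = 35 * (X : ℝ) ^ 2 := by
    field_simp; ring
  rw [this]; nlinarith

/-- With a fine grid the error of a cluster increases by a small amount only. -/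
lemma IsScale.fine_except (hX : IsScale k j ε α ω X) [NeZero n] (hjd : j ≤ d)
    {P : Fin n → Vec d} {C : Finset (Fin n)} (hC : C.Nonempty) (hreg : IsRegular ω C P)
    (hCα : α * n ≤ C.card) {B : List (Vec d)} (hB : Orth B) (hB1 : ∀ b ∈ B, ‖b‖ = 1)
    {D : Submodule ℝ (Vec d)} (hDV : D ≤ sp B)
    (hDj : Module.finrank ℝ D ≤ j) {c : ℝ} (hc0 : 0 ≤ c)
    (hc : ∑ i ∈ C, ‖res D ((sp B).starProjection (P i) -
      centroid C fun i => (sp B).starProjection (P i))‖ ^ 2 ≤ c) {M : ℕ} {a θ : ℝ} (ha : 0 ≤ a)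
    (hθ : 10 * X * √C.card * (B.length * a) ≤ θ)
    (hrad : 7 * X / √C.card * (√((1 + 1 / (8 * X)) * c) + j * θ) ≤ M * a) :
    (recursiveProjection (fun i => (sp B).starProjection (P i)) j (2048 * X ^ 3)
      (grid M a B).val).Except (runFailure X j) fun L => ∃ F ∈ L,
        ∑ i ∈ C, fsd (P i) F ≤ ∑ i ∈ C, ‖res (sp B) (P i)‖ ^ 2 +
          (√((1 + 1 / (8 * X)) * c) + j * θ) ^ 2 := by
  have hX1 := hX.one_le_cast
  have hsm : 0 < √(C.card : ℝ) := Real.sqrt_pos.2 (Nat.cast_pos.2 hC.card_pos)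
  have hθ0 : 0 ≤ θ := le_trans (by positivity) hθ
  refine (hX.recursiveProjection_except hjd hC hreg hCα hDV hDj hc0 hc (G := (grid M a B).val)
    (b := fun h => √((1 + 1 / (8 * X)) * c) + ((j - h : ℕ) : ℝ) * θ) (by simp) ?_).mono
    le_rfl fun _ h => h
  intro o ho h hh W S hWS hSV hdim hdev i hi
  have hq : (sp B).starProjection (P i) - o ∈ sp B := Submodule.sub_mem _ (proj_mem _ _) ho
  -- A good point is close enough to `S` for its residual to lie within the radius of the grid, so a
  -- grid vector nearly cancels it.
  have hres : ‖- res S ((sp B).starProjection (P i) - o)‖ ≤ M * a := by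
    rw [norm_neg]
    refine hi.2.trans (le_trans ?_ hrad)
    gcongr
    refine hdev.trans ?_
    gcongr
    omega
  obtain ⟨g, hg, hgn⟩ := exists_grid_near ha hB hB1 (Submodule.neg_mem _ (by
    rw [res_apply]; exact Submodule.sub_mem _ hq (hSV (proj_mem S _)))) hres
  obtain ⟨S', h1, h2, h3, h4⟩ := exists_tilt_of_near (a := 5 * X * √(C.card : ℝ)) (θ := θ)
    (η := B.length * a) (by positivity) (by positivity) (by linarith) hWS hSV hdim hi.1
    hq (mem_sp_of_mem_grid _ _ _ hg) hgn
  refine ⟨g, hg, S', h1, h2, h3, h4.trans ?_⟩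
  have e : ((j - h : ℕ) : ℝ) = ((j - (h + 1) : ℕ) : ℝ) + 1 := by
    have : j - h = (j - (h + 1)) + 1 := by omega
    rw [this]; push_cast; ring
  rw [e]; linarith

end Phases

section Main

variable {d n k j : ℕ} {ε α ω : ℝ} {X : ℕ}

/-! ### The choice of the parameters -/

/-- The number of rounds of adaptive sampling that bring the error down to the optimum. -/
def shrinkRounds (X : ℕ) : ℕ := 2 * X * (X + 10)

/-- An upper bound for the ratio of the errors before the grid is used and at the optimum, up to
taking roots. -/
def errorRatio (X : ℕ) : ℕ := 2 * (36 * X ^ 2) ^ X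

/-- The parameters for problems of scale `X`. -/
def choice (X : ℕ) : Params where
  -- At least `k(j+1)` rounds that remove the missing dimensions, followed by the rounds that halve
  -- the excess.
  rounds := 2 * X + (shrinkRounds X + 1)
  -- With failure probability `1/(8(T+1))` for each halving round, where `T` is `shrinkRounds X`,
  -- the relative error of a round is at most `2X/(50X²) ≤ 1/(24X)`.
  batch := 400 * X ^ 2 * (shrinkRounds X + 1)
  sampleSize := 2048 * X ^ 3
  radius := 9 * X ^ 2
  -- The second factor bounds the dimension of `V`. The number `720 = 10 · 9 · 8` makes the error of
  -- one level equal to `√m √L / (8X²κ)` for a cluster of `m` points, with `κ` the value of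
  -- `errorRatio`.
  cells := 720 * X ^ 5 * ((2 * X + (shrinkRounds X + 1)) * (400 * X ^ 2 * (shrinkRounds X + 1))) *
    errorRatio X

/-- For `Γ = 2^(X+8)` the growth `(4Γ)^(2X)` is exactly `2^shrinkRounds`, while the failures `2X ·
2/Γ` stay below `1/64`. The halving rounds contribute `1/8`, and `3/(24X) = 1/(8X)`. -/
lemma IsScale.dimensionReduction_except (hX : IsScale k j ε α ω X) {P : Fin n → Vec d}
    {cl : Fin n → Fin k} (hcl : ∀ l, (cluster cl l).Nonempty) {D : Fin k → Submodule ℝ (Vec d)}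
    (hD : ∀ l, Module.finrank ℝ (D l) ≤ j) {Z : ℝ}
    (hZ : flatCost P cl (fun l => centroid (cluster cl l) P) D ≤ Z) :
    (dimensionReduction P (choice X).rounds (choice X).batch).Except (9 / 64)
      fun B => Captures P cl j ((1 + 1 / (8 * X)) * Z) B ∧ ∀ b ∈ B, ‖b‖ = 1 := by
  have hX1 := hX.one_le_cast
  obtain ⟨T, hT⟩ : ∃ T, T = shrinkRounds X := ⟨_, rfl⟩
  have hkj : (k : ℝ) * j ≤ X := by exact_mod_cast hX.mul_le
  have hk : k * (j + 1) ≤ 2 * X := by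
    have := hX.mul_le
    have := Nat.le_mul_of_pos_right k hX.one_le_j
    rw [mul_add]; omega
  have hk' : (k : ℝ) * (j + 1) ≤ 2 * X := by exact_mod_cast hk
  have hs : 0 < 400 * X ^ 2 * (T + 1) := by have := hX.one_le; positivity
  have := dimensionReduction_captures (s := 400 * X ^ 2 * (T + 1)) hs hcl hD hZ
    (δ := 1 / (8 * (T + 1))) (γ := 1 / (24 * X)) (Γ := 2 ^ (X + 8)) (h := 2 * X) (t := T)
    (by positivity) ?_ ?_ ?_ hk ?_
  · simp only [choice, ← hT]
    refine this.mono ?_ fun B hB => ?_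
    · have h1 : (T + 1 : ℝ) * (1 / (8 * (T + 1))) = 1 / 8 := by field_simp
      have h2 : ((2 * X : ℕ) : ℝ) * (2 / 2 ^ (X + 8)) ≤ 1 / 64 := by
        have h3 : (X : ℝ) ≤ 2 ^ X := by exact_mod_cast Nat.lt_two_pow_self.le
        rw [pow_add, ← mul_div_assoc, div_le_div_iff₀ (by positivity) (by positivity)]
        push_cast; linarith
      rw [h1]; linarith
    · have h1 : 1 + 3 * (1 / (24 * (X : ℝ))) = 1 + 1 / (8 * X) := by field_simp; ring
      rw [h1] at hB
      exact hB
  · have h1 : (((400 * X ^ 2 * (T + 1) : ℕ) : ℝ) * (1 / (8 * (T + 1)))) = 50 * (X : ℝ) ^ 2 := by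
      push_cast; field_simp; norm_num
    rw [h1, div_le_div_iff₀ (by positivity) (by positivity)]
    nlinarith
  · rw [div_le_div_iff₀ (by positivity) (by positivity)]; linarith
  · exact one_le_pow₀ (by norm_num)
  · have h1 : (4 : ℝ) * 2 ^ (X + 8) = 2 ^ (X + 10) := by
      rw [show X + 10 = X + 8 + 2 by ring, pow_add _ (X + 8) 2]; ring
    rw [h1, ← pow_mul, hT, shrinkRounds, mul_comm (X + 10)]

/-- The total cost of the coarse flats. -/
lemma IsScale.sum_coarse_le (hX : IsScale k j ε α ω X) {e c : Fin k → ℝ} (he : ∀ l, 0 ≤ e l)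
    (hc : ∀ l, 0 ≤ c l) {Z : ℝ} (hZ : 0 ≤ Z) (h : ∑ l, (e l + c l) ≤ (1 + 1 / (8 * X)) * Z) :
    ∑ l, (e l + ((36 * (X : ℝ) ^ 2) ^ j * √((1 + 1 / (8 * X)) * c l)) ^ 2) ≤
      (errorRatio X : ℝ) ^ 2 * Z := by
  have hX1 := hX.one_le_cast
  have hw : 1 / (8 * (X : ℝ)) ≤ 1 / 8 := by gcongr; linarith
  have hw0 : 0 ≤ 1 / (8 * (X : ℝ)) := by positivity
  set w := 1 / (8 * (X : ℝ))
  have hjX : j ≤ X := (Nat.le_mul_of_pos_left j hX.one_le_k).trans hX.mul_le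
  set A := (36 * (X : ℝ) ^ 2) ^ X with hA
  have h36 : 1 ≤ 36 * (X : ℝ) ^ 2 := by nlinarith
  have hA1 : 1 ≤ A := one_le_pow₀ h36
  have hAj : (36 * (X : ℝ) ^ 2) ^ j ≤ A := pow_le_pow_right₀ h36 hjX
  -- The factor 2, squared, absorbs the two factors `1 + w ≤ 9/8`.
  have hr : (errorRatio X : ℝ) = 2 * A := by rw [errorRatio, hA]; push_cast; ring
  have h1 : ∀ l, e l + ((36 * (X : ℝ) ^ 2) ^ j * √((1 + w) * c l)) ^ 2 ≤
      A ^ 2 * (9 / 8) * (e l + c l) := by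
    intro l
    have h0 : 0 ≤ (1 + w) * c l := mul_nonneg (by linarith) (hc l)
    rw [mul_pow, Real.sq_sqrt h0]
    have h2 : ((36 * (X : ℝ) ^ 2) ^ j) ^ 2 * ((1 + w) * c l) ≤ A ^ 2 * ((9 / 8) * c l) := by
      have := hc l
      gcongr
      linarith
    have h3 : 1 * e l ≤ A ^ 2 * (9 / 8) * e l :=
      mul_le_mul_of_nonneg_right (by nlinarith) (he l)
    linarith
  calc _ ≤ ∑ l, A ^ 2 * (9 / 8) * (e l + c l) := Finset.sum_le_sum fun l _ => h1 l
    _ = A ^ 2 * (9 / 8) * ∑ l, (e l + c l) := by rw [Finset.mul_sum]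
    _ ≤ A ^ 2 * (9 / 8) * ((9 / 8) * Z) := by
        gcongr
        refine h.trans ?_
        gcongr
        linarith
    _ ≤ _ := by rw [hr]; nlinarith [mul_nonneg (sq_nonneg A) hZ]

/-- The total cost of the fine flats. -/
lemma IsScale.sum_fine_le (hX : IsScale k j ε α ω X) {e c m θ : Fin k → ℝ} (he : ∀ l, 0 ≤ e l)
    (hc : ∀ l, 0 ≤ c l) {Z L r N : ℝ} (hZ : 0 ≤ Z) (hr : 0 < r)
    (h : ∑ l, (e l + c l) ≤ (1 + 1 / (8 * X)) * Z) (hN : ∑ l, m l = N)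
    (hL : N * L ≤ r ^ 2 * Z) (hθ : ∀ l, θ l ^ 2 = (1 / (8 * X ^ 2 * r)) ^ 2 * (m l * L))
    (hmL : ∀ l, 0 ≤ m l * L) :
    ∑ l, (e l + (√((1 + 1 / (8 * X)) * c l) + j * θ l) ^ 2) ≤ (1 + ε) * Z := by
  have hX1 := hX.one_le_cast
  have hX0 : (0 : ℝ) < X := by linarith
  obtain ⟨w, hw⟩ : ∃ w, w = 1 / (8 * (X : ℝ)) := ⟨_, rfl⟩
  have hw0 : 0 < w := by rw [hw]; positivity
  have hXw : 8 * X * w = 1 := by rw [hw]; field_simp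
  have hw8 : w ≤ 1 / 8 := by nlinarith
  rw [← hw] at h ⊢
  have hjX : (j : ℝ) ≤ X := by
    exact_mod_cast (Nat.le_mul_of_pos_left j hX.one_le_k).trans hX.mul_le
  have h1 : ∀ l, e l + (√((1 + w) * c l) + j * θ l) ^ 2 ≤
      (1 + w) ^ 2 * (e l + c l) + 9 * w ^ 2 * X * (1 / r ^ 2) * (m l * L) := by
    intro l
    set u := √((1 + w) * c l) with hu
    have hu2 : u ^ 2 = (1 + w) * c l := Real.sq_sqrt (mul_nonneg (by linarith) (hc l))
    -- The weighted inequality between the means, with weights balanced by `8Xw = 1`.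
    have h2 : (u + j * θ l) ^ 2 ≤ (1 + w) * u ^ 2 + (1 + 8 * X) * (j * θ l) ^ 2 := by
      have h3 : 0 ≤ 8 * X * (w * u - j * θ l) ^ 2 := by positivity
      have h4 : 8 * X * (w * u - j * θ l) ^ 2 =
          (8 * X * w) * w * u ^ 2 - 2 * (8 * X * w) * u * (j * θ l) + 8 * X * (j * θ l) ^ 2 := by
        ring
      rw [h4, hXw] at h3
      nlinarith
    have h5 : (1 + 8 * X) * (j * θ l) ^ 2 ≤ 9 * w ^ 2 * X * (1 / r ^ 2) * (m l * L) := by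
      rw [mul_pow, hθ l]
      have h6 : (1 / (8 * X ^ 2 * r)) ^ 2 = w ^ 2 * (1 / X ^ 2) * (1 / r ^ 2) := by
        rw [hw]; field_simp
      rw [h6]
      calc (1 + 8 * X) * ((j : ℝ) ^ 2 * (w ^ 2 * (1 / X ^ 2) * (1 / r ^ 2) * (m l * L)))
          ≤ (9 * X) * ((X : ℝ) ^ 2 * (w ^ 2 * (1 / X ^ 2) * (1 / r ^ 2) * (m l * L))) := by
            have := hmL l
            gcongr
            linarith
        _ = _ := by field_simp
    have h7 : 1 * e l ≤ (1 + w) ^ 2 * e l :=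
      mul_le_mul_of_nonneg_right (by nlinarith) (he l)
    rw [hu2] at h2
    nlinarith
  calc _ ≤ ∑ l, ((1 + w) ^ 2 * (e l + c l) + 9 * w ^ 2 * X * (1 / r ^ 2) * (m l * L)) :=
        Finset.sum_le_sum fun l _ => h1 l
    _ = (1 + w) ^ 2 * ∑ l, (e l + c l) + 9 * w ^ 2 * X * (1 / r ^ 2) * (N * L) := by
        rw [Finset.sum_add_distrib, ← Finset.mul_sum, ← Finset.mul_sum, ← Finset.sum_mul, hN]
    _ ≤ (1 + w) ^ 2 * ((1 + w) * Z) + 9 * w ^ 2 * X * (1 / r ^ 2) * (r ^ 2 * Z) := by gcongr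
    _ = ((1 + w) ^ 3 + 9 / 8 * w * (8 * X * w)) * Z := by field_simp
    _ ≤ (1 + ε) * Z := by
        refine mul_le_mul_of_nonneg_right ?_ hZ
        rw [hXw]
        -- All errors together give `(1 + w)³ + 9w/8 ≤ 1 + 8w`, and `8w = 1/X ≤ ε`.
        have h8 : 8 * w ≤ ε := by
          have := mul_le_mul_of_nonneg_left hX.one_le_ε (by positivity : 0 ≤ 8 * w)
          nlinarith
        nlinarith [mul_pos hw0 hw0]

end Main

section Final

variable {d n k j : ℕ} {ε α ω : ℝ} {X : ℕ}

/-! ### The approximation guarantee -/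

/-- The radius of the grid suffices. -/
lemma IsScale.radius_le (hX : IsScale k j ε α ω X) {N m L c Z κ θ : ℝ} (hN : 0 ≤ N) (hm : 0 < m)
    (hL : 0 ≤ L) (hNm : α * N ≤ m) (hc : 0 ≤ c) (hcZ : c ≤ (1 + 1 / (8 * X)) * Z)
    (hZL : Z ≤ N * L) (hκ : 1 ≤ κ) (hθ : θ = 1 / (8 * X ^ 2 * κ) * (√m * √L)) :
    7 * X / √m * (√((1 + 1 / (8 * X)) * c) + j * θ) ≤ 9 * X ^ 2 * √L := by
  have hX1 := hX.one_le_cast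
  have hX0 : (0 : ℝ) < X := by linarith
  have hw : 1 + 1 / (8 * (X : ℝ)) ≤ 9 / 8 := by
    have : 1 / (8 * (X : ℝ)) ≤ 1 / 8 := by gcongr; linarith
    linarith
  have hw0 : 0 < 1 + 1 / (8 * (X : ℝ)) := by positivity
  -- Since a cluster holds a fraction `α ≥ 1/X` of the points, its cost is bounded in terms of its
  -- own size and `L`, and dividing by `√m` leaves a multiple of `√L`.
  have hNm' : N ≤ X * m := by
    have h1 := mul_le_mul_of_nonneg_left hNm hX0.le
    have h2 := mul_le_mul_of_nonneg_right hX.one_le_α hN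
    linarith
  have hroot : √((1 + 1 / (8 * X)) * c) ≤ 9 / 8 * X * (√m * √L) := by
    refine Real.sqrt_le_iff.2 ⟨by positivity, ?_⟩
    rw [mul_pow, mul_pow √_, Real.sq_sqrt hm.le, Real.sq_sqrt hL]
    have hNL : N * L ≤ X * m * L := mul_le_mul_of_nonneg_right hNm' hL
    have hXX : X * m * L ≤ X * (X * m * L) := le_mul_of_one_le_left (by positivity) hX1
    have h1 : c ≤ 9 / 8 * (X * m * L) :=
      hcZ.trans (mul_le_mul hw (hZL.trans hNL) (by
        by_contra hneg
        push Not at hneg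
        nlinarith) (by norm_num))
    calc (1 + 1 / (8 * X)) * c ≤ 9 / 8 * (9 / 8 * (X * m * L)) :=
          mul_le_mul hw h1 hc (by norm_num)
      _ ≤ (9 / 8) * (9 / 8 * (X * (X * m * L))) := by linarith
      _ = _ := by ring
  have hjX : (j : ℝ) ≤ X := by
    exact_mod_cast (Nat.le_mul_of_pos_left j hX.one_le_k).trans hX.mul_le
  have hsmall : j * θ ≤ 1 / 8 * X * (√m * √L) := by
    rw [hθ, ← mul_assoc]
    refine mul_le_mul_of_nonneg_right ?_ (by positivity)
    rw [mul_one_div, div_le_iff₀ (by positivity)]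
    refine hjX.trans ?_
    have h1 : (1 : ℝ) ≤ X ^ 2 * κ := one_le_mul_of_one_le_of_one_le (one_le_pow₀ hX1) hκ
    nlinarith
  have hm0 : 0 < √m := Real.sqrt_pos.2 hm
  calc _ ≤ 7 * X / √m * (9 / 8 * X * (√m * √L) + 1 / 8 * X * (√m * √L)) := by gcongr
    _ = 35 / 4 * X ^ 2 * √L := by field_simp; ring
    _ ≤ _ := by gcongr; norm_num

/-- The algorithm finds a near-optimal solution of a regular problem. -/
lemma IsScale.projectiveClustering_except (hX : IsScale k j ε α ω X) [NeZero n] (hjd : j ≤ d)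
    {P : Fin n → Vec d} {F : Fin k → AffineSubspace ℝ (Vec d)} {cl : Fin n → Fin k}
    (hF : IsOptimal j P F) (hcl : IsNearest P F cl)
    (hreg : ∀ l, IsRegular ω (cluster cl l) P)
    (hα : ∀ l, α * (n : ℝ) ≤ ((cluster cl l).card : ℝ)) :
    (projectiveClustering (choice X) k j P).Except (1 / 2)
      (IsSolution k j P ((1 + ε) * objective P F)) := by
  have hn : (0 : ℝ) < n := Nat.cast_pos.2 (NeZero.pos n)
  have hX1 := hX.one_le_cast
  have hX0 : (0 : ℝ) < X := by linarith
  have hd : 1 ≤ d := hX.one_le_j.trans hjd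
  have hne : ∀ l, (cluster cl l).Nonempty := by
    intro l
    have : (0 : ℝ) < (cluster cl l).card := lt_of_lt_of_le (mul_pos hX.pos_α hn) (hα l)
    exact Finset.card_pos.1 (by exact_mod_cast this)
  have hcard : ∑ l, ((cluster cl l).card : ℝ) = n := by
    have := sum_cluster cl fun _ _ => (1 : ℝ)
    simpa using this
  set Z := n * objective P F with hZ
  have hdim := hX.dimensionReduction_except hne (fun l => (hF.1 l).2.le)
    (flatCost_centroid_le (fun l => (hF.1 l).1) hcl hne)
  have hZ0 : 0 ≤ Z := le_trans (Finset.sum_nonneg fun _ _ => sq_nonneg _)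
    (flatCost_centroid_le (fun l => (hF.1 l).1) hcl hne)
  obtain ⟨b, hb⟩ : ∃ b, b = (choice X).rounds * (choice X).batch := ⟨_, rfl⟩
  have hb0 : 0 < b := by
    rw [hb]; simp only [choice]; have := hX.one_le; positivity
  obtain ⟨κ, hκ⟩ : ∃ κ, κ = errorRatio X := ⟨_, rfl⟩
  have hκ0 : 0 < κ := by rw [hκ, errorRatio]; have := hX.one_le; positivity
  have hκ1 : (1 : ℝ) ≤ κ := by exact_mod_cast hκ0
  have hM : ((choice X).cells : ℝ) = 720 * X ^ 5 * b * κ := by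
    rw [hb, hκ]; simp only [choice]; push_cast; ring
  have hsize : (choice X).sampleSize = 2048 * X ^ 3 := rfl
  have hradius : (choice X).radius = 9 * (X : ℝ) ^ 2 := rfl
  have hlist := fun (P' : Fin n → Vec d) (G : List (Vec d)) (hG : 1 ≤ G.length) =>
    always_repeatRand k (always_recursiveProjection (j := j) hd hjd P' (2048 * X ^ 3)
      (le_refl G.length) hG)
  unfold projectiveClustering
  rw [hsize, hradius]
  generalize (choice X).cells = M at hM ⊢
  -- The failure probabilities are `9/64` for the dimension reduction and `1/24` for each of the two
  -- phases, less than `1/2` together.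
  refine ((hdim.and_always (always_dimensionReduction P _ _)).bind
    (δ₂ := 1 / 24 + 1 / 24) (by norm_num) ?_).mono (by norm_num) fun _ h => h
  rintro B ⟨⟨hcap, hunit⟩, hBlen, hBO, -⟩
  rw [← hb] at hBlen
  obtain ⟨D, hD, hDZ⟩ := hcap.exists_centered hne
  set V := sp B with hV
  set e : Fin k → ℝ := fun l => ∑ i ∈ cluster cl l, ‖res V (P i)‖ ^ 2 with he
  set c : Fin k → ℝ := fun l => ∑ i ∈ cluster cl l, ‖res (D l) (V.starProjection (P i) -
    centroid (cluster cl l) fun i => V.starProjection (P i))‖ ^ 2 with hc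
  have he0 : ∀ l, 0 ≤ e l := fun l => Finset.sum_nonneg fun _ _ => sq_nonneg _
  have hc0 : ∀ l, 0 ≤ c l := fun l => Finset.sum_nonneg fun _ _ => sq_nonneg _
  refine Rand.Except.det_bind (Rand.Except.det_bind ?_)
  have hP : (table fun i => project B (P i)).val = fun i => V.starProjection (P i) :=
    funext fun i => project_val hBO (P i)
  rw [hP, vzero_val]
  have hcoarse := except_repeatRand_ofFn (k := k) (runFailure_nonneg X j) fun l =>
    hX.coarse_except hjd (hne l) (hreg l) (hα l) (hD l).1 (hD l).2 (hc0 l) le_rfl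
  refine ((hcoarse.mono hX.mul_runFailure_le fun _ h => h).and_always
    (hlist _ [0] (by simp))).bind (δ₂ := 1 / 24) (by norm_num) ?_
  rintro T ⟨⟨H, hHT, hH⟩, hTk, hT⟩
  obtain ⟨Gs, hbest, hflat, hGs⟩ := bestCombination_spec P hX.one_le_k cl hTk
    (fun L hL => (hT L hL).2) hHT
  refine Rand.Except.det_bind ?_
  rw [hbest]
  set L := objective P fun l => (Gs l).toFlat with hL
  simp only [Option.map_some, Option.getD_some]
  refine Rand.Except.det_bind (Rand.Except.det_bind (Rand.Except.det_bind
    (Rand.Except.det_bind ?_)))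
  simp only [rsqrt_val, rmul_val, rdiv_val]
  -- The coarse flats are genuine `j`-flats, so `L` is at least the optimum; this makes the radius
  -- large enough. The upper bound `hLZ` on `L` makes the grid fine enough.
  have hLopt : objective P F ≤ L := hF.2 _ hflat
  have hL0 : 0 ≤ L := le_trans (nonneg_of_mul_nonneg_right hZ0 hn) hLopt
  have hLZ : n * L ≤ (κ : ℝ) ^ 2 * Z := by
    rw [hκ]
    exact (hGs.trans (Finset.sum_le_sum fun l _ => hH l)).trans
      (hX.sum_coarse_le he0 hc0 hZ0 hDZ)
  have hZL : Z ≤ n * L := mul_le_mul_of_nonneg_left hLopt hn.le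
  have hM0 : (0 : ℝ) < M := by
    rw [hM]; have : (0 : ℝ) < b := by exact_mod_cast hb0
    positivity
  set a := 9 * (X : ℝ) ^ 2 * √L / M with ha
  have ha0 : 0 ≤ a := by positivity
  -- The admissible error is proportional to the root of the cluster size, so that the squares over
  -- all clusters add up to a multiple of `n L`.
  obtain ⟨θ, hθ⟩ : ∃ θ : Fin k → ℝ,
      ∀ l, θ l = 1 / (8 * X ^ 2 * κ) * (√((cluster cl l).card : ℝ) * √L) := ⟨_, fun _ => rfl⟩
  have hgrid1 : 1 ≤ (grid M a B).val.length := by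
    rw [grid_length]; exact Nat.one_le_pow _ _ (by omega)
  have hfine := except_repeatRand_ofFn (k := k) (runFailure_nonneg X j) fun l =>
    hX.fine_except (M := M) (a := a) (θ := θ l) hjd (hne l) (hreg l) (hα l) hBO hunit (hD l).1
      (hD l).2 (hc0 l) le_rfl ha0 ?_ ?_
  · refine (((hfine.mono hX.mul_runFailure_le fun _ h => h).and_always
      (hlist _ _ hgrid1)).bind (δ₂ := 0) le_rfl ?_).mono (by norm_num) fun _ h => h
    rintro T' ⟨⟨H', hHT', hH'⟩, hTk', hT'⟩
    obtain ⟨Gs', hbest', hflat', hGs'⟩ := bestCombination_spec P hX.one_le_k cl hTk'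
      (fun L hL => (hT' L hL).2) hHT'
    refine Rand.Except.det_bind ?_
    rw [hbest']
    refine Rand.except_pure ⟨fun l => (Gs' l).toFlat, ?_, hflat', ?_⟩
    · simp only [Option.map_some, Option.getD_some]
      rw [List.map_ofFn]; rfl
    · have h1 := (hGs'.trans (Finset.sum_le_sum fun l _ => hH' l)).trans
        (hX.sum_fine_le (m := fun l => ((cluster cl l).card : ℝ)) (θ := θ) (r := κ) he0 hc0 hZ0
          (by linarith) hDZ hcard hLZ (fun l => by
            rw [hθ l, mul_pow, mul_pow, Real.sq_sqrt (Nat.cast_nonneg _), Real.sq_sqrt hL0])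
          fun l => mul_nonneg (Nat.cast_nonneg _) hL0)
      refine le_of_mul_le_mul_left (h1.trans (le_of_eq ?_)) hn
      rw [hZ]; ring
  · rw [hθ l]
    set m := √((cluster cl l).card : ℝ)
    have hbB : (B.length : ℝ) ≤ b := by exact_mod_cast hBlen
    have hbpos : (0 : ℝ) < b := by exact_mod_cast hb0
    calc 10 * X * m * (B.length * a) ≤ 10 * X * m * (b * a) := by gcongr
      _ = 1 / (8 * X ^ 2 * κ) * (m * √L) := by
        rw [ha, hM]; field_simp; ring
  · have hcl0 : (0 : ℝ) < (cluster cl l).card := Nat.cast_pos.2 (hne l).card_pos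
    have hMa : M * a = 9 * (X : ℝ) ^ 2 * √L := by rw [ha]; field_simp
    have hcZ : c l ≤ (1 + 1 / (8 * X)) * Z :=
      (le_add_of_nonneg_left (he0 l)).trans ((Finset.single_le_sum (f := fun l => e l + c l)
        (fun l _ => add_nonneg (he0 l) (hc0 l)) (Finset.mem_univ l)).trans hDZ)
    rw [hMa]
    exact hX.radius_le hn.le hcl0 hL0 (hα l) (hc0 l) hcZ hZL hκ1 (hθ l)

/-! ### The running time -/

/-- The coefficients are sums for `X ≥ 1`: `2 + 2 + 20 + 1 = 25` for the rounds, `400 · 23 = 9200`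
for the batch, and `230000` for their product, which is below `2^18`. Bounding `X` by `2^X` turns
the number of cells into a power of two with exponent at most `50X²`. -/
lemma two_mul_cells_le (hX : 1 ≤ X) : 2 * (choice X).cells + 1 ≤ 2 ^ (50 * X ^ 2) ∧
    (choice X).rounds ≤ 230000 * X ^ 6 ∧ (choice X).batch ≤ 230000 * X ^ 6 ∧
    (choice X).rounds * (choice X).batch ≤ 230000 * X ^ 6 ∧
    (choice X).sampleSize ≤ 230000 * X ^ 6 := by
  have h1 : (choice X).rounds ≤ 25 * X ^ 2 := by
    simp only [choice, shrinkRounds]; nlinarith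
  have h2 : (choice X).batch ≤ 9200 * X ^ 4 := by
    simp only [choice, shrinkRounds]
    calc _ ≤ 400 * X ^ 2 * (23 * X ^ 2) := by gcongr; nlinarith
      _ = _ := by ring
  have h3 : (choice X).rounds * (choice X).batch ≤ 230000 * X ^ 6 :=
    (Nat.mul_le_mul h1 h2).trans (le_of_eq (by ring))
  have h4 : ∀ i ≤ 6, X ^ i ≤ X ^ 6 := fun i hi => Nat.pow_le_pow_right hX hi
  have h5 := h4 2 (by norm_num)
  have h6 := h4 4 (by norm_num)
  have h7 := h4 3 (by norm_num)
  refine ⟨?_, by omega, by omega, h3, by simp only [choice]; omega⟩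
  have hx : X ≤ 2 ^ X := Nat.lt_two_pow_self.le
  have h8 : (choice X).cells = 720 * X ^ 5 * ((choice X).rounds * (choice X).batch) *
    (2 * (36 * X ^ 2) ^ X) := rfl
  have h9 : (choice X).cells ≤
      2 ^ 10 * (2 ^ X) ^ 5 * (2 ^ 18 * (2 ^ X) ^ 6) * (2 * (2 ^ 6 * (2 ^ X) ^ 2) ^ X) := by
    rw [h8]
    generalize (choice X).rounds * (choice X).batch = b at h3
    have hb : b ≤ 2 ^ 18 * (2 ^ X) ^ 6 := h3.trans (by gcongr; norm_num)
    have h720 : 720 ≤ 2 ^ 10 := by norm_num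
    have h36 : 36 ≤ 2 ^ 6 := by norm_num
    gcongr
  have h10 : 2 ^ 10 * (2 ^ X) ^ 5 * (2 ^ 18 * (2 ^ X) ^ 6) * (2 * (2 ^ 6 * (2 ^ X) ^ 2) ^ X) =
      2 ^ (29 + 17 * X + 2 * X ^ 2) := by
    have : (2 ^ 6 * (2 ^ X) ^ 2) ^ X = 2 ^ (6 * X + 2 * X ^ 2) := by
      rw [← pow_mul, ← pow_add, ← pow_mul]; congr 1; ring
    rw [this]
    ring
  have h11 : 2 * (choice X).cells + 1 ≤ 2 ^ (29 + 17 * X + 2 * X ^ 2 + 2) := by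
    rw [h10] at h9
    rw [pow_add _ _ 2]
    have : 1 ≤ 2 ^ (29 + 17 * X + 2 * X ^ 2) := Nat.one_le_two_pow
    omega
  exact h11.trans (Nat.pow_le_pow_right (by norm_num) (by nlinarith))

/-- The number of steps on problems of scale `X`. -/
lemma IsScale.always_projectiveClustering (hX : IsScale k j ε α ω X) [NeZero n] (hjd : j ≤ d)
    (P : Fin n → Vec d) : (projectiveClustering (choice X) k j P).Always
      (n * d * 2 ^ (65 * 230000 ^ 3 * X ^ 20)) fun _ => True := by
  obtain ⟨h1, h2, h3, h4, h5⟩ := two_mul_cells_le hX.one_le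
  have hX6 : X ≤ 230000 * X ^ 6 :=
    (Nat.le_self_pow (by norm_num) X).trans (Nat.le_mul_of_pos_left _ (by norm_num))
  have hk : k ≤ X := (Nat.le_mul_of_pos_right k hX.one_le_j).trans hX.mul_le
  have hj : j ≤ X := (Nat.le_mul_of_pos_left j hX.one_le_k).trans hX.mul_le
  refine (ProjClust.always_projectiveClustering hX.one_le_k hX.one_le_j hjd P (choice X)
    (hk.trans hX6) (hj.trans hX6) h2 h3 h4 h5 h1).mono ?_ fun _ h => h
  refine Nat.mul_le_mul_left _ (Nat.pow_le_pow_right (by norm_num) ?_)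
  have hy : 1 ≤ 230000 * X ^ 6 := hX.one_le.trans hX6
  have hX2 : 1 ≤ X ^ 2 := Nat.one_le_pow _ _ hX.one_le
  -- With `y = 230000 X⁶` and `m = 50X²` the exponent is `9 + 3y + y² + 2y³ + my³`, at most `65X²y³`
  -- because `9 + 3 + 1 + 2 + 50 = 65`.
  have h6 : 65 * 230000 ^ 3 * X ^ 20 = 65 * X ^ 2 * (230000 * X ^ 6) ^ 3 := by ring
  rw [h6]
  generalize 230000 * X ^ 6 = y at hy
  generalize X ^ 2 = x at hX2
  obtain ⟨y, rfl⟩ := Nat.exists_eq_add_of_le hy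
  obtain ⟨x, rfl⟩ := Nat.exists_eq_add_of_le hX2
  zify
  rw [← sub_nonneg]
  ring_nf
  positivity

end Final

end ProjClust

/-! ### The theorem: explicit constants and parameters. -/

theorem theorem7 :
    ∃ (c : ℝ) (C : ℝ) (p : Polynomial ℝ) (prm : ℕ → ℕ → ℝ → ℝ → ℝ → ProjClust.Params), 0 < c ∧
      ∀ (k j : ℕ) (ε α ω : ℝ), 1 ≤ k → 1 ≤ j → 0 < ε → ε ≤ 1 → 0 < α → α ≤ 1 / (k : ℝ) → 1 ≤ ω →
      ∀ (d n : ℕ) [NeZero n] (P : Fin n → ProjClust.Vec d), j ≤ d →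
        (∀ t ∈ (ProjClust.projectiveClustering (prm k j ε α ω) k j P).law.support,
          (t.steps : ℝ) ≤
            C * (2 : ℝ) ^ (p.eval ((k : ℝ) * (j : ℝ) * ω / (ε * α))) * (n : ℝ) * (d : ℝ)) ∧
        ∀ (F : Fin k → AffineSubspace ℝ (ProjClust.Vec d)) (cl : Fin n → Fin k),
          ProjClust.IsOptimal j P F → ProjClust.IsNearest P F cl →
          (∀ l, ProjClust.IsRegular ω (ProjClust.cluster cl l) P) →
          (∀ l, α * (n : ℝ) ≤ ((ProjClust.cluster cl l).card : ℝ)) →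
          ENNReal.ofReal c ≤
            (ProjClust.projectiveClustering (prm k j ε α ω) k j P).law.toOuterMeasure
              {t | ProjClust.IsSolution k j P ((1 + ε) * ProjClust.objective P F) t.val} := by
  -- The step bound is a power of two in the integer scale `⌈x⌉₊`. Since `⌈x⌉₊ ≤ x + 1`, a
  -- polynomial in `x + 1` dominates its exponent; the degree is `20 = 3 · 6 + 2`.
  refine ⟨1 / 2, 1, Polynomial.C (65 * 230000 ^ 3) * (Polynomial.X + 1) ^ 20,
    fun k j ε α ω => ProjClust.choice ⌈(k : ℝ) * j * ω / (ε * α)⌉₊, by norm_num, ?_⟩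
  intro k j ε α ω hk hj hε hε1 hα hαk hω d n _ P hjd
  have hX := ProjClust.isScale_ceil hk hj hε hε1 hα hαk hω
  refine ⟨fun t ht => ?_, fun F cl hF hcl hreg hclα => ?_⟩
  · have h1 := (hX.always_projectiveClustering hjd P t ht).2
    set x := (k : ℝ) * j * ω / (ε * α) with hx
    have hx0 : 0 ≤ x := by positivity
    have h2 : (⌈x⌉₊ : ℝ) ≤ x + 1 := (Nat.ceil_lt_add_one hx0).le
    have h3 : (2 : ℝ) ^ (65 * 230000 ^ 3 * ⌈x⌉₊ ^ 20) ≤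
        (2 : ℝ) ^ ((Polynomial.C (65 * 230000 ^ 3) * (Polynomial.X + 1) ^ 20 :
          Polynomial ℝ).eval x) := by
      rw [← Real.rpow_natCast]
      refine Real.rpow_le_rpow_of_exponent_le (by norm_num) ?_
      simp only [Polynomial.eval_mul, Polynomial.eval_C, Polynomial.eval_pow, Polynomial.eval_add,
        Polynomial.eval_X, Polynomial.eval_one]
      rw [Nat.cast_mul, Nat.cast_pow]
      refine mul_le_mul (by norm_num) (by gcongr) (by positivity) (by norm_num)
    calc (t.steps : ℝ) ≤ ((n * d * 2 ^ (65 * 230000 ^ 3 * ⌈x⌉₊ ^ 20) : ℕ) : ℝ) := by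
          exact_mod_cast h1
      _ = 2 ^ (65 * 230000 ^ 3 * ⌈x⌉₊ ^ 20) * n * d := by
          rw [Nat.cast_mul, Nat.cast_mul, Nat.cast_pow, Nat.cast_ofNat]; ring
      _ ≤ _ := by rw [one_mul]; gcongr
  · have h1 := ProjClust.Rand.toOuterMeasure_ge
      (hX.projectiveClustering_except hjd hF hcl hreg hclα)
    norm_num at h1 ⊢
    exact h1

end
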